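/- Let $D$ be an unoriented link diagram on the sphere (equivalently, in the plane) with $N$ crossings, and suppose that $D$ is alternating, non-split (i.e. non-empty and connected as a subset of the sphere) and has no nugatory crossing (a crossing is nugatory if some simple closed curve meets $D$ in that crossing only and separates two adjacent strand ends there from the other two). A Kauffman state $s$ assigns a marker $\pm1$ to each crossing; $D_s$ is the system of circles obtained by smoothing every crossing according to its marker (the positive marker joins the two corners swept out when the upper strand is rotated counterclockwise), and $|s|$ is the number of its circles. Let $s_+$ and $s_-$ be the states with all markers positive and all markers negative. An enhanced state $S$ is a state $s$ with a sign for each circle of $D_s$; $\sigma(S)$ is the sum of the markers and $\tau(S)$ the sum of the signs of the circles. Let $C_{i,j}(D)$ be the free abelian group on the enhanced states with $\sigma(S)=i$ and $\sigma(S)+2\tau(S)=j$, and, for a fixed ordering of the crossings, let $d\colon C_{i,j}(D)\to C_{i-2,j}(D)$, $d(S)=\sum_{S'}(-1)^{t(S:S')}[S:S']\,S'$, where $[S:S']=1$ if the markers of $S$ and $S'$ differ at exactly one crossing $c$ and the circles not touching $c$ have the same signs in $S$ and $S'$, $[S:S']=0$ otherwise, and $t(S:S')$ is the number of negative markers of $S$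 at crossings bigger than $c$. Let $H_{i,j}(D)=\ker(d|_{C_{i,j}(D)})/d(C_{i+2,j}(D))$ be the Khovanov homology with integer coefficients. For integers $k_1,k_2$, call $D$ $H$-$(k_1,k_2)$-thick if $H_{i,j}(D)\neq0$ implies $$N-2|s_-|-4k_2\le j-2i\le 2|s_+|-N+4k_1,$$ and call $D$ $H$-$k$-thick if it is $H$-$(k_1,k_2)$-thick for some integers $k_1,k_2$ with $k\ge k_1+k_2+\tfrac12(|s_+|+|s_-|-N)$. Then $D$ is $H$-$(0,0)$-thick and $H$-$1$-thick. Moreover, its Khovanov homology lies on two adjacent diagonals of slope $2$: one has $2|s_+|-N=N-2|s_-|+4$, and $H_{i,j}(D)\neq 0$ implies $j-2i=N-2|s_-|$ or $j-2i=2|s_+|-N$. -/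

import Mathlib

universe u

/-- The four ends of the strands at each crossing of a link diagram whose set of crossings is `V`.
At a crossing `v` the ends `(v, 0), (v, 1), (v, 2), (v, 3)` are listed in counterclockwise order;
`(v, 0)` and `(v, 2)` are the two ends of the lower strand, `(v, 1)` and `(v, 3)` the two ends of
the upper strand. -/
abbrev CrossingEnd (V : Type u) : Type u := V × Fin 4

namespace CrossingEnd

variable {V : Type u}

/-- The counterclockwise next end at the same crossing. -/
def next (x : CrossingEnd V) : CrossingEnd V := (x.1, x.2 + 1)

/-- The end belongs to the upper strand of its crossing. -/
def IsOver (x : CrossingEnd V) : Prop := x.2 = 1 ∨ x.2 = 3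

/-- The regions cut out on the oriented surface that is described by the rotation system
(`next`, `edge`): orbits of "run along the edge that starts at `x`, then turn to the
counterclockwise next end".  The end `(v, k)` represents the region at `v` that lies between the
ends `(v, k - 1)` and `(v, k)`. -/
def Region (edge : CrossingEnd V → CrossingEnd V) : Type u :=
  Quot fun x y : CrossingEnd V => y = next (edge x)

/-- The connected components of the four-valent graph with vertices `V` and edges `{x, edge x}`. -/
def GraphComponent (edge : CrossingEnd V → CrossingEnd V) : Type u :=
  Quot fun x y : CrossingEnd V => y.1 = x.1 ∨ y = edge x

end CrossingEnd

/-- An unoriented link diagram on the sphere, up to isotopy, with (finite) set of crossings `V`.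
`edge` says which ends of strands are joined by the arcs of the diagram, and `circles` is the number
of components of the diagram that have no crossings.  Each connected component of the underlying
four-valent graph has genus zero: (number of crossings) - (number of edges) + (number of regions) =
2 (number of components), where the number of edges is twice the number of crossings. -/
structure LinkDiagram (V : Type u) [Fintype V] where
  edge : CrossingEnd V → CrossingEnd V
  edge_edge : ∀ x, edge (edge x) = x
  edge_ne : ∀ x, edge x ≠ x
  circles : ℕ
  planar : (Fintype.card V : ℤ) - 2 * Fintype.card V + Nat.card (CrossingEnd.Region edge)
    = 2 * Nat.card (CrossingEnd.GraphComponent edge)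

namespace LinkDiagram

open CrossingEnd

variable {V : Type u} [Fintype V]

/-- The connected components of the diagram as a subset of the sphere. -/
def Piece (D : LinkDiagram V) : Type u := GraphComponent D.edge ⊕ Fin D.circles

/-- A (non-empty) diagram is non-split if it is not the disjoint union of two non-empty diagrams,
that is, if it is connected. -/
def NonSplit (D : LinkDiagram V) : Prop := Nat.card D.Piece = 1

/-- Travelling along the diagram one passes alternately over and under: each edge joins an
end of an upper strand to an end of a lower strand. -/
def Alternating (D : LinkDiagram V) : Prop := ∀ x, IsOver (D.edge x) ↔ ¬ IsOver x

/-- A crossing is nugatory if two opposite corners at it lie in the same region, that is, if there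
is a simple closed curve on the sphere which meets the diagram in this crossing only and
separates two adjacent ends there from the other two. -/
def Nugatory (D : LinkDiagram V) (v : V) : Prop :=
  ∃ k : Fin 4, (Quot.mk _ (v, k) : Region D.edge) = Quot.mk _ (v, k + 2)

/-- Kauffman states: a marker `+1` or `-1` at each crossing. -/
abbrev State (_D : LinkDiagram V) : Type u := V → ℤˣ

/-- How smoothing with a given marker reconnects the four ends at a crossing.  The positive marker
joins the two corners that the upper strand sweeps when it is rotated counterclockwise, so it
connects end `0` to `1` and `2` to `3`; the negative marker connects `1` to `2` and `3` to `0`. -/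
def smoothing (m : ℤˣ) (k : Fin 4) : Fin 4 :=
  if m = 1 then ![1, 0, 3, 2] k else ![3, 2, 1, 0] k

/-- The circles of `D_s` that run through smoothed crossings. -/
def ArcCircle (D : LinkDiagram V) (s : D.State) : Type u :=
  Quot fun x y : CrossingEnd V => y = D.edge x ∨ y = (x.1, smoothing (s x.1) x.2)

/-- All circles of `D_s`. -/
def Circle (D : LinkDiagram V) (s : D.State) : Type u := D.ArcCircle s ⊕ Fin D.circles

instance (D : LinkDiagram V) (s : D.State) : Finite (D.Circle s) :=
  inferInstanceAs (Finite (Quot _ ⊕ Fin D.circles))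

/-- The circle of `D_s` through the end `x`. -/
def circleAt (D : LinkDiagram V) (s : D.State) (x : CrossingEnd V) : D.Circle s :=
  Sum.inl (Quot.mk _ x)

/-- The circle of `D_s` given by a crossingless component of `D`. -/
def freeCircle (D : LinkDiagram V) (s : D.State) (a : Fin D.circles) : D.Circle s := Sum.inr a

/-- `|s|`, the number of circles of `D_s`. -/
noncomputable def numCircles (D : LinkDiagram V) (s : D.State) : ℕ := Nat.card (D.Circle s)

/-- The state `s_+`. -/
def posState (D : LinkDiagram V) : D.State := fun _ => 1

/-- The state `s_-`. -/
def negState (D : LinkDiagram V) : D.State := fun _ => -1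

/-- Enhanced Kauffman states: a state `s` and a sign for each circle of `D_s`. -/
structure EnhancedState (D : LinkDiagram V) : Type u where
  state : D.State
  sign : D.Circle state → ℤˣ

namespace EnhancedState

variable {D : LinkDiagram V}

/-- `σ(S)`: the number of positive markers minus the number of negative markers. -/
def σ (S : D.EnhancedState) : ℤ := ∑ v, (S.state v : ℤ)

/-- `τ(S)`: the number of positive circles minus the number of negative circles. -/
noncomputable def τ (S : D.EnhancedState) : ℤ := ∑ᶠ c, (S.sign c : ℤ)

/-- The circle of `D_S` through the end `x` passes the smoothed crossing `c`. -/
def Touches (S : D.EnhancedState) (x : CrossingEnd V) (c : V) : Prop :=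
  ∃ k, D.circleAt S.state x = D.circleAt S.state (c, k)

/-- `[S : S'] = 1`, the markers differing at the crossing `c`: the bidegree of `S'` is that
of `S` plus `(-2, 0)`, the markers of `S` and `S'` differ exactly at `c`, and all circles that do
not touch `c` (they are circles of both `D_S` and `D_{S'}`) have the same sign in `S` and `S'`. -/
structure Incident (S S' : D.EnhancedState) (c : V) : Prop where
  left_degree : S'.σ = S.σ - 2
  right_degree : S'.σ + 2 * S'.τ = S.σ + 2 * S.τ
  differ : S.state c ≠ S'.state c
  agree : ∀ v, v ≠ c → S.state v = S'.state v
  sign_eq : ∀ x, ¬ S.Touches x c →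
    S.sign (D.circleAt S.state x) = S'.sign (D.circleAt S'.state x)
  free_sign_eq : ∀ a, S.sign (D.freeCircle S.state a) = S'.sign (D.freeCircle S'.state a)

variable [LinearOrder V]

/-- The number of negative markers of `S` at crossings bigger than `c`. -/
def t (S : D.EnhancedState) (c : V) : ℕ :=
  (Finset.univ.filter fun v => c < v ∧ S.state v = -1).card

open Classical in
/-- `(-1)^{t(S:S')} [S : S']`; at most one summand is non-zero. -/
noncomputable def incidence (S S' : D.EnhancedState) : ℤ :=
  ∑ c, if S.Incident S' c then (-1) ^ S.t c else 0

end EnhancedState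

instance (D : LinkDiagram V) : Finite D.EnhancedState :=
  Finite.of_injective
    (fun S => (⟨S.state, S.sign⟩ : (s : D.State) × (D.Circle s → ℤˣ)))
    (by rintro ⟨s, f⟩ ⟨s', f'⟩ h; cases h; rfl)

/-- The chain group `C(D)`, free abelian on the enhanced states. -/
abbrev Chain (D : LinkDiagram V) : Type u := D.EnhancedState →₀ ℤ

/-- `C_{i,j}(D)`, spanned by the `S` with `σ(S) = i` and `σ(S) + 2 τ(S) = j`. -/
def chain (D : LinkDiagram V) (i j : ℤ) : Submodule ℤ D.Chain :=
  Finsupp.supported ℤ ℤ {S : D.EnhancedState | S.σ = i ∧ S.σ + 2 * S.τ = j}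

variable [LinearOrder V]

/-- The differential `d(S) = ∑_{S'} (-1)^{t(S:S')} [S : S'] S'`.  It maps `C_{i,j}(D)` to
`C_{i-2,j}(D)`. -/
noncomputable def d (D : LinkDiagram V) : D.Chain →ₗ[ℤ] D.Chain :=
  Finsupp.linearCombination ℤ fun S => ∑ᶠ S', S.incidence S' • Finsupp.single S' (1 : ℤ)

/-- The cycles in `C_{i,j}(D)`. -/
noncomputable def cycles (D : LinkDiagram V) (i j : ℤ) : Submodule ℤ D.Chain :=
  D.chain i j ⊓ LinearMap.ker D.d

/-- The boundaries in `C_{i,j}(D)`, the image of `C_{i+2,j}(D)`. -/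
noncomputable def boundaries (D : LinkDiagram V) (i j : ℤ) : Submodule ℤ D.Chain :=
  (D.chain (i + 2) j).map D.d

/-- Khovanov homology `H_{i,j}(D)`, with integer coefficients. -/
abbrev H (D : LinkDiagram V) (i j : ℤ) : Type u :=
  D.cycles i j ⧸ (D.boundaries i j).submoduleOf (D.cycles i j)

/-- `D` is `H`-`(k₁, k₂)`-thick. -/
def HThickPair (D : LinkDiagram V) (k₁ k₂ : ℤ) : Prop :=
  ∀ i j : ℤ, Nontrivial (D.H i j) →
    (Fintype.card V : ℤ) - 2 * D.numCircles D.negState - 4 * k₂ ≤ j - 2 * i ∧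
      j - 2 * i ≤ 2 * D.numCircles D.posState - (Fintype.card V : ℤ) + 4 * k₁

/-- `D` is `H`-`k`-thick. -/
def HThick (D : LinkDiagram V) (k : ℤ) : Prop :=
  ∃ k₁ k₂ : ℤ, D.HThickPair k₁ k₂ ∧
    (k₁ : ℚ) + k₂ + 1 / 2 * ((D.numCircles D.posState : ℚ) + D.numCircles D.negState
      - Fintype.card V) ≤ k

end LinkDiagram

/-!
In an alternating diagram every edge leads from an upper end to a lower end, and every smoothing
joins a lower end to an upper end. So the circles of a Kauffman state are the cycles of a
permutation of the upper ends, and changing a marker multiplies this permutation by a transposition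
(`circleAt_opposite_flip`): it merges two circles or splits one. Signs of circles are read in the
Frobenius algebra `ℤ[X]/(X²)`, with `+` for `X` and `-` for `1`. The unsigned differential commutes
with multiplication by the class `X` of each circle (`step_raise`), hence is determined by its
values on all-negative enhanced states, where `d² = 0` is checked by following merges and splits
(`step_step_bot`, `d_d`).

All complexes in the argument are subquotients of the Khovanov complex of the given diagram, spanned
by convex sets of enhanced states. The positive signs at a base point `p` span a subcomplex whose
quotient is another copy of it with `j` shifted by `4`. So it suffices that this reduced complex has
homology on the single diagonal `j - 2 i = 2 |s₊| - N` only (`exactOn_reduced`). This is shown for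
all connected planar partially smoothed diagrams and all base points, by induction on the number of
crossings which are left. Following the strand through `p` one meets such a crossing `c`, and `p`
may be moved to it. If both smoothings of `c` are connected, the long exact sequence applies, since
the diagonal is the same for both. Otherwise just one smoothing is connected, and the strands at `c`
lie in different components after the other one (`ConnectedPlanar.smooth`). The differential between
the two smoothings then always merges the circle of `p` with the circle on the other side of `c`, or
always splits such a circle off. It is an isomorphism once the sign of the other circle is
prescribed, and what remains is the reduced complex of the connected smoothing in shifted degrees
(`exactOn_of_merge`, `exactOn_of_split`).

Instead of planarity the induction uses the equation `|s₊| + |s₋| = N + 2`. It comes from Euler's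
formula, since the regions of an alternating diagram are the circles of `s₊` and `s₋`
(`regionEquiv`), and it persists thanks to the inequality `numCircles_add_le`.
-/

/-! ### Cycles of permutations and circles of alternating diagrams -/

/-- If `a` returns to itself under `f` without passing `b`, then `b` is not on its cycle. -/
theorem Equiv.Perm.not_sameCycle_of_return {α : Type*} [Finite α] {f : Equiv.Perm α} {a b : α}
    {m : ℕ} (hab : a ≠ b) (hm : (f ^ m) a = a) (hpos : 0 < m)
    (h : ∀ i, 0 < i → i < m → (f ^ i) a ≠ b) : ¬ f.SameCycle a b := by
  intro hs
  obtain ⟨n, hn⟩ := hs.exists_nat_pow_eq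
  have hp : ∀ q : ℕ, ((f ^ m) ^ q) a = a := by
    intro q
    induction q with
    | zero => rfl
    | succ q ih => rw [pow_succ, Equiv.Perm.mul_apply, hm, ih]
  rw [← Nat.mod_add_div n m, pow_add, pow_mul, Equiv.Perm.mul_apply, hp] at hn
  rcases Nat.eq_zero_or_pos (n % m) with h0 | h0
  · rw [h0] at hn
    exact hab hn
  · exact h _ h0 (Nat.mod_lt _ hpos) hn

/-- Multiplying a permutation by the transposition of `a` and `b` joins their cycles if these are
distinct, and cuts their common cycle in two otherwise. -/
theorem Equiv.Perm.sameCycle_swap_mul_iff {α : Type*} [Finite α] [DecidableEq α]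
    (f : Equiv.Perm α) {a b : α} (hab : a ≠ b) :
    (Equiv.swap a b * f).SameCycle a b ↔ ¬ f.SameCycle a b := by
  have hex : ∃ m, 0 < m ∧ ((f ^ m) a = a ∨ (f ^ m) a = b) :=
    ⟨orderOf f, orderOf_pos f, Or.inl (by rw [pow_orderOf_eq_one]; rfl)⟩
  classical
  -- `m` is the time of the first visit to `{a, b}`; until then both permutations agree on `a`
  obtain ⟨m, ⟨hpos, hm⟩, hmin⟩ := Nat.findX hex
  set g := Equiv.swap a b * f with hg
  have hstep : ∀ i < m, (g ^ i) a = (f ^ i) a := by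
    intro i
    induction i with
    | zero => intro _; rfl
    | succ i ih =>
      intro hi
      have hne := hmin (i + 1) hi
      rw [pow_succ', pow_succ', Equiv.Perm.mul_apply, Equiv.Perm.mul_apply f, ih (by omega), hg,
        Equiv.Perm.mul_apply, Equiv.swap_apply_of_ne_of_ne]
      · intro h
        exact hne ⟨by omega, Or.inl (by rw [pow_succ', Equiv.Perm.mul_apply, h])⟩
      · intro h
        exact hne ⟨by omega, Or.inr (by rw [pow_succ', Equiv.Perm.mul_apply, h])⟩
  have hlast : (g ^ m) a = Equiv.swap a b ((f ^ m) a) := by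
    obtain ⟨k, rfl⟩ : ∃ k, m = k + 1 := ⟨m - 1, by omega⟩
    rw [pow_succ', pow_succ', Equiv.Perm.mul_apply, Equiv.Perm.mul_apply f, hstep k (by omega), hg,
      Equiv.Perm.mul_apply]
  rcases hm with hm | hm
  · rw [hm, Equiv.swap_apply_left] at hlast
    have h1 : g.SameCycle a b := ⟨m, by rw [zpow_natCast, hlast]⟩
    have h2 : ¬ f.SameCycle a b :=
      not_sameCycle_of_return hab hm hpos fun i h0 hi h => hmin i hi ⟨h0, Or.inr h⟩
    exact iff_of_true h1 h2
  · rw [hm, Equiv.swap_apply_right] at hlast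
    have h1 : f.SameCycle a b := ⟨m, by rw [zpow_natCast, hm]⟩
    have h2 : ¬ g.SameCycle a b :=
      not_sameCycle_of_return hab hlast hpos fun i h0 hi h =>
        hmin i hi ⟨h0, Or.inr (by rw [← hstep i hi, h])⟩
    exact iff_of_false h2 (not_not.2 h1)

/-- Let `q : α → β` be surjective and identify nothing but the two distinct elements `a` and `b`.
If `f` and `g` correspond under `q` away from `a` and `b`, then their sums over all other elements
agree. -/
theorem sum_sub_eq_of_identify {α β : Type*} [Fintype α] [Fintype β] (q : α → β) {a b : α}
    (hq : Function.Surjective q) (hab : a ≠ b) (hqab : q a = q b)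
    (hinj : ∀ x y, q x = q y → x = y ∨ ((x = a ∨ x = b) ∧ (y = a ∨ y = b)))
    (f : α → ℤ) (g : β → ℤ) (hfg : ∀ x, x ≠ a → x ≠ b → f x = g (q x)) :
    ∑ x, f x - f a - f b = ∑ y, g y - g (q a) := by
  classical
  have h1 : ∑ x, f x = f a + (f b + ∑ x ∈ (Finset.univ.erase a).erase b, f x) := by
    rw [Finset.add_sum_erase _ f (by simp [hab.symm]), Finset.add_sum_erase _ f (by simp)]
  have h2 : ∑ y, g y = g (q a) + ∑ y ∈ Finset.univ.erase (q a), g y := by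
    rw [Finset.add_sum_erase _ g (by simp)]
  have h3 : ∑ x ∈ (Finset.univ.erase a).erase b, f x = ∑ y ∈ Finset.univ.erase (q a), g y := by
    refine Finset.sum_bij (fun x _ => q x) ?_ ?_ ?_ ?_
    · intro x hx
      simp only [Finset.mem_erase, Finset.mem_univ, and_true, ne_eq] at hx ⊢
      intro h
      rcases hinj x a h with h | h <;> tauto
    · intro x hx y hy h
      simp only [Finset.mem_erase, Finset.mem_univ, and_true, ne_eq] at hx hy
      rcases hinj x y h with h | h <;> tauto
    · intro y hy
      obtain ⟨x, rfl⟩ := hq y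
      simp only [Finset.mem_erase, Finset.mem_univ, and_true, ne_eq] at hy
      refine ⟨x, ?_, rfl⟩
      simp only [Finset.mem_erase, Finset.mem_univ, and_true, ne_eq]
      exact ⟨fun h => hy (by rw [h, hqab]), fun h => hy (by rw [h])⟩
    · intro x hx
      simp only [Finset.mem_erase, Finset.mem_univ, and_true, ne_eq] at hx
      exact hfg x hx.2 hx.1
  linarith

theorem card_eq_of_identify {α β : Type*} [Finite α] [Finite β] (q : α → β) {a b : α}
    (hq : Function.Surjective q) (hab : a ≠ b) (hqab : q a = q b)
    (hinj : ∀ x y, q x = q y → x = y ∨ ((x = a ∨ x = b) ∧ (y = a ∨ y = b))) :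
    Nat.card α = Nat.card β + 1 := by
  have := Fintype.ofFinite α
  have := Fintype.ofFinite β
  have := sum_sub_eq_of_identify q hq hab hqab hinj (fun _ => 1) (fun _ => 1) fun _ _ _ => rfl
  simp only [Finset.sum_const, Finset.card_univ, nsmul_eq_mul, mul_one] at this
  rw [Nat.card_eq_fintype_card, Nat.card_eq_fintype_card]
  omega

namespace LinkDiagram

open CrossingEnd

variable {V : Type u} [Fintype V]

theorem smoothing_smoothing (m : ℤˣ) (k : Fin 4) : smoothing m (smoothing m k) = k := by
  unfold smoothing
  split_ifs <;> fin_cases k <;> rfl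

section Circles

variable {D : LinkDiagram V} {s s' : D.State} {c : V}

theorem circleAt_edge (x : CrossingEnd V) : D.circleAt s (D.edge x) = D.circleAt s x :=
  congrArg Sum.inl
    (Quot.sound (r := fun x y => y = D.edge x ∨ y = (x.1, smoothing (s x.1) x.2)) (Or.inl rfl)).symm

theorem circleAt_smoothing (v : V) (k : Fin 4) :
    D.circleAt s (v, smoothing (s v) k) = D.circleAt s (v, k) :=
  congrArg Sum.inl (Quot.sound (r := fun x y => y = D.edge x ∨ y = (x.1, smoothing (s x.1) x.2))
    (a := (v, k)) (Or.inr rfl)).symm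

/-- Lying on one circle of `D_s` is the smallest equivalence relation that is compatible with the
edges and the smoothings. -/
theorem rel_of_circleAt_eq {r : CrossingEnd V → CrossingEnd V → Prop} (hr : Equivalence r)
    (hedge : ∀ x, r x (D.edge x)) (hsm : ∀ v k, r (v, k) (v, smoothing (s v) k))
    {x y : CrossingEnd V} (h : D.circleAt s x = D.circleAt s y) : r x y := by
  let S : Setoid (CrossingEnd V) := ⟨r, hr⟩
  have h' := Sum.inl.inj h
  have := congrArg (Quot.lift (Quotient.mk S) (by
    rintro x y (rfl | rfl)
    · exact Quotient.sound (hedge x)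
    · exact Quotient.sound (hsm x.1 x.2))) h'
  exact Quotient.exact this

/-- The ends at a crossing run through at most two circles, those of two opposite ends. -/
theorem circleAt_crossing (s : D.State) (c : V) (k l : Fin 4) :
    D.circleAt s (c, l) = D.circleAt s (c, k) ∨ D.circleAt s (c, l) = D.circleAt s (c, k + 2) := by
  have h := fun l => circleAt_smoothing (D := D) (s := s) c l
  have h0 := h 0
  have h1 := h 1
  have h2 := h 2
  have h3 := h 3
  rcases Int.units_eq_one_or (s c) with hs | hs <;> rw [hs] at h0 h1 h2 h3 <;>
    simp [smoothing] at h0 h1 h2 h3 <;> fin_cases k <;> fin_cases l <;> simp <;> simp_all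

/-- Whether both strands of a smoothed crossing lie on one circle can be tested on either pair of
opposite ends. -/
theorem circleAt_opposite_iff (s : D.State) (c : V) (k l : Fin 4) :
    D.circleAt s (c, k) = D.circleAt s (c, k + 2) ↔
      D.circleAt s (c, l) = D.circleAt s (c, l + 2) := by
  have h := fun l => circleAt_smoothing (D := D) (s := s) c l
  have h0 := h 0
  have h1 := h 1
  have h2 := h 2
  have h3 := h 3
  rcases Int.units_eq_one_or (s c) with hs | hs <;> rw [hs] at h0 h1 h2 h3 <;>
    simp [smoothing] at h0 h1 h2 h3 <;> fin_cases k <;> fin_cases l <;> simp <;> grind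

/-- The circle of `D_s` through `x` passes the smoothed crossing `c`. -/
def Meets (D : LinkDiagram V) (s : D.State) (c : V) (x : CrossingEnd V) : Prop :=
  ∃ k, D.circleAt s x = D.circleAt s (c, k)

theorem meets_iff (k : Fin 4) {x : CrossingEnd V} : D.Meets s c x ↔
    D.circleAt s x = D.circleAt s (c, k) ∨ D.circleAt s x = D.circleAt s (c, k + 2) := by
  constructor
  · rintro ⟨l, hl⟩
    rw [hl]
    exact circleAt_crossing s c k l
  · rintro (h | h)
    exacts [⟨_, h⟩, ⟨_, h⟩]

theorem meets_congr {x y : CrossingEnd V} (h : D.circleAt s x = D.circleAt s y) :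
    D.Meets s c x ↔ D.Meets s c y := by
  unfold Meets
  rw [h]

theorem meets_self (k : Fin 4) : D.Meets s c (c, k) := ⟨k, rfl⟩

/-- Changing the marker at `c` leaves the circles away from `c` unchanged. -/
theorem circleAt_eq_or_meets (h : ∀ v, v ≠ c → s v = s' v) {x y : CrossingEnd V}
    (hxy : D.circleAt s x = D.circleAt s y) :
    D.circleAt s' x = D.circleAt s' y ∨ (D.Meets s' c x ∧ D.Meets s' c y) := by
  refine rel_of_circleAt_eq (r := fun x y => D.circleAt s' x = D.circleAt s' y ∨
    (D.Meets s' c x ∧ D.Meets s' c y)) ⟨fun _ => Or.inl rfl, ?_, ?_⟩ ?_ ?_ hxy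
  · rintro x y (h | h)
    exacts [Or.inl h.symm, Or.inr h.symm]
  · rintro x y z (h1 | h1) (h2 | h2)
    · exact Or.inl (h1.trans h2)
    · exact Or.inr ⟨(meets_congr h1).2 h2.1, h2.2⟩
    · exact Or.inr ⟨h1.1, (meets_congr h2).1 h1.2⟩
    · exact Or.inr ⟨h1.1, h2.2⟩
  · exact fun x => Or.inl (circleAt_edge x).symm
  · intro v k
    by_cases hv : v = c
    · subst hv
      exact Or.inr ⟨meets_self _, meets_self _⟩
    · rw [h v hv]
      exact Or.inl (circleAt_smoothing v k).symm

theorem meets_of_meets (h : ∀ v, v ≠ c → s v = s' v) {x : CrossingEnd V} (hx : D.Meets s c x) :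
    D.Meets s' c x := by
  obtain ⟨k, hk⟩ := hx
  rcases circleAt_eq_or_meets h hk with h | h
  exacts [⟨k, h⟩, h.1]

theorem meets_flip (h : ∀ v, v ≠ c → s v = s' v) {x : CrossingEnd V} :
    D.Meets s c x ↔ D.Meets s' c x :=
  ⟨meets_of_meets h, meets_of_meets fun v hv => (h v hv).symm⟩

theorem circleAt_flip_of_not_meets (h : ∀ v, v ≠ c → s v = s' v) {x y : CrossingEnd V}
    (hx : ¬ D.Meets s c x) :
    D.circleAt s x = D.circleAt s y ↔ D.circleAt s' x = D.circleAt s' y := by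
  constructor
  · intro hxy
    rcases circleAt_eq_or_meets h hxy with h' | h'
    · exact h'
    · exact absurd ((meets_flip h).2 h'.1) hx
  · intro hxy
    rcases circleAt_eq_or_meets (fun v hv => (h v hv).symm) hxy with h' | h'
    · exact h'
    · exact absurd h'.1 hx

/-- If the strands at `c` lie on one circle of `D_{s'}`, changing the marker at `c` from `s` to
`s'` only merges circles. -/
theorem circleAt_eq_of_merge (h : ∀ v, v ≠ c → s v = s' v) (k : Fin 4)
    (hc : D.circleAt s' (c, k) = D.circleAt s' (c, k + 2)) {x y : CrossingEnd V}
    (hxy : D.circleAt s x = D.circleAt s y) : D.circleAt s' x = D.circleAt s' y := by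
  rcases circleAt_eq_or_meets h hxy with h' | ⟨h1, h2⟩
  · exact h'
  · rw [meets_iff k, ← hc, or_self] at h1 h2
    rw [h1, h2]

end Circles

section Alternating

variable {D : LinkDiagram V}

omit [Fintype V] in
theorem isOver_smoothing (m : ℤˣ) (v : V) (k : Fin 4) :
    IsOver (v, smoothing m k) ↔ ¬ IsOver (v, k) := by
  unfold smoothing IsOver
  split_ifs <;> fin_cases k <;> simp

/-- The permutation of the upper ends of an alternating diagram that takes each of them to the next
upper end on its circle in `D_s`: along its edge to a lower end, then through the smoothed
crossing. -/
def nextOver (D : LinkDiagram V) (halt : D.Alternating) (s : D.State) :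
    Equiv.Perm {x : CrossingEnd V // IsOver x} where
  toFun x := ⟨((D.edge x).1, smoothing (s (D.edge x).1) (D.edge x).2), by
    rw [isOver_smoothing]
    exact fun h => (halt x).1 h x.2⟩
  invFun x := ⟨D.edge (x.1.1, smoothing (s x.1.1) x.1.2), by
    rw [halt, isOver_smoothing, not_not]
    exact x.2⟩
  left_inv x := by
    apply Subtype.ext
    simp [smoothing_smoothing, D.edge_edge]
  right_inv x := by
    apply Subtype.ext
    simp [smoothing_smoothing, D.edge_edge]

open Classical in
/-- The end of the edge at `x` that belongs to an upper strand. -/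
noncomputable def overEnd (D : LinkDiagram V) (halt : D.Alternating) (x : CrossingEnd V) :
    {x : CrossingEnd V // IsOver x} :=
  if h : IsOver x then ⟨x, h⟩ else ⟨D.edge x, (halt x).2 h⟩

variable (halt : D.Alternating) {s s' : D.State} {c : V}

theorem overEnd_of_isOver {x : CrossingEnd V} (h : IsOver x) : D.overEnd halt x = ⟨x, h⟩ :=
  dif_pos h

theorem overEnd_edge (x : CrossingEnd V) : D.overEnd halt (D.edge x) = D.overEnd halt x := by
  unfold overEnd
  by_cases h : IsOver x
  · have h' : ¬ IsOver (D.edge x) := fun h' => (halt x).1 h' h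
    simp [h, h', D.edge_edge]
  · have h' : IsOver (D.edge x) := (halt x).2 h
    simp [h, h']

/-- In an alternating diagram the circles of `D_s` are the cycles of the permutation
`nextOver`. -/
theorem circleAt_eq_iff_sameCycle {x y : CrossingEnd V} : D.circleAt s x = D.circleAt s y ↔
    (D.nextOver halt s).SameCycle (D.overEnd halt x) (D.overEnd halt y) := by
  constructor
  · have key : ∀ v k, ¬ IsOver (v, k) → (D.nextOver halt s).SameCycle (D.overEnd halt (v, k))
        (D.overEnd halt (v, smoothing (s v) k)) := by
      intro v k h
      have h' : IsOver (v, smoothing (s v) k) := by rwa [isOver_smoothing]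
      refine ⟨1, ?_⟩
      rw [overEnd_of_isOver halt h', zpow_one]
      apply Subtype.ext
      simp [nextOver, overEnd, h, D.edge_edge]
    refine fun hxy => rel_of_circleAt_eq (r := fun x y => (D.nextOver halt s).SameCycle
      (D.overEnd halt x) (D.overEnd halt y))
      ⟨fun _ => Equiv.Perm.SameCycle.refl _ _, fun h => h.symm, fun h h' => h.trans h'⟩ ?_ ?_ hxy
    · intro x
      rw [overEnd_edge]
    · intro v k
      by_cases h : IsOver (v, k)
      · have := key v (smoothing (s v) k) (by rw [isOver_smoothing, not_not]; exact h)
        rw [smoothing_smoothing] at this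
        exact this.symm
      · exact key v k h
  · intro h
    obtain ⟨n, hn⟩ := h.exists_nat_pow_eq
    have h1 : ∀ x, D.circleAt s (D.overEnd halt x).1 = D.circleAt s x := by
      intro x
      unfold overEnd
      split_ifs
      · rfl
      · exact circleAt_edge x
    have h2 : ∀ (n : ℕ) (o : {x : CrossingEnd V // IsOver x}),
        D.circleAt s (((D.nextOver halt s) ^ n) o).1 = D.circleAt s o.1 := by
      intro n o
      induction n with
      | zero => rfl
      | succ n ih =>
        rw [pow_succ', Equiv.Perm.mul_apply, ← ih]
        exact (circleAt_smoothing _ _).trans (circleAt_edge _)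
    rw [← h1 x, ← h1 y, ← hn, h2]

/-- Changing one marker of an alternating diagram always merges two circles or splits one: it
multiplies `nextOver` by the transposition of the two upper ends at the crossing. -/
theorem circleAt_opposite_flip (halt : D.Alternating) (h : ∀ v, v ≠ c → s v = s' v)
    (hc : s c ≠ s' c) (k : Fin 4) : D.circleAt s' (c, k) = D.circleAt s' (c, k + 2) ↔
      ¬ D.circleAt s (c, k) = D.circleAt s (c, k + 2) := by
  classical
  rw [circleAt_opposite_iff s' c k 1, circleAt_opposite_iff s c k 1,
    circleAt_eq_iff_sameCycle halt, circleAt_eq_iff_sameCycle halt]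
  have h1 : IsOver (c, (1 : Fin 4)) := Or.inl rfl
  have h3 : IsOver (c, (1 + 2 : Fin 4)) := Or.inr rfl
  rw [overEnd_of_isOver halt h1, overEnd_of_isOver halt h3]
  rw [← Equiv.Perm.sameCycle_swap_mul_iff _ (by simp)]
  suffices hs : D.nextOver halt s' = Equiv.swap ⟨(c, 1), h1⟩ ⟨(c, 1 + 2), h3⟩ * D.nextOver halt s by
    rw [hs]
  ext1 x
  rw [Equiv.Perm.mul_apply]
  have hu : ¬ IsOver (D.edge x) := fun h => (halt x).1 h x.2
  by_cases hv : (D.edge x).1 = c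
  · have hk : (D.edge x).2 = 0 ∨ (D.edge x).2 = 2 := by
      unfold IsOver at hu
      generalize (D.edge x).2 = l at hu
      fin_cases l <;> simp at hu ⊢
    have hval : ∀ t : D.State, D.nextOver halt t x = ⟨(c, smoothing (t c) (D.edge x).2), by
        rw [isOver_smoothing, ← hv]; exact hu⟩ := by
      intro t
      apply Subtype.ext
      simp [nextOver, hv]
    rw [hval, hval]
    rw [Equiv.swap_apply_def]
    rcases Int.units_eq_one_or (s c) with h1 | h1 <;> rcases Int.units_eq_one_or (s' c) with h2 | h2
    · exact absurd (h1.trans h2.symm) hc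
    · rcases hk with hk | hk <;> simp [hk, h1, h2, smoothing]
    · rcases hk with hk | hk <;> simp [hk, h1, h2, smoothing]
    · exact absurd (h1.trans h2.symm) hc
  · rw [Equiv.swap_apply_of_ne_of_ne]
    · apply Subtype.ext
      simp [nextOver, h _ hv]
    · intro h'
      exact hv (congrArg (fun y => y.1.1) h')
    · intro h'
      exact hv (congrArg (fun y => y.1.1) h')

end Alternating

end LinkDiagram

/-! ### Signs of circles and the incidence of enhanced states -/

namespace LinkDiagram

open CrossingEnd

variable {V : Type u} [Fintype V]

section Sums

variable {D : LinkDiagram V} {s s' : D.State} {c : V}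

theorem circleAt_surjective (h0 : D.circles = 0) (s : D.State) :
    Function.Surjective (D.circleAt s) := by
  rintro (⟨⟨x⟩⟩ | a)
  · exact ⟨x, rfl⟩
  · exact absurd a.2 (by omega)

/-- If changing the marker at `c` merges two circles, sums over the circles change at most by the
terms of the circles at `c`. -/
theorem finsum_circle_of_merge (h0 : D.circles = 0) (h : ∀ v, v ≠ c → s v = s' v) (k : Fin 4)
    (hs : D.circleAt s (c, k) ≠ D.circleAt s (c, k + 2))
    (hs' : D.circleAt s' (c, k) = D.circleAt s' (c, k + 2))
    (f : D.Circle s → ℤ) (g : D.Circle s' → ℤ)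
    (hfg : ∀ x, ¬ D.Meets s c x → f (D.circleAt s x) = g (D.circleAt s' x)) :
    ∑ᶠ C, f C - f (D.circleAt s (c, k)) - f (D.circleAt s (c, k + 2))
      = ∑ᶠ C, g C - g (D.circleAt s' (c, k)) := by
  have := Fintype.ofFinite (D.Circle s)
  have := Fintype.ofFinite (D.Circle s')
  rw [finsum_eq_sum_of_fintype, finsum_eq_sum_of_fintype]
  set q : D.Circle s → D.Circle s' :=
    fun C => D.circleAt s' (Function.surjInv (circleAt_surjective h0 s) C) with hq
  have hqx : ∀ x, q (D.circleAt s x) = D.circleAt s' x := fun x =>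
    circleAt_eq_of_merge h k hs' (Function.surjInv_eq (circleAt_surjective h0 s) _)
  have key := sum_sub_eq_of_identify q (a := D.circleAt s (c, k)) (b := D.circleAt s (c, k + 2))
    (fun C => by
      obtain ⟨x, rfl⟩ := circleAt_surjective h0 s' C
      exact ⟨_, hqx x⟩) hs (by rw [hqx, hqx, hs']) (by
      intro C C'
      obtain ⟨x, rfl⟩ := circleAt_surjective h0 s C
      obtain ⟨y, rfl⟩ := circleAt_surjective h0 s C'
      rw [hqx, hqx, ← meets_iff k, ← meets_iff k]
      exact circleAt_eq_or_meets fun v hv => (h v hv).symm) f g (by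
      intro C
      obtain ⟨x, rfl⟩ := circleAt_surjective h0 s C
      intro h1 h2
      rw [hqx]
      exact hfg x (by rw [meets_iff k]; tauto))
  rw [hqx] at key
  exact key

theorem numCircles_of_merge (h0 : D.circles = 0) (h : ∀ v, v ≠ c → s v = s' v) (k : Fin 4)
    (hs : D.circleAt s (c, k) ≠ D.circleAt s (c, k + 2))
    (hs' : D.circleAt s' (c, k) = D.circleAt s' (c, k + 2)) :
    D.numCircles s = D.numCircles s' + 1 := by
  have key := finsum_circle_of_merge h0 h k hs hs' (fun _ => 1) (fun _ => 1) fun _ _ => rfl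
  have h1 : ∀ t : D.State, ∑ᶠ _ : D.Circle t, (1 : ℤ) = D.numCircles t := by
    intro t
    have := Fintype.ofFinite (D.Circle t)
    rw [finsum_eq_sum_of_fintype, numCircles, Nat.card_eq_fintype_card]
    simp
  rw [h1, h1] at key
  omega

end Sums

/-- `s'` arises from `s` by changing the marker at `c` from `1` to `-1`. -/
structure IsDrop {D : LinkDiagram V} (s s' : D.State) (c : V) : Prop where
  pos : s c = 1
  neg : s' c = -1
  agree : ∀ v, v ≠ c → s v = s' v

namespace EnhancedState

variable {D : LinkDiagram V} {S S' : D.EnhancedState} {c : V}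

/-- The sign of the circle of `D_S` through the end `x`. -/
def lab (S : D.EnhancedState) (x : CrossingEnd V) : ℤˣ := S.sign (D.circleAt S.state x)

theorem lab_congr {x y : CrossingEnd V} (h : D.circleAt S.state x = D.circleAt S.state y) :
    S.lab x = S.lab y := congrArg S.sign h

/-- Enhanced states of diagrams without crossingless components are determined by the signs along
the ends. -/
theorem ext_lab (h0 : D.circles = 0) (hs : S.state = S'.state) (hl : ∀ x, S.lab x = S'.lab x) :
    S = S' := by
  obtain ⟨s, f⟩ := S
  obtain ⟨s', f'⟩ := S'
  obtain rfl : s = s' := hs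
  congr 1
  ext1 C
  obtain ⟨x, rfl⟩ := circleAt_surjective h0 s C
  exact hl x

/-- The enhanced state whose circle through `x` has sign `g x`; meaningful if `g` is constant
along the circles. -/
noncomputable def ofLab (h0 : D.circles = 0) (s : D.State) (g : CrossingEnd V → ℤˣ) :
    D.EnhancedState :=
  ⟨s, fun C => g (Function.surjInv (circleAt_surjective h0 s) C)⟩

theorem lab_ofLab (h0 : D.circles = 0) {s : D.State} {g : CrossingEnd V → ℤˣ}
    (hg : ∀ x y, D.circleAt s x = D.circleAt s y → g x = g y) (x : CrossingEnd V) :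
    (ofLab h0 s g).lab x = g x :=
  hg _ _ (Function.surjInv_eq (circleAt_surjective h0 s) _)

open Classical in
/-- Change the sign of the circle through `x` to `ε`. -/
noncomputable def relabel (S : D.EnhancedState) (x : CrossingEnd V) (ε : ℤˣ) : D.EnhancedState :=
  ⟨S.state, Function.update S.sign (D.circleAt S.state x) ε⟩

@[simp]
theorem relabel_state (S : D.EnhancedState) (x : CrossingEnd V) (ε : ℤˣ) :
    (S.relabel x ε).state = S.state := rfl

theorem lab_relabel_of_eq {x y : CrossingEnd V} {ε : ℤˣ}
    (h : D.circleAt S.state y = D.circleAt S.state x) : (S.relabel x ε).lab y = ε := by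
  classical
  unfold lab relabel
  simp only
  rw [h, Function.update_self]

theorem lab_relabel_self (x : CrossingEnd V) (ε : ℤˣ) : (S.relabel x ε).lab x = ε :=
  lab_relabel_of_eq rfl

theorem lab_relabel_of_ne {x y : CrossingEnd V} {ε : ℤˣ}
    (h : D.circleAt S.state y ≠ D.circleAt S.state x) : (S.relabel x ε).lab y = S.lab y := by
  classical
  unfold lab relabel
  simp only
  rw [Function.update_of_ne h]

theorem relabel_relabel (x : CrossingEnd V) (ε ε' : ℤˣ) :
    (S.relabel x ε).relabel x ε' = S.relabel x ε' := by
  unfold relabel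
  simp

theorem relabel_lab {x : CrossingEnd V} {ε : ℤˣ} (h : S.lab x = ε) : S.relabel x ε = S := by
  subst h
  unfold relabel lab
  simp

theorem relabel_congr {x y : CrossingEnd V} (h : D.circleAt S.state x = D.circleAt S.state y)
    (ε : ℤˣ) : S.relabel x ε = S.relabel y ε := by
  unfold relabel
  rw [h]

theorem relabel_comm {x y : CrossingEnd V} (h : D.circleAt S.state x ≠ D.circleAt S.state y)
    (ε ε' : ℤˣ) : (S.relabel x ε).relabel y ε' = (S.relabel y ε').relabel x ε := by
  classical
  unfold relabel
  simp only
  rw [Function.update_comm h]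

theorem τ_relabel (x : CrossingEnd V) (ε : ℤˣ) : (S.relabel x ε).τ = S.τ - S.lab x + ε := by
  classical
  have := Fintype.ofFinite (D.Circle S.state)
  have key : ∀ T : D.Circle S.state → ℤˣ, (∑ᶠ C, (T C : ℤ))
      = T (D.circleAt S.state x) + ∑ C ∈ Finset.univ.erase (D.circleAt S.state x), (T C : ℤ) := by
    intro T
    rw [finsum_eq_sum_of_fintype, Finset.add_sum_erase _ (fun C => (T C : ℤ)) (Finset.mem_univ _)]
  have h1 : S.τ = S.lab x + ∑ C ∈ Finset.univ.erase (D.circleAt S.state x), (S.sign C : ℤ) :=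
    key S.sign
  have h2 := key (S.relabel x ε).sign
  have h3 : (S.relabel x ε).sign (D.circleAt S.state x) = ε := lab_relabel_self x ε
  rw [h3] at h2
  have h4 : (S.relabel x ε).τ = _ := h2
  rw [h4, h1]
  have h5 : ∑ C ∈ Finset.univ.erase (D.circleAt S.state x), ((S.relabel x ε).sign C : ℤ)
      = ∑ C ∈ Finset.univ.erase (D.circleAt S.state x), (S.sign C : ℤ) := by
    refine Finset.sum_congr rfl fun C hC => ?_
    unfold relabel
    simp only
    rw [Function.update_of_ne (Finset.ne_of_mem_erase hC)]
  rw [h5]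
  ring

theorem σ_relabel (x : CrossingEnd V) (ε : ℤˣ) : (S.relabel x ε).σ = S.σ := rfl

theorem sum_of_agree {s s' : V → ℤˣ} (h : ∀ v, v ≠ c → s v = s' v) :
    ∑ v, (s' v : ℤ) = ∑ v, (s v : ℤ) - s c + s' c := by
  classical
  rw [← Finset.add_sum_erase _ (fun v => (s v : ℤ)) (Finset.mem_univ c),
    ← Finset.add_sum_erase _ (fun v => (s' v : ℤ)) (Finset.mem_univ c)]
  have : ∑ v ∈ Finset.univ.erase c, (s v : ℤ) = ∑ v ∈ Finset.univ.erase c, (s' v : ℤ) :=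
    Finset.sum_congr rfl fun v hv => by rw [h v (Finset.ne_of_mem_erase hv)]
  rw [this]
  ring

theorem σ_eq_of_isDrop (h : IsDrop S.state S'.state c) : S'.σ = S.σ - 2 := by
  have := sum_of_agree h.agree
  rw [h.pos, h.neg] at this
  unfold σ
  rw [this]
  simp
  ring

/-- The condition on the first degree says which way the marker changes; the one on the second
degree then says that `τ` grows by one. -/
theorem incident_iff (h0 : D.circles = 0) : S.Incident S' c ↔ IsDrop S.state S'.state c ∧
    (∀ x, ¬ D.Meets S.state c x → S.lab x = S'.lab x) ∧ S'.τ = S.τ + 1 := by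
  constructor
  · intro h
    have h1 := sum_of_agree h.agree
    have h2 : ∑ v, (S'.state v : ℤ) = ∑ v, (S.state v : ℤ) - 2 := h.left_degree
    refine ⟨⟨?_, ?_, h.agree⟩, h.sign_eq, ?_⟩
    · rcases Int.units_eq_one_or (S.state c) with h3 | h3
      · exact h3
      · rcases Int.units_eq_one_or (S'.state c) with h4 | h4 <;> simp [h3, h4] at h1 <;> omega
    · rcases Int.units_eq_one_or (S'.state c) with h4 | h4
      · rcases Int.units_eq_one_or (S.state c) with h3 | h3 <;> simp [h3, h4] at h1 <;> omega
      · exact h4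
    · have := h.left_degree
      have := h.right_degree
      omega
  · rintro ⟨h1, h2, h3⟩
    have := σ_eq_of_isDrop h1
    refine ⟨this, by omega, ?_, h1.agree, h2, fun a => absurd a.2 (by omega)⟩
    rw [h1.pos, h1.neg]
    decide

/-- The degree condition when two circles are merged: it allows `-, - ↦ -` and `+, - ↦ +`. -/
theorem τ_iff_of_merge (h0 : D.circles = 0) (h : ∀ v, v ≠ c → S.state v = S'.state v) (k : Fin 4)
    (hl : ∀ x, ¬ D.Meets S.state c x → S.lab x = S'.lab x)
    (hs : D.circleAt S.state (c, k) ≠ D.circleAt S.state (c, k + 2))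
    (hs' : D.circleAt S'.state (c, k) = D.circleAt S'.state (c, k + 2)) :
    S'.τ = S.τ + 1 ↔ (S'.lab (c, k) : ℤ) = S.lab (c, k) + S.lab (c, k + 2) + 1 := by
  have : S.τ - S.lab (c, k) - S.lab (c, k + 2) = S'.τ - S'.lab (c, k) :=
    finsum_circle_of_merge h0 h k hs hs' (fun C => (S.sign C : ℤ)) (fun C => (S'.sign C : ℤ))
    fun x hx => congrArg Units.val (hl x hx)
  constructor <;> intro <;> linarith

/-- The degree condition when a circle is split: it allows `+ ↦ +, +`, `- ↦ +, -` and
`- ↦ -, +`. -/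
theorem τ_iff_of_split (h0 : D.circles = 0) (h : ∀ v, v ≠ c → S.state v = S'.state v) (k : Fin 4)
    (hl : ∀ x, ¬ D.Meets S.state c x → S.lab x = S'.lab x)
    (hs : D.circleAt S.state (c, k) = D.circleAt S.state (c, k + 2))
    (hs' : D.circleAt S'.state (c, k) ≠ D.circleAt S'.state (c, k + 2)) :
    S'.τ = S.τ + 1 ↔ (S'.lab (c, k) : ℤ) + S'.lab (c, k + 2) = S.lab (c, k) + 1 := by
  have : S'.τ - S'.lab (c, k) - S'.lab (c, k + 2) = S.τ - S.lab (c, k) :=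
    finsum_circle_of_merge h0 (fun v hv => (h v hv).symm) k hs' hs (fun C => (S'.sign C : ℤ))
    (fun C => (S.sign C : ℤ)) fun x hx => congrArg Units.val (hl x (by rwa [meets_flip h])).symm
  constructor <;> intro <;> linarith

/-- A positive sign at a given end persists along the differential. -/
theorem Incident.lab_eq_one (h0 : D.circles = 0) (halt : D.Alternating) (h : S.Incident S' c)
    {x : CrossingEnd V} (hx : S.lab x = 1) : S'.lab x = 1 := by
  rw [incident_iff h0] at h
  obtain ⟨hd, hl, hτ⟩ := h
  have hne : S.state c ≠ S'.state c := by rw [hd.pos, hd.neg]; decide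
  by_cases hm : D.Meets S.state c x
  · obtain ⟨k, hk⟩ := hm
    have hk' := (meets_iff k).1 ((meets_flip hd.agree).1 ⟨k, hk⟩)
    rw [lab_congr hk] at hx
    have hflip := circleAt_opposite_flip halt hd.agree hne k
    by_cases hs : D.circleAt S.state (c, k) = D.circleAt S.state (c, k + 2)
    · have hs' : D.circleAt S'.state (c, k) ≠ D.circleAt S'.state (c, k + 2) := by tauto
      rw [τ_iff_of_split h0 hd.agree k hl hs hs', hx] at hτ
      have h1 : S'.lab (c, k) = 1 ∧ S'.lab (c, k + 2) = 1 := by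
        rcases Int.units_eq_one_or (S'.lab (c, k)) with h1 | h1 <;>
        rcases Int.units_eq_one_or (S'.lab (c, k + 2)) with h2 | h2 <;> simp [h1, h2] at hτ ⊢
      rcases hk' with h | h <;> rw [lab_congr h]
      exacts [h1.1, h1.2]
    · have hs' := hflip.2 hs
      rw [← hs', or_self] at hk'
      rw [τ_iff_of_merge h0 hd.agree k hl hs hs', hx] at hτ
      rw [lab_congr hk']
      rcases Int.units_eq_one_or (S'.lab (c, k)) with h1 | h1
      · exact h1
      · rcases Int.units_eq_one_or (S.lab (c, k + 2)) with h2 | h2 <;> simp [h1, h2] at hτ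
  · rw [← hl x hm, hx]

/-- Raising a sign before or after passing an incidence amounts to the same.  This says that the
differential commutes with the operators `raise`. -/
theorem incident_relabel_iff (h0 : D.circles = 0) {x : CrossingEnd V} (hx : S.lab x = -1)
    (hx' : S'.lab x = 1) : S.Incident (S'.relabel x (-1)) c ↔ (S.relabel x 1).Incident S' c := by
  rw [incident_iff h0, incident_iff h0]
  simp only [relabel_state, τ_relabel, hx, hx']
  -- `τ` grows by two on the right and drops by two on the left; away from the crossing, both
  -- changes affect the same circles
  refine and_congr_right fun hd => and_congr (forall_congr' fun y => imp_congr_right fun hy => ?_)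
    (by push_cast; constructor <;> intro <;> linarith)
  have hiff : D.circleAt S.state y = D.circleAt S.state x ↔
      D.circleAt S'.state y = D.circleAt S'.state x := circleAt_flip_of_not_meets hd.agree hy
  by_cases hyx : D.circleAt S.state y = D.circleAt S.state x
  · rw [lab_relabel_of_eq hyx, lab_relabel_of_eq (hiff.1 hyx), lab_congr hyx,
      lab_congr (hiff.1 hyx), hx, hx']
    simp
  · rw [lab_relabel_of_ne hyx, lab_relabel_of_ne (fun h => hyx (hiff.2 h))]

end EnhancedState

end LinkDiagram

/-! ### The Frobenius algebra structure of the chain group -/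

namespace LinkDiagram

open CrossingEnd EnhancedState

variable {V : Type u} [Fintype V]

open Classical in
/-- The state `s` with its marker at `c` replaced by `ε`. -/
noncomputable def mark (s : V → ℤˣ) (c : V) (ε : ℤˣ) : V → ℤˣ := Function.update s c ε

omit [Fintype V] in
@[simp]
theorem mark_self (s : V → ℤˣ) (c : V) (ε : ℤˣ) : mark s c ε c = ε := by
  simp [mark]

omit [Fintype V] in
theorem mark_of_ne (s : V → ℤˣ) {c v : V} (h : v ≠ c) (ε : ℤˣ) : mark s c ε v = s v := by
  simp [mark, h]

omit [Fintype V] in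
theorem mark_mark (s : V → ℤˣ) (c : V) (ε ε' : ℤˣ) : mark (mark s c ε) c ε' = mark s c ε' := by
  simp [mark]

omit [Fintype V] in
theorem mark_comm (s : V → ℤˣ) {c c' : V} (h : c ≠ c') (ε ε' : ℤˣ) :
    mark (mark s c ε) c' ε' = mark (mark s c' ε') c ε := by
  classical
  exact Function.update_comm h _ _ _

theorem isDrop_mark {D : LinkDiagram V} {s : D.State} {c : V} (h : s c = 1) :
    IsDrop (D := D) s (mark s c (-1)) c :=
  ⟨h, mark_self _ _ _, fun _ hv => (mark_of_ne _ hv _).symm⟩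

theorem IsDrop.eq_mark {D : LinkDiagram V} {s s' : D.State} {c : V}
    (h : IsDrop (D := D) s s' c) : s' = mark s c (-1) := by
  funext v
  by_cases hv : v = c
  · subst hv
    rw [h.neg, mark_self]
  · rw [mark_of_ne _ hv, h.agree v hv]

variable (D : LinkDiagram V)

open Classical in
/-- The part of the differential that changes the marker at `c`, without signs. -/
noncomputable def step (c : V) : D.Chain →ₗ[ℤ] D.Chain :=
  Finsupp.linearCombination ℤ fun S =>
    Finsupp.equivFunOnFinite.symm fun S' => if S.Incident S' c then 1 else 0

open Classical in
/-- Multiplication by the class of a positive circle in the Frobenius algebra `ℤ[X]/(X²)` of the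
circle through `x`: it turns a negative sign of this circle into a positive one, and annihilates
the enhanced states in which it is positive already. -/
noncomputable def raise (x : CrossingEnd V) : D.Chain →ₗ[ℤ] D.Chain :=
  Finsupp.linearCombination ℤ fun S =>
    if S.lab x = -1 then Finsupp.single (S.relabel x 1) 1 else 0

/-- The enhanced state all of whose circles are negative, as a chain. -/
noncomputable def bot (s : D.State) : D.Chain := Finsupp.single ⟨s, fun _ => -1⟩ 1

variable {D}

open Classical in
theorem step_single_apply (c : V) (S S' : D.EnhancedState) :
    D.step c (Finsupp.single S 1) S' = if S.Incident S' c then 1 else 0 := by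
  simp [step]

theorem raise_single_of_neg {x : CrossingEnd V} {S : D.EnhancedState} (h : S.lab x = -1) :
    D.raise x (Finsupp.single S 1) = Finsupp.single (S.relabel x 1) 1 := by
  simp [raise, h]

theorem raise_single_of_pos {x : CrossingEnd V} {S : D.EnhancedState} (h : S.lab x = 1) :
    D.raise x (Finsupp.single S 1) = 0 := by
  have : (1 : ℤˣ) ≠ -1 := by decide
  simp [raise, h, this]

theorem neg_one_of_ne_one {ε : ℤˣ} (h : ε ≠ 1) : ε = -1 := (Int.units_eq_one_or ε).resolve_left h

open Classical in
theorem raise_apply (x : CrossingEnd V) (w : D.Chain) (S : D.EnhancedState) :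
    D.raise x w S = if S.lab x = 1 then w (S.relabel x (-1)) else 0 := by
  induction w using Finsupp.induction_linear with
  | zero => simp
  | add f g hf hg =>
    rw [map_add, Finsupp.add_apply, hf, hg]
    split_ifs <;> simp
  | single T n =>
    rw [← mul_one n, ← smul_eq_mul, ← Finsupp.smul_single, map_smul, Finsupp.smul_apply]
    by_cases hT : T.lab x = 1
    · rw [raise_single_of_pos hT]
      split_ifs with h
      · have : T ≠ S.relabel x (-1) := by
          rintro rfl
          rw [lab_relabel_self] at hT
          exact absurd hT (by decide)
        simp [this]
      · simp
    · have hT' := neg_one_of_ne_one hT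
      rw [raise_single_of_neg hT', Finsupp.smul_apply]
      split_ifs with h
      · have : T.relabel x 1 = S ↔ T = S.relabel x (-1) := by
          constructor
          · rintro rfl
            rw [relabel_relabel, relabel_lab hT']
          · rintro rfl
            rw [relabel_relabel, relabel_lab h]
        simp [Finsupp.single_apply, this]
      · have : T.relabel x 1 ≠ S := by
          rintro rfl
          exact h (lab_relabel_self _ _)
        simp [this]

theorem chain_hom_ext {f g : D.Chain →ₗ[ℤ] D.Chain}
    (h : ∀ S, f (Finsupp.single S 1) = g (Finsupp.single S 1)) (z : D.Chain) : f z = g z := by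
  have : f = g := by
    ext1 S
    ext1
    exact h S
  rw [this]

theorem raise_raise (x y : CrossingEnd V) (z : D.Chain) :
    D.raise x (D.raise y z) = D.raise y (D.raise x z) := by
  refine chain_hom_ext (f := D.raise x ∘ₗ D.raise y) (g := D.raise y ∘ₗ D.raise x)
    (fun S => ?_) z
  simp only [LinearMap.comp_apply]
  by_cases hxy : D.circleAt S.state x = D.circleAt S.state y
  · by_cases hx : S.lab x = 1
    · have hy : S.lab y = 1 := by rw [← lab_congr hxy, hx]
      rw [raise_single_of_pos hx, raise_single_of_pos hy, map_zero, map_zero]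
    · have hx' := neg_one_of_ne_one hx
      have hy' : S.lab y = -1 := by rw [← lab_congr hxy, hx']
      rw [raise_single_of_neg hx', raise_single_of_neg hy', raise_single_of_pos,
        raise_single_of_pos]
      exacts [lab_relabel_of_eq hxy.symm, lab_relabel_of_eq hxy]
  · have h1 : ∀ ε, (S.relabel x ε).lab y = S.lab y := fun ε =>
      lab_relabel_of_ne fun h => hxy h.symm
    have h2 : ∀ ε, (S.relabel y ε).lab x = S.lab x := fun ε => lab_relabel_of_ne hxy
    by_cases hx : S.lab x = 1 <;> by_cases hy : S.lab y = 1
    · rw [raise_single_of_pos hx, raise_single_of_pos hy, map_zero, map_zero]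
    · rw [raise_single_of_pos hx, raise_single_of_neg (neg_one_of_ne_one hy), map_zero,
        raise_single_of_pos (by rw [h2, hx])]
    · rw [raise_single_of_pos hy, raise_single_of_neg (neg_one_of_ne_one hx), map_zero,
        raise_single_of_pos (by rw [h1, hy])]
    · rw [raise_single_of_neg (neg_one_of_ne_one hx), raise_single_of_neg (neg_one_of_ne_one hy),
        raise_single_of_neg (by rw [h2, neg_one_of_ne_one hx]),
        raise_single_of_neg (by rw [h1, neg_one_of_ne_one hy]), relabel_comm hxy]

theorem raise_bot_congr {s : D.State} {x y : CrossingEnd V}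
    (h : D.circleAt s x = D.circleAt s y) : D.raise x (D.bot s) = D.raise y (D.bot s) := by
  unfold bot
  rw [raise_single_of_neg rfl, raise_single_of_neg rfl, relabel_congr h]

/-- The differential is linear over multiplication by the classes of circles. -/
theorem step_raise (h0 : D.circles = 0) (halt : D.Alternating) (c : V) (x : CrossingEnd V)
    (z : D.Chain) : D.step c (D.raise x z) = D.raise x (D.step c z) := by
  refine chain_hom_ext (f := D.step c ∘ₗ D.raise x) (g := D.raise x ∘ₗ D.step c)
    (fun S => ?_) z
  classical
  simp only [LinearMap.comp_apply]
  ext S'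
  rw [raise_apply, step_single_apply]
  by_cases hx : S.lab x = 1
  · rw [raise_single_of_pos hx, map_zero, Finsupp.zero_apply]
    split_ifs with h1 h2
    · have := h2.lab_eq_one h0 halt hx
      rw [lab_relabel_self] at this
      exact absurd this (by decide)
    · rfl
    · rfl
  · have hx' := neg_one_of_ne_one hx
    rw [raise_single_of_neg hx', step_single_apply]
    by_cases h1 : S'.lab x = 1
    · rw [if_pos h1]
      exact if_congr (incident_relabel_iff h0 hx' h1).symm rfl rfl
    · rw [if_neg h1, if_neg]
      intro h2
      exact h1 (h2.lab_eq_one h0 halt (lab_relabel_self _ _))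

theorem step_single_eq_zero (h0 : D.circles = 0) {c : V} {S : D.EnhancedState}
    (h : S.state c ≠ 1) : D.step c (Finsupp.single S 1) = 0 := by
  ext S'
  rw [step_single_apply, if_neg]
  · rfl
  · rw [incident_iff h0]
    exact fun h' => h h'.1.pos

theorem step_mem_supported (h0 : D.circles = 0) (c : V) (S : D.EnhancedState) :
    D.step c (Finsupp.single S 1) ∈
      Finsupp.supported ℤ ℤ {S' : D.EnhancedState | S'.state = mark S.state c (-1)} := by
  rw [Finsupp.mem_supported']
  intro S' hS'
  rw [step_single_apply, if_neg]
  rw [incident_iff h0]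
  exact fun h => hS' h.1.eq_mark

/-- A merge maps `1 ⊗ 1` to `1`. -/
theorem step_bot_of_merge (h0 : D.circles = 0) (halt : D.Alternating) {s : D.State} {c : V}
    (hc : s c = 1) (hs : D.circleAt s (c, 0) ≠ D.circleAt s (c, 0 + 2)) :
    D.step c (D.bot s) = D.bot (mark s c (-1)) := by
  have hd : IsDrop (D := D) s (mark s c (-1)) c := isDrop_mark hc
  have hs' : D.circleAt (mark s c (-1)) (c, 0) = D.circleAt (mark s c (-1)) (c, 0 + 2) :=
    (circleAt_opposite_flip halt hd.agree (by rw [hd.pos, hd.neg]; decide) 0).2 hs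
  classical
  ext S'
  unfold bot
  rw [step_single_apply, Finsupp.single_apply]
  refine if_congr ?_ rfl rfl
  rw [incident_iff h0]
  constructor
  · rintro ⟨h1, h2, h3⟩
    have hst : S'.state = mark s c (-1) := h1.eq_mark
    refine ext_lab h0 hst.symm fun x => ?_
    rw [τ_iff_of_merge h0 h1.agree 0 h2 hs (by rw [hst]; exact hs')] at h3
    by_cases hx : D.Meets s c x
    · have hx' := (meets_iff 0).1 ((meets_flip hd.agree).1 hx)
      rw [← hs', or_self] at hx'
      have hl : S'.lab x = S'.lab (c, 0) := lab_congr (by rw [hst]; exact hx')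
      rw [hl]
      refine (neg_one_of_ne_one fun h => ?_).symm
      rw [h] at h3
      change ((1 : ℤˣ) : ℤ) = ((-1 : ℤˣ) : ℤ) + ((-1 : ℤˣ) : ℤ) + 1 at h3
      exact absurd h3 (by decide)
    · exact h2 x hx
  · rintro rfl
    refine ⟨hd, fun _ _ => rfl, ?_⟩
    rw [τ_iff_of_merge (S := ⟨s, fun _ => -1⟩) (S' := ⟨mark s c (-1), fun _ => -1⟩) h0 hd.agree 0
      (fun _ _ => rfl) hs hs']
    change ((-1 : ℤˣ) : ℤ) = ((-1 : ℤˣ) : ℤ) + ((-1 : ℤˣ) : ℤ) + 1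
    decide

/-- A split maps `1` to `X ⊗ 1 + 1 ⊗ X`. -/
theorem step_bot_of_split (h0 : D.circles = 0) (halt : D.Alternating) {s : D.State} {c : V}
    (hc : s c = 1) (hs : D.circleAt s (c, 0) = D.circleAt s (c, 0 + 2)) :
    D.step c (D.bot s) = D.raise (c, 0) (D.bot (mark s c (-1)))
      + D.raise (c, 0 + 2) (D.bot (mark s c (-1))) := by
  have hd : IsDrop (D := D) s (mark s c (-1)) c := isDrop_mark hc
  have hs' : D.circleAt (mark s c (-1)) (c, 0) ≠ D.circleAt (mark s c (-1)) (c, 0 + 2) := by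
    have := circleAt_opposite_flip halt hd.agree (by rw [hd.pos, hd.neg]; decide) 0
    tauto
  classical
  ext S'
  unfold bot
  rw [raise_single_of_neg rfl, raise_single_of_neg rfl]
  set B : D.EnhancedState := ⟨mark s c (-1), fun _ => -1⟩ with hB
  have hBlab : ∀ x, B.lab x = -1 := fun _ => rfl
  have e1 : (B.relabel (c, 0) 1).lab (c, 0 + 2) = -1 := lab_relabel_of_ne (S := B) hs'.symm
  have e2 : (B.relabel (c, 0 + 2) 1).lab (c, 0) = -1 := lab_relabel_of_ne (S := B) hs'
  have e3 : (B.relabel (c, 0) 1).lab (c, 0) = 1 := lab_relabel_self _ _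
  have e4 : (B.relabel (c, 0 + 2) 1).lab (c, 0 + 2) = 1 := lab_relabel_self _ _
  have hoff : ∀ x, ¬ D.Meets s c x → ∀ k, (B.relabel (c, k) 1).lab x = -1 := by
    intro x hx k
    refine lab_relabel_of_ne (S := B) fun h => hx ((meets_flip hd.agree).2 ⟨k, h⟩)
  rw [step_single_apply, Finsupp.add_apply, Finsupp.single_apply, Finsupp.single_apply]
  have hne : B.relabel (c, 0) 1 ≠ B.relabel (c, 0 + 2) 1 := fun h => by
    rw [h, e2] at e3
    exact absurd e3 (by decide)
  have key : (EnhancedState.mk s fun _ => -1).Incident S' c ↔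
      (B.relabel (c, 0) 1 = S' ∨ B.relabel (c, 0 + 2) 1 = S') := by
    rw [incident_iff h0]
    constructor
    · rintro ⟨h1, h2, h3⟩
      have hst : S'.state = mark s c (-1) := h1.eq_mark
      rw [τ_iff_of_split h0 h1.agree 0 h2 hs (by rw [hst]; exact hs')] at h3
      change ((S'.lab (c, 0) : ℤ) + S'.lab (c, 0 + 2)) = ((-1 : ℤˣ) : ℤ) + 1 at h3
      have hmeets : ∀ x, D.Meets s c x → S'.lab x = S'.lab (c, 0) ∧
          D.circleAt B.state x = D.circleAt B.state (c, 0) ∨ S'.lab x = S'.lab (c, 0 + 2) ∧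
          D.circleAt B.state x = D.circleAt B.state (c, 0 + 2) := by
        intro x hx
        have hx' := (meets_iff 0).1 ((meets_flip hd.agree).1 hx)
        refine hx'.imp (fun h => ⟨lab_congr (by rw [hst]; exact h), h⟩)
          (fun h => ⟨lab_congr (by rw [hst]; exact h), h⟩)
      rcases Int.units_eq_one_or (S'.lab (c, 0)) with ha | ha <;>
        rcases Int.units_eq_one_or (S'.lab (c, 0 + 2)) with hb | hb <;>
        rw [ha, hb] at h3 hmeets
      · exact absurd h3 (by decide)
      · refine Or.inl (ext_lab h0 hst.symm fun x => ?_)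
        by_cases hx : D.Meets s c x
        · rcases hmeets x hx with ⟨h4, h5⟩ | ⟨h4, h5⟩
          · rw [h4, lab_relabel_of_eq h5]
          · rw [h4, ← e1]
            exact lab_congr h5
        · rw [hoff x hx]
          exact h2 x hx
      · refine Or.inr (ext_lab h0 hst.symm fun x => ?_)
        by_cases hx : D.Meets s c x
        · rcases hmeets x hx with ⟨h4, h5⟩ | ⟨h4, h5⟩
          · rw [h4, ← e2]
            exact lab_congr h5
          · rw [h4, lab_relabel_of_eq h5]
        · rw [hoff x hx]
          exact h2 x hx
      · exact absurd h3 (by decide)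
    · have hfin : ∀ T : D.EnhancedState, T.state = mark s c (-1) →
          (∀ x, ¬ D.Meets s c x → T.lab x = -1) →
          ((T.lab (c, 0) : ℤ) + T.lab (c, 0 + 2) = 0) →
          IsDrop s T.state c ∧ (∀ x, ¬ D.Meets s c x → -1 = T.lab x) ∧
            T.τ = (EnhancedState.mk s fun _ => -1).τ + 1 := by
        intro T hT hl hsum
        have hd' : IsDrop (D := D) s T.state c := by rw [hT]; exact hd
        refine ⟨hd', fun x hx => (hl x hx).symm, ?_⟩
        rw [τ_iff_of_split (S := ⟨s, fun _ => -1⟩) h0 hd'.agree 0 (fun x hx => (hl x hx).symm) hs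
          (by rw [hT]; exact hs'), hsum]
        change 0 = ((-1 : ℤˣ) : ℤ) + 1
        decide
      rintro (rfl | rfl)
      · exact hfin _ rfl (fun x hx => hoff x hx 0) (by rw [e1, e3]; decide)
      · exact hfin _ rfl (fun x hx => hoff x hx _) (by rw [e2, e4]; decide)
  by_cases h1 : B.relabel (c, 0) 1 = S'
  · have h2 : B.relabel (c, 0 + 2) 1 ≠ S' := fun h => hne (h1.trans h.symm)
    rw [if_pos h1, if_neg h2, if_pos (key.2 (Or.inl h1)), add_zero]
  · by_cases h2 : B.relabel (c, 0 + 2) 1 = S'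
    · rw [if_neg h1, if_pos h2, if_pos (key.2 (Or.inr h2)), zero_add]
    · rw [if_neg h1, if_neg h2, if_neg (fun h => (key.1 h).elim h1 h2), add_zero]

end LinkDiagram

/-! ### The differential squares to zero -/

namespace LinkDiagram

open CrossingEnd EnhancedState

variable {V : Type u} [Fintype V] {D : LinkDiagram V}

theorem numCircles_mark_of_merge (h0 : D.circles = 0) (halt : D.Alternating) {s : D.State} {c : V}
    (hc : s c = 1) (k : Fin 4) (hs : D.circleAt s (c, k) ≠ D.circleAt s (c, k + 2)) :
    D.numCircles s = D.numCircles (mark s c (-1)) + 1 := by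
  have hd : IsDrop (D := D) s (mark s c (-1)) c := isDrop_mark hc
  exact numCircles_of_merge h0 hd.agree k hs
    ((circleAt_opposite_flip halt hd.agree (by rw [hd.pos, hd.neg]; decide) k).2 hs)

theorem numCircles_mark_of_split (h0 : D.circles = 0) (halt : D.Alternating) {s : D.State} {c : V}
    (hc : s c = 1) (k : Fin 4) (hs : D.circleAt s (c, k) = D.circleAt s (c, k + 2)) :
    D.numCircles (mark s c (-1)) = D.numCircles s + 1 := by
  have hd : IsDrop (D := D) s (mark s c (-1)) c := isDrop_mark hc
  have := circleAt_opposite_flip halt hd.agree (by rw [hd.pos, hd.neg]; decide) k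
  exact numCircles_of_merge h0 (fun v hv => (hd.agree v hv).symm) k (by tauto) hs

theorem numCircles_mark_le (h0 : D.circles = 0) (halt : D.Alternating) {t : D.State} {c : V}
    (ht : t c = 1) : D.numCircles (mark t c (-1)) ≤ D.numCircles t + 1 := by
  by_cases h : D.circleAt t (c, 0) = D.circleAt t (c, 0 + 2)
  · exact (numCircles_mark_of_split h0 halt ht 0 h).le
  · have := numCircles_mark_of_merge h0 halt ht 0 h
    omega

/-- The two ways around a square of the cube of states agree on the all-negative enhanced state.
Each composite multiplies it by a factor `X + X'` for every split on the way, where `X` and `X'`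
belong to the two strands at the crossing. Both ways have the same number of splits, and the
factors act in the same way on the circles at the end. -/
theorem step_step_bot (h0 : D.circles = 0) (halt : D.Alternating) {s : D.State} {c c' : V}
    (hne : c ≠ c') (hc : s c = 1) (hc' : s c' = 1) :
    D.step c' (D.step c (D.bot s)) = D.step c (D.step c' (D.bot s)) := by
  set s₁ : D.State := mark s c (-1) with hs₁
  set s₂ : D.State := mark s c' (-1) with hs₂
  set t : D.State := mark s₁ c' (-1) with ht
  have ht' : t = mark s₂ c (-1) := mark_comm s hne _ _
  have hc₁ : s₁ c' = 1 := by rw [hs₁, mark_of_ne _ hne.symm, hc']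
  have hc₂ : s₂ c = 1 := by rw [hs₂, mark_of_ne _ hne, hc]
  have d₁ : IsDrop (D := D) s s₁ c := isDrop_mark hc
  have d₂ : IsDrop (D := D) s s₂ c' := isDrop_mark hc'
  have d₁t : IsDrop (D := D) s₁ t c' := isDrop_mark hc₁
  have d₂t : IsDrop (D := D) s₂ t c := by rw [ht']; exact isDrop_mark hc₂
  have flip : ∀ {r r' : D.State} {v : V}, IsDrop (D := D) r r' v →
      (D.circleAt r' (v, 0) = D.circleAt r' (v, 0 + 2) ↔
        ¬ D.circleAt r (v, 0) = D.circleAt r (v, 0 + 2)) := fun hd =>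
    circleAt_opposite_flip halt hd.agree (by rw [hd.pos, hd.neg]; decide) 0
  by_cases hP : D.circleAt s (c, 0) = D.circleAt s (c, 0 + 2) <;>
  by_cases hQ' : D.circleAt s₁ (c', 0) = D.circleAt s₁ (c', 0 + 2) <;>
  by_cases hP' : D.circleAt s (c', 0) = D.circleAt s (c', 0 + 2) <;>
  by_cases hQ : D.circleAt s₂ (c, 0) = D.circleAt s₂ (c, 0 + 2)
  all_goals
    first
      | have n1 := numCircles_mark_of_split h0 halt hc 0 hP
        have m1 := step_bot_of_split h0 halt hc hP
      | have n1 := numCircles_mark_of_merge h0 halt hc 0 hP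
        have m1 := step_bot_of_merge h0 halt hc hP
    first
      | have n2 := numCircles_mark_of_split h0 halt hc₁ 0 hQ'
        have m2 := step_bot_of_split h0 halt hc₁ hQ'
      | have n2 := numCircles_mark_of_merge h0 halt hc₁ 0 hQ'
        have m2 := step_bot_of_merge h0 halt hc₁ hQ'
    first
      | have n3 := numCircles_mark_of_split h0 halt hc' 0 hP'
        have m3 := step_bot_of_split h0 halt hc' hP'
      | have n3 := numCircles_mark_of_merge h0 halt hc' 0 hP'
        have m3 := step_bot_of_merge h0 halt hc' hP'
    first
      | have n4 := numCircles_mark_of_split h0 halt hc₂ 0 hQ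
        have m4 := step_bot_of_split h0 halt hc₂ hQ
      | have n4 := numCircles_mark_of_merge h0 halt hc₂ 0 hQ
        have m4 := step_bot_of_merge h0 halt hc₂ hQ
    rw [← hs₁] at n1 m1
    rw [← ht] at n2 m2
    rw [← hs₂] at n3 m3
    rw [← ht'] at n4 m4
    first
      | exfalso; omega
      | simp only [m1, m3, map_add, step_raise h0 halt, m2, m4]
  · -- both paths consist of two splits
    simp only [raise_raise (c', 0), raise_raise (c', 0 + 2)]
    abel
  · -- each path splits a circle first, then rejoins the halves
    have hm : ∀ k, D.circleAt t (c, k) = D.circleAt t (c', 0) := by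
      intro k
      have h1 : D.Meets s₂ c' (c, k) := by
        have h2 : ∀ l, D.Meets s₂ c' (c, l) ∨ D.circleAt s₂ (c, 0) = D.circleAt s₂ (c, 0 + 2) := by
          intro l
          rcases circleAt_eq_or_meets d₂.agree hP with h | h
          · exact Or.inr h
          · rcases circleAt_crossing s₂ c 0 l with h' | h'
            exacts [Or.inl ((meets_congr h').2 h.1), Or.inl ((meets_congr h').2 h.2)]
        exact (h2 k).resolve_right hQ
      have h2 : D.circleAt t (c', 0) = D.circleAt t (c', 0 + 2) := (flip d₁t).2 hQ'
      rcases (meets_iff 0).1 h1 with h | h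
      · exact circleAt_eq_of_merge d₂t.agree 0 ((flip d₂t).2 hQ) h
      · exact (circleAt_eq_of_merge d₂t.agree 0 ((flip d₂t).2 hQ) h).trans h2.symm
    have h2 : D.circleAt t (c', 0) = D.circleAt t (c', 0 + 2) := (flip d₁t).2 hQ'
    rw [raise_bot_congr (hm 0), raise_bot_congr (hm (0 + 2)), ← raise_bot_congr h2]
  · -- each path merges the same two circles first, then splits the result
    have hm : ∀ k, D.Meets t c' (c, k) := by
      intro k
      rw [← meets_flip d₁t.agree]
      have h1 : D.Meets s c' (c, k) := by
        rcases circleAt_eq_or_meets (fun v hv => (d₂.agree v hv).symm) hQ with h | h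
        · exact absurd h hP
        · rcases circleAt_crossing s c 0 k with h' | h'
          exacts [(meets_congr h').2 h.1, (meets_congr h').2 h.2]
      obtain ⟨l, hl⟩ := h1
      exact ⟨l, circleAt_eq_of_merge d₁.agree 0 ((flip d₁).2 hP) hl⟩
    have hne' : D.circleAt t (c, 0) ≠ D.circleAt t (c, 0 + 2) := fun h => (flip d₂t).1 h hQ
    rcases (meets_iff 0).1 (hm 0) with h | h <;> rcases (meets_iff 0).1 (hm (0 + 2)) with h' | h'
    · exact absurd (h.trans h'.symm) hne'
    · rw [raise_bot_congr h, raise_bot_congr h']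
    · rw [raise_bot_congr h, raise_bot_congr h', add_comm]
    · exact absurd (h.trans h'.symm) hne'

/-- Every enhanced state arises from an all-negative one by turning signs of circles positive. -/
theorem EnhancedState.relabel_induction {D : LinkDiagram V} {P : D.EnhancedState → Prop}
    (hbot : ∀ s, P ⟨s, fun _ => -1⟩)
    (hraise : ∀ (S : D.EnhancedState) x, S.lab x = -1 → P S → P (S.relabel x 1))
    (h0 : D.circles = 0) (S : D.EnhancedState) : P S := by
  classical
  induction hn : (Finset.univ.filter fun x => S.lab x = 1).card using Nat.strong_induction_on
    generalizing S with
  | _ n ih =>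
    by_cases hS : ∃ x, S.lab x = 1
    · obtain ⟨x, hx⟩ := hS
      have h1 := hraise (S.relabel x (-1)) x (lab_relabel_self _ _) (ih _ (by
        rw [← hn]
        refine Finset.card_lt_card (Finset.ssubset_iff_subset_ne.2 ⟨?_, ?_⟩)
        · intro y hy
          rw [Finset.mem_filter] at hy ⊢
          refine ⟨Finset.mem_univ _, ?_⟩
          by_cases hyx : D.circleAt S.state y = D.circleAt S.state x
          · rw [lab_congr hyx, hx]
          · rw [← hy.2, lab_relabel_of_ne hyx]
        · intro h
          have h2 : x ∈ Finset.univ.filter fun x => S.lab x = 1 := by simp [hx]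
          rw [← h, Finset.mem_filter, lab_relabel_self] at h2
          exact absurd h2.2 (by decide)) _ rfl)
      rwa [relabel_relabel, relabel_lab hx] at h1
    · have : S = ⟨S.state, fun _ => -1⟩ :=
        ext_lab h0 rfl fun x => neg_one_of_ne_one fun h => hS ⟨x, h⟩
      rw [this]
      exact hbot _

theorem step_step_single (h0 : D.circles = 0) (halt : D.Alternating) {c c' : V} (hne : c ≠ c')
    (S : D.EnhancedState) (hc : S.state c = 1) (hc' : S.state c' = 1) :
    D.step c' (D.step c (Finsupp.single S 1)) = D.step c (D.step c' (Finsupp.single S 1)) := by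
  revert hc hc'
  refine relabel_induction (P := fun S => S.state c = 1 → S.state c' = 1 →
    D.step c' (D.step c (Finsupp.single S 1)) = D.step c (D.step c' (Finsupp.single S 1)))
    (fun s hc hc' => step_step_bot h0 halt hne hc hc') (fun S x hx ih hc hc' => ?_) h0 S
  rw [← raise_single_of_neg hx]
  simp only [step_raise h0 halt]
  rw [ih hc hc']

section Differential

variable [LinearOrder V]

/-- The sign `(-1)^t` in the differential, where `t` depends on the underlying state only. -/
def koszulSign (s : V → ℤˣ) (c : V) : ℤ :=
  (-1) ^ (Finset.univ.filter fun v => c < v ∧ s v = -1).card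

theorem koszulSign_mul_self (s : V → ℤˣ) (c : V) : koszulSign s c * koszulSign s c = 1 := by
  unfold koszulSign
  rw [← mul_pow]
  simp

theorem koszulSign_mark {s : V → ℤˣ} {c c' : V} (h : s c' = 1) :
    koszulSign (mark s c' (-1)) c = koszulSign s c * if c < c' then -1 else 1 := by
  unfold koszulSign
  split_ifs with hlt
  · have : (Finset.univ.filter fun v => c < v ∧ mark s c' (-1) v = -1)
        = insert c' (Finset.univ.filter fun v => c < v ∧ s v = -1) := by
      ext v
      by_cases hv : v = c'
      · subst hv
        simp [hlt]
      · simp [mark_of_ne s hv, hv]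
    rw [this, Finset.card_insert_of_notMem (by simp [h]), pow_succ]
  · rw [mul_one]
    congr 2
    ext v
    by_cases hv : v = c'
    · subst hv
      simp [hlt]
    · simp [mark_of_ne s hv]

theorem d_single (S : D.EnhancedState) : D.d (Finsupp.single S 1)
    = ∑ c, koszulSign S.state c • D.step c (Finsupp.single S 1) := by
  classical
  have := Fintype.ofFinite D.EnhancedState
  ext S'
  unfold d
  rw [Finsupp.linearCombination_single, one_smul, finsum_eq_sum_of_fintype,
    Finsupp.finsetSum_apply, Finsupp.finsetSum_apply]
  simp only [Finsupp.smul_apply, step_single_apply, Finsupp.single_apply, smul_eq_mul, mul_ite,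
    mul_one, mul_zero, Finset.sum_ite_eq', Finset.mem_univ, if_true]
  unfold incidence
  refine Finset.sum_congr rfl fun c _ => ?_
  split_ifs <;> rfl

/-- On chains over one state the signs of the differential are constant. -/
theorem d_of_state {s : D.State} {z : D.Chain}
    (hz : z ∈ Finsupp.supported ℤ ℤ {S : D.EnhancedState | S.state = s}) :
    D.d z = ∑ c, koszulSign s c • D.step c z := by
  have h : Set.EqOn D.d (∑ c, koszulSign s c • D.step c : D.Chain →ₗ[ℤ] D.Chain)
      (Finsupp.supported ℤ ℤ {S : D.EnhancedState | S.state = s}) := by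
    rw [Finsupp.supported_eq_span_single]
    refine LinearMap.eqOn_span' ?_
    rintro _ ⟨S, rfl, rfl⟩
    rw [d_single]
    simp
  rw [h hz]
  simp

theorem d_d (h0 : D.circles = 0) (halt : D.Alternating) (z : D.Chain) : D.d (D.d z) = 0 := by
  refine chain_hom_ext (f := D.d ∘ₗ D.d) (g := 0) (fun S => ?_) z
  rw [LinearMap.comp_apply, d_single, map_sum]
  set F : V → V → D.Chain := fun c c' =>
    (koszulSign S.state c * koszulSign (mark S.state c (-1)) c') •
      D.step c' (D.step c (Finsupp.single S 1)) with hF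
  have h1 : ∀ c, D.d (koszulSign S.state c • D.step c (Finsupp.single S 1)) = ∑ c', F c c' := by
    intro c
    rw [map_smul, d_of_state (step_mem_supported h0 c S), Finset.smul_sum]
    simp only [hF, smul_smul]
  simp only [h1]
  have hzero : ∀ c c', S.state c ≠ 1 → F c c' = 0 := by
    intro c c' h
    simp only [hF]
    rw [step_single_eq_zero h0 h, map_zero, smul_zero]
  have hzero' : ∀ c c', mark S.state c (-1) c' ≠ 1 → F c c' = 0 := by
    intro c c' h
    simp only [hF]
    suffices D.step c' (D.step c (Finsupp.single S 1)) = 0 by rw [this, smul_zero]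
    have h2 : Set.EqOn (D.step c') (0 : D.Chain →ₗ[ℤ] D.Chain)
        (Finsupp.supported ℤ ℤ {S' : D.EnhancedState | S'.state = mark S.state c (-1)}) := by
      rw [Finsupp.supported_eq_span_single]
      refine LinearMap.eqOn_span' ?_
      rintro _ ⟨T, hT, rfl⟩
      exact step_single_eq_zero h0 (by rw [hT]; exact h)
    exact h2 (step_mem_supported h0 c S)
  have hanti : ∀ c c', F c' c = - F c c' := by
    intro c c'
    by_cases hne : c = c'
    · subst hne
      have : F c c = 0 := hzero' c c (by rw [mark_self]; decide)
      rw [this, neg_zero]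
    · by_cases hc : S.state c = 1
      · by_cases hc' : S.state c' = 1
        · simp only [hF]
          rw [step_step_single h0 halt hne S hc hc', koszulSign_mark hc, koszulSign_mark hc',
            ← neg_smul]
          congr 1
          rcases lt_or_gt_of_ne hne with h | h
          · rw [if_pos h, if_neg h.asymm]
            ring
          · rw [if_pos h, if_neg h.asymm]
            ring
        · rw [hzero c' c hc', hzero' c c' (by rwa [mark_of_ne _ (Ne.symm hne)]), neg_zero]
      · rw [hzero c c' hc, hzero' c' c (by rwa [mark_of_ne _ hne]), neg_zero]
  have hsum : ∑ c, ∑ c', F c c' = - ∑ c, ∑ c', F c c' := by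
    conv_lhs => rw [Finset.sum_comm]
    simp only [← Finset.sum_neg_distrib]
    exact Finset.sum_congr rfl fun c _ => Finset.sum_congr rfl fun c' _ => hanti c c'
  exact self_eq_neg.1 hsum

end Differential

end LinkDiagram

/-! ### Homology of subquotients of based complexes -/

namespace BasedComplex

variable {E : Type*}

open Classical in
/-- The part of a chain that is supported on `A`. -/
noncomputable def cut (A : Set E) : (E →₀ ℤ) →ₗ[ℤ] (E →₀ ℤ) :=
  (Finsupp.supported ℤ ℤ A).subtype ∘ₗ Finsupp.restrictDom ℤ ℤ A

open Classical in
theorem cut_apply (A : Set E) (z : E →₀ ℤ) (S : E) : cut A z S = if S ∈ A then z S else 0 := by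
  simp only [cut, LinearMap.comp_apply, Submodule.subtype_apply, Finsupp.restrictDom_apply,
    Finsupp.filter_apply]

theorem cut_apply_of_mem {A : Set E} (z : E →₀ ℤ) {S : E} (h : S ∈ A) : cut A z S = z S := by
  classical
  rw [cut_apply, if_pos h]

theorem cut_apply_of_notMem {A : Set E} (z : E →₀ ℤ) {S : E} (h : S ∉ A) : cut A z S = 0 := by
  classical
  rw [cut_apply, if_neg h]

theorem cut_mem (A : Set E) (z : E →₀ ℤ) : cut A z ∈ Finsupp.supported ℤ ℤ A := by
  rw [Finsupp.mem_supported']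
  exact fun S hS => cut_apply_of_notMem z hS

theorem cut_of_mem {A : Set E} {z : E →₀ ℤ} (h : z ∈ Finsupp.supported ℤ ℤ A) : cut A z = z := by
  rw [Finsupp.mem_supported'] at h
  ext S
  by_cases hS : S ∈ A
  · rw [cut_apply_of_mem z hS]
  · rw [cut_apply_of_notMem z hS, h S hS]

theorem supported_mono {A B : Set E} (h : A ⊆ B) {z : E →₀ ℤ}
    (hz : z ∈ Finsupp.supported ℤ ℤ A) : z ∈ Finsupp.supported ℤ ℤ B :=
  Finsupp.supported_mono h hz

variable (d : (E →₀ ℤ) →ₗ[ℤ] (E →₀ ℤ))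

/-- The differential of the subquotient spanned by `A`. -/
noncomputable def diff (A : Set E) : (E →₀ ℤ) →ₗ[ℤ] (E →₀ ℤ) := cut A ∘ₗ d

/-- The matrix coefficient of `d` from `S` to `S'` does not vanish. -/
def Arrow (S S' : E) : Prop := d (Finsupp.single S 1) S' ≠ 0

variable {d}

/-- A non-zero coefficient of `d z` is reached by an arrow from the support of `z`. -/
theorem exists_arrow {z : E →₀ ℤ} {S' : E} (h : d z S' ≠ 0) : ∃ S, z S ≠ 0 ∧ Arrow d S S' := by
  by_contra! hcon
  have hz : z ∈ Finsupp.supported ℤ ℤ {S | z S ≠ 0} := by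
    rw [Finsupp.mem_supported']
    intro S hS
    simpa using hS
  have : Set.EqOn (Finsupp.lapply S' ∘ₗ d) (0 : (E →₀ ℤ) →ₗ[ℤ] ℤ)
      (Finsupp.supported ℤ ℤ {S | z S ≠ 0}) := by
    rw [Finsupp.supported_eq_span_single]
    refine LinearMap.eqOn_span' ?_
    rintro _ ⟨S, hS, rfl⟩
    have := hcon S hS
    unfold Arrow at this
    rw [not_not] at this
    simpa using this
  exact h (by simpa using this hz)

theorem apply_eq_zero {A : Set E} {z : E →₀ ℤ} (hz : z ∈ Finsupp.supported ℤ ℤ A) {S' : E}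
    (h : ∀ S ∈ A, ¬ Arrow d S S') : d z S' = 0 := by
  by_contra hne
  obtain ⟨S, hS, hS'⟩ := exists_arrow hne
  rw [Finsupp.mem_supported'] at hz
  refine h S ?_ hS'
  by_contra hSA
  exact hS (hz S hSA)

variable (d)

/-- `A` spans a subquotient complex: with the ends of a path of two arrows it contains the
middle. -/
def Convex (A : Set E) : Prop :=
  ∀ S S' S'', S ∈ A → S'' ∈ A → Arrow d S S' → Arrow d S' S'' → S' ∈ A

/-- `gr i j` is the set of basis elements of bidegree `(i, j)`, for a bigrading for which `d` has
bidegree `(-2, 0)`. -/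
structure IsGrading (gr : ℤ → ℤ → Set E) : Prop where
  arrow : ∀ {i j S S'}, S ∈ gr i j → Arrow d S S' → S' ∈ gr (i - 2) j
  exists_mem : ∀ S, ∃ i j, S ∈ gr i j
  unique : ∀ {S i j i' j'}, S ∈ gr i j → S ∈ gr i' j' → i = i' ∧ j = j'

/-- The subquotient spanned by `A` has no homology in bidegree `(i, j)`. -/
def ExactOn (gr : ℤ → ℤ → Set E) (A : Set E) (i j : ℤ) : Prop :=
  ∀ z ∈ Finsupp.supported ℤ ℤ (A ∩ gr i j), diff d A z = 0 →
    ∃ w ∈ Finsupp.supported ℤ ℤ (A ∩ gr (i + 2) j), diff d A w = z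

variable {d} {gr : ℤ → ℤ → Set E} {A B Q C : Set E}

theorem Convex.inter (hA : Convex d A) (hB : Convex d B) : Convex d (A ∩ B) :=
  fun S S' S'' h h'' h1 h2 =>
    ⟨hA S S' S'' h.1 h''.1 h1 h2, hB S S' S'' h.2 h''.2 h1 h2⟩

/-- A subcomplex of a convex set is convex. -/
theorem Convex.sub_of_union (h : Convex d (B ∪ Q)) (hBQ : ∀ S ∈ B, ∀ S' ∈ Q, ¬ Arrow d S S') :
    Convex d B := fun S S' S'' hS hS'' h1 h2 =>
  (h S S' S'' (Or.inl hS) (Or.inl hS'') h1 h2).resolve_right fun h' => hBQ S hS S' h' h1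

/-- The complement of a subcomplex in a convex set is convex. -/
theorem Convex.quotient_of_union (h : Convex d (B ∪ Q))
    (hBQ : ∀ S ∈ B, ∀ S' ∈ Q, ¬ Arrow d S S') : Convex d Q := fun S S' S'' hS hS'' h1 h2 =>
  (h S S' S'' (Or.inr hS) (Or.inr hS'') h1 h2).resolve_left fun h' => hBQ S' h' S'' hS'' h2

theorem exactOn_of_isEmpty {i j : ℤ} (h : ∀ S ∈ A, S ∉ gr i j) : ExactOn d gr A i j := by
  intro z hz _
  have : z = 0 := by
    ext S
    rw [Finsupp.mem_supported'] at hz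
    exact hz S fun hS => h S hS.1 hS.2
  exact ⟨0, Submodule.zero_mem _, by rw [map_zero, this]⟩

theorem cut_diff_of_subset (h : B ⊆ A) (z : E →₀ ℤ) : cut B (diff d A z) = diff d B z := by
  ext S
  unfold diff
  simp only [LinearMap.comp_apply]
  by_cases hS : S ∈ B
  · rw [cut_apply_of_mem _ hS, cut_apply_of_mem _ hS, cut_apply_of_mem _ (h hS)]
  · rw [cut_apply_of_notMem _ hS, cut_apply_of_notMem _ hS]

theorem diff_mem (z : E →₀ ℤ) : diff d A z ∈ Finsupp.supported ℤ ℤ A := cut_mem _ _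

theorem diff_mem_grade (hg : IsGrading d gr) {i j : ℤ} {X : Set E} {z : E →₀ ℤ}
    (hz : z ∈ Finsupp.supported ℤ ℤ (X ∩ gr (i + 2) j)) :
    diff d A z ∈ Finsupp.supported ℤ ℤ (A ∩ gr i j) := by
  rw [Finsupp.mem_supported']
  intro S' hS'
  by_cases h : S' ∈ A
  · rw [diff, LinearMap.comp_apply, cut_apply_of_mem _ h]
    refine apply_eq_zero hz fun S hS harr => hS' ⟨h, ?_⟩
    have := hg.arrow hS.2 harr
    rwa [add_sub_cancel_right] at this
  · exact cut_apply_of_notMem _ h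

/-- The part of `d z` outside a convex set does not return to it. -/
theorem diff_diff (hd : ∀ z, d (d z) = 0) (hA : Convex d A) {z : E →₀ ℤ}
    (hz : z ∈ Finsupp.supported ℤ ℤ A) : diff d A (diff d A z) = 0 := by
  ext S''
  by_cases h : S'' ∈ A
  · rw [diff, LinearMap.comp_apply, cut_apply_of_mem _ h]
    have h1 : d (d z) S'' = d (d z - cut A (d z)) S'' + d (cut A (d z)) S'' := by
      rw [← Finsupp.add_apply, ← map_add, sub_add_cancel]
    rw [hd, Finsupp.zero_apply] at h1
    have h2 : d (d z - cut A (d z)) S'' = 0 := by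
      by_contra hne
      obtain ⟨S', hS', harr'⟩ := exists_arrow hne
      have hS'A : S' ∉ A := by
        intro h'
        rw [Finsupp.sub_apply, cut_apply_of_mem _ h', sub_self] at hS'
        exact hS' rfl
      rw [Finsupp.sub_apply, cut_apply_of_notMem _ hS'A, sub_zero] at hS'
      obtain ⟨S, hS, harr⟩ := exists_arrow hS'
      refine hS'A (hA S S' S'' ?_ h harr harr')
      by_contra hSA
      rw [Finsupp.mem_supported'] at hz
      exact hS (hz S hSA)
    rw [h2, zero_add] at h1
    exact h1.symm
  · exact cut_apply_of_notMem _ h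

theorem cut_union (hdisj : Disjoint B Q) (z : E →₀ ℤ) :
    cut (B ∪ Q) z = cut B z + cut Q z := by
  ext S
  rw [Finsupp.add_apply]
  by_cases hB : S ∈ B
  · have hQ : S ∉ Q := fun h => Set.disjoint_left.1 hdisj hB h
    rw [cut_apply_of_mem _ (Set.mem_union_left Q hB), cut_apply_of_mem _ hB,
      cut_apply_of_notMem _ hQ, add_zero]
  · by_cases hQ : S ∈ Q
    · rw [cut_apply_of_mem _ (Set.mem_union_right B hQ), cut_apply_of_mem _ hQ,
        cut_apply_of_notMem _ hB, zero_add]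
    · rw [cut_apply_of_notMem _ hB, cut_apply_of_notMem _ hQ,
        cut_apply_of_notMem _ (fun h : S ∈ B ∪ Q => h.elim hB hQ), add_zero]

theorem diff_union (hdisj : Disjoint B Q) (z : E →₀ ℤ) :
    diff d (B ∪ Q) z = diff d B z + diff d Q z := cut_union hdisj _

theorem diff_eq_zero_of_no_arrow (h : ∀ S ∈ B, ∀ S' ∈ Q, ¬ Arrow d S S') {z : E →₀ ℤ}
    (hz : z ∈ Finsupp.supported ℤ ℤ B) : diff d Q z = 0 := by
  ext S'
  by_cases hS' : S' ∈ Q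
  · rw [diff, LinearMap.comp_apply, cut_apply_of_mem _ hS']
    exact apply_eq_zero hz fun S hS => h S hS S' hS'
  · exact cut_apply_of_notMem _ hS'

theorem cut_mem_grade {i j : ℤ} {X : Set E} {z : E →₀ ℤ}
    (hz : z ∈ Finsupp.supported ℤ ℤ (X ∩ gr i j)) :
    cut A z ∈ Finsupp.supported ℤ ℤ (A ∩ gr i j) := by
  rw [Finsupp.mem_supported'] at hz ⊢
  intro S hS
  by_cases h : S ∈ A
  · rw [cut_apply_of_mem _ h]
    exact hz S fun h' => hS ⟨h, h'.2⟩
  · exact cut_apply_of_notMem _ h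

/-- The long exact sequence of a subcomplex `B` with quotient `Q`, as far as vanishing of homology
is concerned. -/
theorem ExactOn.union (hd : ∀ z, d (d z) = 0) (hg : IsGrading d gr) (hconv : Convex d (B ∪ Q))
    (hdisj : Disjoint B Q) (hBQ : ∀ S ∈ B, ∀ S' ∈ Q, ¬ Arrow d S S') {i j : ℤ}
    (hB : ExactOn d gr B i j) (hQ : ExactOn d gr Q i j) : ExactOn d gr (B ∪ Q) i j := by
  intro z hz hz0
  have hzA := supported_mono Set.inter_subset_left hz
  have hz0B : diff d B z = 0 := by
    rw [← cut_diff_of_subset (A := B ∪ Q) Set.subset_union_left, hz0, map_zero]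
  have hz0Q : diff d Q z = 0 := by
    rw [← cut_diff_of_subset (A := B ∪ Q) Set.subset_union_right, hz0, map_zero]
  have hsplit : z = cut B z + cut Q z := by rw [← cut_union hdisj, cut_of_mem hzA]
  obtain ⟨w₁, hw₁, hw₁z⟩ := hQ (cut Q z) (cut_mem_grade hz) (by
    have h1 : diff d Q (cut B z) = 0 := diff_eq_zero_of_no_arrow hBQ (cut_mem _ _)
    rw [hsplit, map_add, h1, zero_add] at hz0Q
    exact hz0Q)
  have hw₁A : w₁ ∈ Finsupp.supported ℤ ℤ (B ∪ Q) :=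
    supported_mono (Set.inter_subset_left.trans Set.subset_union_right) hw₁
  set z' := cut B z - diff d B w₁ with hz'
  have hz'eq : z' = z - diff d (B ∪ Q) w₁ := by
    rw [diff_union hdisj, hw₁z, hz']
    nth_rewrite 2 [hsplit]
    abel
  obtain ⟨w₂, hw₂, hw₂z⟩ := hB z' (Submodule.sub_mem _ (cut_mem_grade hz) (diff_mem_grade hg hw₁))
    (by
      rw [hz'eq, map_sub, hz0B, ← cut_diff_of_subset (A := B ∪ Q) Set.subset_union_left,
        diff_diff hd hconv hw₁A, map_zero, sub_zero])
  refine ⟨w₁ + w₂, Submodule.add_mem _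
    (supported_mono (Set.inter_subset_inter_left _ Set.subset_union_right) hw₁)
    (supported_mono (Set.inter_subset_inter_left _ Set.subset_union_left) hw₂), ?_⟩
  have h2 : diff d Q w₂ = 0 :=
    diff_eq_zero_of_no_arrow hBQ (supported_mono Set.inter_subset_left hw₂)
  rw [map_add, diff_union hdisj w₂, h2, hw₂z, hz'eq]
  abel

/-- The component `B → C` of the differential is bijective in the strong sense that it is given by
a bijection of the bases and signs. -/
structure Matching (d : (E →₀ ℤ) →ₗ[ℤ] (E →₀ ℤ)) (B C : Set E) : Prop where
  exists_right : ∀ S ∈ B, ∃ S' ∈ C, Arrow d S S'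
  exists_left : ∀ S' ∈ C, ∃ S ∈ B, Arrow d S S'
  unique_right : ∀ S ∈ B, ∀ S' ∈ C, ∀ T' ∈ C, Arrow d S S' → Arrow d S T' → S' = T'
  unique_left : ∀ S' ∈ C, ∀ S ∈ B, ∀ T ∈ B, Arrow d S S' → Arrow d T S' → S = T
  unit : ∀ S ∈ B, ∀ S' ∈ C, Arrow d S S' →
    d (Finsupp.single S 1) S' * d (Finsupp.single S 1) S' = 1

/-- The inverse of the component `B → C` of the differential. -/
theorem Matching.exists_inverse (hg : IsGrading d gr) (h : Matching d B C) :
    ∃ g : (E →₀ ℤ) →ₗ[ℤ] (E →₀ ℤ),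
      (∀ i j, ∀ c ∈ Finsupp.supported ℤ ℤ (C ∩ gr i j),
        g c ∈ Finsupp.supported ℤ ℤ (B ∩ gr (i + 2) j)) ∧
      (∀ b ∈ Finsupp.supported ℤ ℤ B, g (diff d C b) = b) ∧
      (∀ c ∈ Finsupp.supported ℤ ℤ C, diff d C (g c) = c) := by
  classical
  choose e he hearr using h.exists_right
  choose e' he' hearr' using h.exists_left
  set g : (E →₀ ℤ) →ₗ[ℤ] (E →₀ ℤ) := Finsupp.linearCombination ℤ fun S' =>
    if hS' : S' ∈ C then
      d (Finsupp.single (e' S' hS') 1) S' • Finsupp.single (e' S' hS') 1 else 0 with hgdef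
  have hgs : ∀ S' (hS' : S' ∈ C), g (Finsupp.single S' 1) =
      d (Finsupp.single (e' S' hS') 1) S' • Finsupp.single (e' S' hS') 1 := by
    intro S' hS'
    simp [hgdef, hS']
  have hds : ∀ S (hS : S ∈ B), ∀ S' ∈ C, Arrow d S S' → diff d C (Finsupp.single S 1) =
      d (Finsupp.single S 1) S' • Finsupp.single S' 1 := by
    intro S hS S' hS' harr
    ext T
    by_cases hT : T ∈ C
    · rw [diff, LinearMap.comp_apply, cut_apply_of_mem _ hT, Finsupp.smul_apply,
        Finsupp.single_apply]
      by_cases hTS : S' = T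
      · rw [if_pos hTS, hTS]
        simp
      · rw [if_neg hTS, smul_zero]
        by_contra hne
        exact hTS (h.unique_right S hS S' hS' T hT harr hne)
    · rw [diff, LinearMap.comp_apply, cut_apply_of_notMem _ hT, Finsupp.smul_apply,
        Finsupp.single_apply, if_neg, smul_zero]
      rintro rfl
      exact hT hS'
  refine ⟨g, fun i j c hc => ?_, fun b hb => ?_, fun c hc => ?_⟩
  · have hle : Finsupp.supported ℤ ℤ (C ∩ gr i j) ≤
        (Finsupp.supported ℤ ℤ (B ∩ gr (i + 2) j)).comap g := by
      rw [Finsupp.supported_eq_span_single, Submodule.span_le]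
      rintro _ ⟨S', hS', rfl⟩
      rw [SetLike.mem_coe, Submodule.mem_comap, hgs S' hS'.1]
      refine Submodule.smul_mem _ _ (Finsupp.single_mem_supported _ _ ⟨he' _ _, ?_⟩)
      obtain ⟨i', j', hij⟩ := hg.exists_mem (e' S' hS'.1)
      obtain ⟨h1, h2⟩ := hg.unique hS'.2 (hg.arrow hij (hearr' S' hS'.1))
      obtain rfl : i' = i + 2 := by omega
      exact h2 ▸ hij
    exact hle hc
  · have heq : Set.EqOn (g ∘ₗ diff d C)
        (LinearMap.id : (E →₀ ℤ) →ₗ[ℤ] (E →₀ ℤ)) (Finsupp.supported ℤ ℤ B) := by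
      rw [Finsupp.supported_eq_span_single]
      refine LinearMap.eqOn_span' ?_
      rintro _ ⟨S, hS, rfl⟩
      have h1 := hds S hS _ (he S hS) (hearr S hS)
      have h2 : e' (e S hS) (he S hS) = S :=
        h.unique_left _ (he S hS) _ (he' _ _) _ hS (hearr' _ _) (hearr S hS)
      rw [LinearMap.comp_apply, h1, map_smul, hgs _ (he S hS), h2, smul_smul,
        h.unit S hS _ (he S hS) (hearr S hS), one_smul]
      rfl
    exact heq hb
  · have heq : Set.EqOn (diff d C ∘ₗ g)
        (LinearMap.id : (E →₀ ℤ) →ₗ[ℤ] (E →₀ ℤ)) (Finsupp.supported ℤ ℤ C) := by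
      rw [Finsupp.supported_eq_span_single]
      refine LinearMap.eqOn_span' ?_
      rintro _ ⟨S', hS', rfl⟩
      rw [LinearMap.comp_apply, hgs S' hS', map_smul,
        hds _ (he' S' hS') S' hS' (hearr' S' hS'), smul_smul,
        h.unit _ (he' S' hS') _ hS' (hearr' _ _), one_smul]
      rfl
    exact heq hc

section Cone

variable (hd : ∀ z, d (d z) = 0) (hg : IsGrading d gr) (h : Matching d B C)
  (hconv : Convex d (B ∪ C)) (hdisj : Disjoint B C) (hCB : ∀ S ∈ C, ∀ S' ∈ B, ¬ Arrow d S S')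

include hd hconv hdisj hCB in
/-- In the cone of `B → C` this map anticommutes with the differentials of `B` and `C`. -/
theorem diff_anticomm {b : E →₀ ℤ} (hb : b ∈ Finsupp.supported ℤ ℤ B) :
    diff d B (diff d B b) = 0 ∧ diff d C (diff d B b) + diff d C (diff d C b) = 0 := by
  have h1 := diff_diff hd hconv (supported_mono Set.subset_union_left hb)
  have h2 : diff d B (diff d C b) = 0 := diff_eq_zero_of_no_arrow hCB (diff_mem _)
  have h3 : diff d B (diff d (B ∪ C) b) = diff d B (diff d B b) := by
    rw [diff_union hdisj, map_add, h2, add_zero]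
  have h4 : diff d C (diff d (B ∪ C) b) = diff d C (diff d B b) + diff d C (diff d C b) := by
    rw [diff_union hdisj, map_add]
  rw [← h3, ← h4, ← cut_diff_of_subset (A := B ∪ C) Set.subset_union_left,
    ← cut_diff_of_subset (A := B ∪ C) Set.subset_union_right, h1, map_zero, map_zero]
  exact ⟨rfl, rfl⟩

include hd hg h hconv hdisj hCB in
/-- The mapping cone of an isomorphism has no homology. -/
theorem Matching.exactOn_union (i j : ℤ) : ExactOn d gr (B ∪ C) i j := by
  obtain ⟨g, hg1, hg2, hg3⟩ := h.exists_inverse hg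
  intro z hz hz0
  have hzA := supported_mono Set.inter_subset_left hz
  have hsplit : cut B z + cut C z = z := by rw [← cut_union hdisj, cut_of_mem hzA]
  have hw := hg1 i j (cut C z) (cut_mem_grade hz)
  have hwB := supported_mono Set.inter_subset_left hw
  set w := g (cut C z) with hwdef
  have hwC : diff d C w = cut C z := hg3 _ (cut_mem _ _)
  have hz0C : diff d C (cut B z) + diff d C (cut C z) = 0 := by
    rw [← map_add, hsplit, ← cut_diff_of_subset (A := B ∪ C) Set.subset_union_right, hz0, map_zero]
  have hanti := (diff_anticomm hd hconv hdisj hCB hwB).2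
  rw [hwC] at hanti
  have heq : diff d B w = cut B z := by
    rw [← hg2 _ (diff_mem w), ← hg2 _ (cut_mem B z)]
    exact congrArg g (add_right_cancel (hanti.trans hz0C.symm))
  refine ⟨w, supported_mono (Set.inter_subset_inter_left _ Set.subset_union_left) hw, ?_⟩
  rw [diff_union hdisj, hwC, heq, hsplit]

include hd hg h hconv hdisj hCB in
/-- An isomorphism `B → C` carries vanishing of homology from `C` to `B`. -/
theorem Matching.exactOn_left {i j : ℤ} (hC : ExactOn d gr C i j) : ExactOn d gr B (i + 2) j := by
  obtain ⟨g, hg1, hg2, hg3⟩ := h.exists_inverse hg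
  intro b hb hb0
  have hbB := supported_mono Set.inter_subset_left hb
  have hanti := (diff_anticomm hd hconv hdisj hCB hbB).2
  rw [hb0, map_zero, zero_add] at hanti
  obtain ⟨c, hc, hcb⟩ := hC _ (diff_mem_grade hg hb) hanti
  have hgc := hg1 _ _ c hc
  have hgcB := supported_mono Set.inter_subset_left hgc
  have hanti' := (diff_anticomm hd hconv hdisj hCB hgcB).2
  rw [hg3 c (supported_mono Set.inter_subset_left hc), hcb, ← map_add] at hanti'
  refine ⟨-g c, Submodule.neg_mem _ hgc, ?_⟩
  have := hg2 _ (Submodule.add_mem _ (diff_mem (d := d) (A := B) (g c)) hbB)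
  rw [hanti', map_zero] at this
  rw [map_neg]
  exact neg_eq_of_add_eq_zero_right this.symm

include hd hg h hconv hdisj hCB in
/-- An isomorphism `B → C` carries vanishing of homology from `B` to `C`. -/
theorem Matching.exactOn_right {i j : ℤ} (hB : ExactOn d gr B (i + 2) j) : ExactOn d gr C i j := by
  obtain ⟨g, hg1, hg2, hg3⟩ := h.exists_inverse hg
  intro c hc hc0
  have hcC := supported_mono Set.inter_subset_left hc
  have hgc := hg1 _ _ c hc
  have hgcB := supported_mono Set.inter_subset_left hgc
  have hanti := (diff_anticomm hd hconv hdisj hCB hgcB).2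
  rw [hg3 c hcC, hc0, add_zero] at hanti
  have hb0 : diff d B (g c) = 0 := by
    rw [← hg2 _ (diff_mem (g c)), hanti, map_zero]
  obtain ⟨b, hb, hbc⟩ := hB _ hgc hb0
  have hanti' := (diff_anticomm hd hconv hdisj hCB (supported_mono Set.inter_subset_left hb)).2
  rw [hbc, hg3 c hcC] at hanti'
  refine ⟨-diff d C b, Submodule.neg_mem _ (diff_mem_grade hg hb), ?_⟩
  rw [map_neg]
  exact neg_eq_of_add_eq_zero_left hanti'

end Cone

/-- Transport of exactness along an isomorphism of subquotients that shifts the grading. -/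
theorem exactOn_iff_of_iso {φ ψ : (E →₀ ℤ) →ₗ[ℤ] (E →₀ ℤ)} {n : ℤ}
    (hφ : ∀ i j, ∀ z ∈ Finsupp.supported ℤ ℤ (A ∩ gr i j),
      φ z ∈ Finsupp.supported ℤ ℤ (B ∩ gr i (j + n)))
    (hψ : ∀ i j, ∀ z ∈ Finsupp.supported ℤ ℤ (B ∩ gr i (j + n)),
      ψ z ∈ Finsupp.supported ℤ ℤ (A ∩ gr i j))
    (hψφ : ∀ z ∈ Finsupp.supported ℤ ℤ A, ψ (φ z) = z)
    (hφψ : ∀ z ∈ Finsupp.supported ℤ ℤ B, φ (ψ z) = z)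
    (hcomm : ∀ z ∈ Finsupp.supported ℤ ℤ A, φ (diff d A z) = diff d B (φ z)) {i j : ℤ} :
    ExactOn d gr A i j ↔ ExactOn d gr B i (j + n) := by
  have hsub : ∀ {X : Set E} {i j : ℤ} {z : E →₀ ℤ},
      z ∈ Finsupp.supported ℤ ℤ (X ∩ gr i j) → z ∈ Finsupp.supported ℤ ℤ X := fun hz =>
    supported_mono Set.inter_subset_left hz
  constructor
  · intro h z hz hz0
    have hψz := hψ _ _ z hz
    obtain ⟨w, hw, hwz⟩ := h (ψ z) hψz (by
      rw [← hψφ _ (diff_mem (ψ z)), hcomm _ (hsub hψz), hφψ z (hsub hz), hz0, map_zero])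
    refine ⟨φ w, hφ _ _ w hw, ?_⟩
    rw [← hcomm w (hsub hw), hwz, hφψ z (hsub hz)]
  · intro h z hz hz0
    obtain ⟨w, hw, hwz⟩ := h (φ z) (hφ _ _ z hz) (by rw [← hcomm z (hsub hz), hz0, map_zero])
    have hψw := hψ _ _ w hw
    refine ⟨ψ w, hψw, ?_⟩
    rw [← hψφ _ (diff_mem (ψ w)), hcomm _ (hsub hψw), hφψ w (hsub hw), hwz, hψφ z (hsub hz)]

end BasedComplex

/-! ### Faces of the cube of resolutions -/

namespace LinkDiagram

open CrossingEnd EnhancedState BasedComplex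

variable {V : Type u} [Fintype V] {D : LinkDiagram V} {c : V}

section Incidence

variable {S S' : D.EnhancedState}

theorem EnhancedState.Incident.lab_of_merge (h0 : D.circles = 0) (halt : D.Alternating)
    (h : S.Incident S' c) (k : Fin 4)
    (hs : D.circleAt S.state (c, k) ≠ D.circleAt S.state (c, k + 2)) :
    (S'.lab (c, k) : ℤ) = S.lab (c, k) + S.lab (c, k + 2) + 1 := by
  obtain ⟨hd, hl, hτ⟩ := (incident_iff h0).1 h
  exact (τ_iff_of_merge h0 hd.agree k hl hs
    ((circleAt_opposite_flip halt hd.agree h.differ k).2 hs)).1 hτ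

theorem EnhancedState.Incident.lab_of_split (h0 : D.circles = 0) (halt : D.Alternating)
    (h : S.Incident S' c) (k : Fin 4)
    (hs : D.circleAt S.state (c, k) = D.circleAt S.state (c, k + 2)) :
    (S'.lab (c, k) : ℤ) + S'.lab (c, k + 2) = S.lab (c, k) + 1 := by
  obtain ⟨hd, hl, hτ⟩ := (incident_iff h0).1 h
  refine (τ_iff_of_split h0 hd.agree k hl hs fun h' => ?_).1 hτ
  exact (circleAt_opposite_flip halt hd.agree h.differ k).1 h' hs

/-- Enhanced states are determined by their underlying state, their signs away from `c`, and the
signs of the circles at `c`. -/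
theorem EnhancedState.ext_of_crossing (h0 : D.circles = 0) (hs : S.state = S'.state) (k : Fin 4)
    (hoff : ∀ x, ¬ D.Meets S.state c x → S.lab x = S'.lab x)
    (h1 : S.lab (c, k) = S'.lab (c, k)) (h2 : S.lab (c, k + 2) = S'.lab (c, k + 2)) : S = S' := by
  refine ext_lab h0 hs fun x => ?_
  by_cases hx : D.Meets S.state c x
  · rcases (meets_iff k).1 hx with h | h
    · rw [lab_congr h, h1]
      exact (lab_congr (by rw [← hs, h])).symm
    · rw [lab_congr h, h2]
      exact (lab_congr (by rw [← hs, h])).symm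
  · exact hoff x hx

open Classical in
/-- The enhanced state over `s` that agrees with `S` away from `c`, and whose circles at `c` are
positive. -/
noncomputable def plusAt (h0 : D.circles = 0) (S : D.EnhancedState) (s : D.State) (c : V) :
    D.EnhancedState :=
  ofLab h0 s fun x => if D.Meets s c x then 1 else S.lab x

open Classical in
theorem lab_plusAt (h0 : D.circles = 0) {s : D.State} (hs : ∀ v, v ≠ c → s v = S.state v)
    (x : CrossingEnd V) : (plusAt h0 S s c).lab x = if D.Meets s c x then 1 else S.lab x := by
  refine lab_ofLab h0 (fun x y hxy => ?_) x
  rw [meets_congr hxy]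
  split_ifs with h
  · rfl
  · exact lab_congr ((circleAt_flip_of_not_meets hs ((meets_congr hxy).not.2 h)).1 hxy)

theorem lab_plusAt_self (h0 : D.circles = 0) {s : D.State} (hs : ∀ v, v ≠ c → s v = S.state v)
    (k : Fin 4) : (plusAt h0 S s c).lab (c, k) = 1 := by
  rw [lab_plusAt h0 hs, if_pos (meets_self k)]

theorem lab_plusAt_of_not_meets (h0 : D.circles = 0) {s : D.State}
    (hs : ∀ v, v ≠ c → s v = S.state v) {x : CrossingEnd V} (hx : ¬ D.Meets s c x) :
    (plusAt h0 S s c).lab x = S.lab x := by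
  rw [lab_plusAt h0 hs, if_neg hx]

end Incidence

/-- The enhanced states of bidegree `(i, j)`. -/
def gr (D : LinkDiagram V) (i j : ℤ) : Set D.EnhancedState := {S | S.σ = i ∧ S.σ + 2 * S.τ = j}

/-- The face of the cube of resolutions in which the crossings outside `U` are smoothed according
to `s`. -/
def face (D : LinkDiagram V) (U : Finset V) (s : D.State) : Set D.EnhancedState :=
  {S | ∀ v, v ∉ U → S.state v = s v}

/-- The enhanced states in which the circle through `x` has sign `ε`. -/
def labelled (D : LinkDiagram V) (x : CrossingEnd V) (ε : ℤˣ) : Set D.EnhancedState :=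
  {S | S.lab x = ε}

open Classical in
/-- Turn a positive sign of the circle through `x` into a negative one, and annihilate the other
enhanced states. -/
noncomputable def lower (D : LinkDiagram V) (x : CrossingEnd V) : D.Chain →ₗ[ℤ] D.Chain where
  toFun z := Finsupp.equivFunOnFinite.symm fun S => if S.lab x = -1 then z (S.relabel x 1) else 0
  map_add' z w := by
    ext S
    simp only [Finsupp.equivFunOnFinite_symm_apply_apply, Finsupp.add_apply]
    split_ifs <;> simp
  map_smul' n z := by
    ext S
    simp only [Finsupp.equivFunOnFinite_symm_apply_apply, Finsupp.smul_apply, RingHom.id_apply]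
    split_ifs <;> simp

open Classical in
theorem lower_apply (x : CrossingEnd V) (z : D.Chain) (S : D.EnhancedState) :
    D.lower x z S = if S.lab x = -1 then z (S.relabel x 1) else 0 := by
  simp [lower]

theorem relabel_mem_gr_iff {S : D.EnhancedState} {x : CrossingEnd V} (h : S.lab x = -1) {i j : ℤ} :
    S.relabel x 1 ∈ D.gr i (j + 4) ↔ S ∈ D.gr i j := by
  simp only [gr, Set.mem_ofPred_eq, σ_relabel, τ_relabel, h]
  push_cast
  constructor <;> rintro ⟨h1, h2⟩ <;> exact ⟨h1, by linarith⟩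

variable [LinearOrder V]

theorem d_raise (h0 : D.circles = 0) (halt : D.Alternating) (x : CrossingEnd V) (z : D.Chain) :
    D.d (D.raise x z) = D.raise x (D.d z) := by
  refine chain_hom_ext (f := D.d ∘ₗ D.raise x) (g := D.raise x ∘ₗ D.d) (fun S => ?_) z
  simp only [LinearMap.comp_apply]
  rw [d_single, map_sum]
  simp only [map_smul, ← step_raise h0 halt]
  by_cases hx : S.lab x = 1
  · simp [raise_single_of_pos hx]
  · rw [raise_single_of_neg (neg_one_of_ne_one hx), d_single]
    rfl

/-- Changing the sign of a distinguished circle is an isomorphism of subquotient complexes. -/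
theorem exactOn_relabel_iff (h0 : D.circles = 0) (halt : D.Alternating) {X : Set D.EnhancedState}
    (x : CrossingEnd V) (hX : ∀ S ε, S.relabel x ε ∈ X ↔ S ∈ X) {i j : ℤ} :
    ExactOn D.d D.gr (X ∩ D.labelled x (-1)) i j ↔
      ExactOn D.d D.gr (X ∩ D.labelled x 1) i (j + 4) := by
  have hback : ∀ {S : D.EnhancedState}, S.lab x = 1 → (S.relabel x (-1)).relabel x 1 = S :=
    fun h => by rw [relabel_relabel, relabel_lab h]
  have hback' : ∀ {S : D.EnhancedState}, S.lab x = -1 → (S.relabel x 1).relabel x (-1) = S :=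
    fun h => by rw [relabel_relabel, relabel_lab h]
  refine exactOn_iff_of_iso (φ := D.raise x) (ψ := D.lower x) ?_ ?_ ?_ ?_ ?_
  · intro i j z hz
    rw [Finsupp.mem_supported'] at hz ⊢
    intro S hS
    rw [raise_apply]
    split_ifs with h
    · refine hz _ fun hmem => hS ⟨⟨(hX _ _).1 hmem.1.1, h⟩, ?_⟩
      rw [← hback h]
      exact (relabel_mem_gr_iff (lab_relabel_self _ _)).2 hmem.2
    · rfl
  · intro i j z hz
    rw [Finsupp.mem_supported'] at hz ⊢
    intro S hS
    rw [lower_apply]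
    split_ifs with h
    · exact hz _ fun hmem =>
        hS ⟨⟨(hX _ _).1 hmem.1.1, h⟩, (relabel_mem_gr_iff h).1 hmem.2⟩
    · rfl
  · intro z hz
    rw [Finsupp.mem_supported'] at hz
    ext S
    rw [lower_apply]
    split_ifs with h
    · rw [raise_apply, if_pos (lab_relabel_self _ _), hback' h]
    · exact (hz S fun hmem => h hmem.2).symm
  · intro z hz
    rw [Finsupp.mem_supported'] at hz
    ext S
    rw [raise_apply]
    split_ifs with h
    · rw [lower_apply, if_pos (lab_relabel_self _ _), hback h]
    · exact (hz S fun hmem => h hmem.2).symm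
  · intro z hz
    rw [diff, diff, LinearMap.comp_apply, LinearMap.comp_apply, d_raise h0 halt]
    classical
    ext S
    rw [raise_apply, cut_apply, cut_apply, raise_apply]
    by_cases h : S.lab x = 1
    · have h1 : S.relabel x (-1) ∈ X ∩ D.labelled x (-1) ↔ S ∈ X ∩ D.labelled x 1 :=
        ⟨fun h' => ⟨(hX _ _).1 h'.1, h⟩, fun h' => ⟨(hX _ _).2 h'.1, lab_relabel_self _ _⟩⟩
      simp only [h1, if_pos h]
    · simp [h]

theorem d_single_apply (S S' : D.EnhancedState) : D.d (Finsupp.single S 1) S'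
    = ∑ c, koszulSign S.state c * D.step c (Finsupp.single S 1) S' := by
  rw [d_single, Finsupp.finsetSum_apply]
  rfl

theorem exists_incident {S S' : D.EnhancedState} (h : Arrow D.d S S') : ∃ c, S.Incident S' c := by
  by_contra! hcon
  refine h ?_
  classical
  rw [d_single_apply]
  refine Finset.sum_eq_zero fun c _ => ?_
  rw [step_single_apply, if_neg (hcon c), mul_zero]

open Classical in
theorem d_single_apply_of_ne {S S' : D.EnhancedState} (h : S.state c ≠ S'.state c) :
    D.d (Finsupp.single S 1) S' = if S.Incident S' c then koszulSign S.state c else 0 := by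
  rw [d_single_apply, Finset.sum_eq_single c]
  · rw [step_single_apply, mul_ite, mul_one, mul_zero]
  · intro v _ hv
    rw [step_single_apply, if_neg, mul_zero]
    exact fun h' => h (h'.agree c hv.symm)
  · simp

theorem koszulSign_ne_zero (s : V → ℤˣ) (c : V) : koszulSign s c ≠ 0 := by
  intro h
  have := koszulSign_mul_self s c
  rw [h] at this
  exact absurd this (by decide)

theorem arrow_iff_incident {S S' : D.EnhancedState} (h : S.state c ≠ S'.state c) :
    Arrow D.d S S' ↔ S.Incident S' c := by
  classical
  unfold Arrow
  rw [d_single_apply_of_ne h]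
  split_ifs with h'
  · exact iff_of_true (koszulSign_ne_zero _ _) h'
  · exact iff_of_false (not_not.2 rfl) h'

theorem isGrading_gr : IsGrading D.d D.gr where
  arrow := by
    rintro i j S S' ⟨h1, h2⟩ h
    obtain ⟨c, hc⟩ := exists_incident h
    exact ⟨by rw [hc.left_degree, h1], by rw [hc.right_degree, h2]⟩
  exists_mem S := ⟨_, _, rfl, rfl⟩
  unique := by
    rintro S i j i' j' ⟨h1, h2⟩ ⟨h3, h4⟩
    exact ⟨h1.symm.trans h3, h2.symm.trans h4⟩

theorem arrow_state (h0 : D.circles = 0) {S S' : D.EnhancedState} (h : Arrow D.d S S') (v : V) :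
    S'.state v = S.state v ∨ (S.state v = 1 ∧ S'.state v = -1) := by
  obtain ⟨c, hc⟩ := exists_incident h
  by_cases hv : v = c
  · subst hv
    have := ((incident_iff h0).1 hc).1
    exact Or.inr ⟨this.pos, this.neg⟩
  · exact Or.inl (hc.agree v hv).symm

theorem arrow_lab (h0 : D.circles = 0) (halt : D.Alternating) {S S' : D.EnhancedState}
    (h : Arrow D.d S S') {x : CrossingEnd V} (hx : S.lab x = 1) : S'.lab x = 1 := by
  obtain ⟨c, hc⟩ := exists_incident h
  exact hc.lab_eq_one h0 halt hx

theorem convex_face (h0 : D.circles = 0) (U : Finset V) (s : D.State) :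
    Convex D.d (D.face U s) := by
  intro S S' S'' hS hS'' h1 h2 v hv
  have e1 := hS v hv
  have e2 := hS'' v hv
  rcases arrow_state h0 h1 v with h | ⟨h, h'⟩
  · rw [h, e1]
  · rcases arrow_state h0 h2 v with h3 | ⟨h3, h3'⟩
    · rw [← h3, e2]
    · rw [h'] at h3
      exact absurd h3 (by decide)

theorem convex_labelled (h0 : D.circles = 0) (halt : D.Alternating) (x : CrossingEnd V) (ε : ℤˣ) :
    Convex D.d (D.labelled x ε) := by
  intro S S' S'' hS hS'' h1 h2
  rcases Int.units_eq_one_or ε with rfl | rfl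
  · exact arrow_lab h0 halt h1 hS
  · refine neg_one_of_ne_one fun h => ?_
    have h3 := arrow_lab h0 halt h2 h
    rw [show S''.lab x = -1 from hS''] at h3
    exact absurd h3 (by decide)

section Matchings

variable {U : Finset V} {s : D.State} {k : Fin 4}

omit [LinearOrder V] in
theorem state_eq_of_mem_face {ε : ℤˣ} {S : D.EnhancedState} (h : S ∈ D.face U (mark s c ε))
    (hc : c ∉ U) : S.state c = ε := by
  rw [h c hc, mark_self]

theorem mem_face_mark {ε ε' : ℤˣ} {S S' : D.EnhancedState} (h : S ∈ D.face U (mark s c ε))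
    (hagree : ∀ v, v ≠ c → S'.state v = S.state v) (hc : S'.state c = ε') :
    S' ∈ D.face U (mark s c ε') := by
  intro v hv
  by_cases hvc : v = c
  · subst hvc
    rw [hc, mark_self]
  · rw [hagree v hvc, h v hv, mark_of_ne _ hvc, mark_of_ne _ hvc]

omit [LinearOrder V] in
theorem state_ne_of_faces {S S' : D.EnhancedState} (hS : S ∈ D.face U (mark s c 1))
    (hS' : S' ∈ D.face U (mark s c (-1))) (hc : c ∉ U) : S.state c ≠ S'.state c := by
  rw [state_eq_of_mem_face hS hc, state_eq_of_mem_face hS' hc]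
  decide

theorem matching_of_incident {B C : Set D.EnhancedState} (hne : ∀ S ∈ B, ∀ S' ∈ C,
      S.state c ≠ S'.state c)
    (h1 : ∀ S ∈ B, ∃ S' ∈ C, S.Incident S' c) (h2 : ∀ S' ∈ C, ∃ S ∈ B, S.Incident S' c)
    (h3 : ∀ S ∈ B, ∀ S' ∈ C, ∀ T' ∈ C, S.Incident S' c → S.Incident T' c → S' = T')
    (h4 : ∀ S' ∈ C, ∀ S ∈ B, ∀ T ∈ B, S.Incident S' c → T.Incident S' c → S = T) :
    Matching D.d B C where
  exists_right S hS := by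
    obtain ⟨S', hS', h⟩ := h1 S hS
    exact ⟨S', hS', (arrow_iff_incident (hne S hS S' hS')).2 h⟩
  exists_left S' hS' := by
    obtain ⟨S, hS, h⟩ := h2 S' hS'
    exact ⟨S, hS, (arrow_iff_incident (hne S hS S' hS')).2 h⟩
  unique_right S hS S' hS' T' hT' h h' := h3 S hS S' hS' T' hT'
    ((arrow_iff_incident (hne S hS S' hS')).1 h) ((arrow_iff_incident (hne S hS T' hT')).1 h')
  unique_left S' hS' S hS T hT h h' := h4 S' hS' S hS T hT
    ((arrow_iff_incident (hne S hS S' hS')).1 h) ((arrow_iff_incident (hne T hT S' hS')).1 h')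
  unit S hS S' hS' h := by
    classical
    have h' := (arrow_iff_incident (hne S hS S' hS')).1 h
    rw [d_single_apply_of_ne (hne S hS S' hS'), if_pos h', koszulSign_mul_self]

/-- If all the states of a face merge two circles at `c`, then merging the circle at `(c, k)` with
a negative one at the opposite end is a bijection. -/
theorem matching_of_merge (h0 : D.circles = 0) (halt : D.Alternating) (hc : c ∉ U)
    (hmerge : ∀ S ∈ D.face U (mark s c 1),
      D.circleAt S.state (c, k) ≠ D.circleAt S.state (c, k + 2)) :
    Matching D.d (D.face U (mark s c 1) ∩ D.labelled (c, k) 1 ∩ D.labelled (c, k + 2) (-1))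
      (D.face U (mark s c (-1)) ∩ D.labelled (c, k) 1) := by
  have hjoin : ∀ {S S' : D.EnhancedState}, S ∈ D.face U (mark s c 1) →
      IsDrop (D := D) S.state S'.state c →
      D.circleAt S'.state (c, k) = D.circleAt S'.state (c, k + 2) := fun hS hd =>
    (circleAt_opposite_flip halt hd.agree (by rw [hd.pos, hd.neg]; decide) k).2 (hmerge _ hS)
  refine matching_of_incident (c := c) (fun S hS S' hS' => state_ne_of_faces hS.1.1 hS'.1 hc)
    ?_ ?_ ?_ ?_
  · rintro S ⟨⟨hS, hk⟩, hk'⟩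
    have hSc := state_eq_of_mem_face hS hc
    have hd : IsDrop (D := D) S.state (mark S.state c (-1)) c := isDrop_mark hSc
    have hs' : ∀ v, v ≠ c → mark S.state c (-1) v = S.state v := fun v hv => mark_of_ne _ hv _
    refine ⟨plusAt h0 S (mark S.state c (-1)) c,
      ⟨mem_face_mark hS hs' (mark_self _ _ _), lab_plusAt_self h0 hs' k⟩, ?_⟩
    have hoff : ∀ x, ¬ D.Meets S.state c x →
        S.lab x = (plusAt h0 S (mark S.state c (-1)) c).lab x := fun x hx =>
      (lab_plusAt_of_not_meets h0 hs' (by rwa [meets_flip hs'])).symm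
    rw [incident_iff h0]
    refine ⟨hd, hoff, ?_⟩
    rw [τ_iff_of_merge h0 hd.agree k hoff (hmerge S hS) (hjoin hS hd), lab_plusAt_self h0 hs' k,
      show S.lab (c, k) = 1 from hk, show S.lab (c, k + 2) = -1 from hk']
    decide
  · rintro S' ⟨hS', hk⟩
    have hS'c := state_eq_of_mem_face hS' hc
    have hs : ∀ v, v ≠ c → mark S'.state c 1 v = S'.state v := fun v hv => mark_of_ne _ hv _
    set T := plusAt h0 S' (mark S'.state c 1) c with hT
    have hTf : T ∈ D.face U (mark s c 1) := mem_face_mark hS' hs (mark_self _ _ _)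
    have hne := hmerge T hTf
    have hd : IsDrop (D := D) T.state S'.state c := ⟨mark_self _ _ _, hS'c, hs⟩
    have hk1 : (T.relabel (c, k + 2) (-1)).lab (c, k) = 1 := by
      rw [lab_relabel_of_ne hne, hT, lab_plusAt_self h0 hs]
    refine ⟨T.relabel (c, k + 2) (-1), ⟨⟨hTf, hk1⟩, lab_relabel_self _ _⟩, ?_⟩
    have hoff : ∀ x, ¬ D.Meets T.state c x → (T.relabel (c, k + 2) (-1)).lab x = S'.lab x := by
      intro x hx
      rw [lab_relabel_of_ne fun h => hx ⟨_, h⟩]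
      exact lab_plusAt_of_not_meets h0 hs hx
    rw [incident_iff h0]
    refine ⟨hd, hoff, ?_⟩
    rw [τ_iff_of_merge (S := T.relabel (c, k + 2) (-1)) h0 hd.agree k hoff hne (hjoin hTf hd), hk1,
      lab_relabel_self, show S'.lab (c, k) = 1 from hk]
    decide
  · rintro S ⟨⟨hS, -⟩, -⟩ S' ⟨hS', hk'⟩ T' ⟨hT', hkT⟩ h h'
    have hd := ((incident_iff h0).1 h).1
    have hd' := ((incident_iff h0).1 h').1
    refine ext_of_crossing (c := c) h0 (hd.eq_mark.trans hd'.eq_mark.symm) k (fun x hx => ?_)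
      (Eq.trans hk' (Eq.symm hkT)) ?_
    · rw [← meets_flip hd.agree] at hx
      exact (((incident_iff h0).1 h).2.1 x hx).symm.trans (((incident_iff h0).1 h').2.1 x hx)
    · rw [← lab_congr (hjoin hS hd), ← lab_congr (hjoin hS hd')]
      exact Eq.trans hk' (Eq.symm hkT)
  · rintro S' - S ⟨⟨hS, hk⟩, hk'⟩ T ⟨⟨hT, hkT⟩, hkT'⟩ h h'
    have hd := ((incident_iff h0).1 h).1
    have hd' := ((incident_iff h0).1 h').1
    have hst : S.state = T.state := by
      funext v
      by_cases hv : v = c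
      · subst hv
        rw [hd.pos, hd'.pos]
      · rw [hd.agree v hv, hd'.agree v hv]
    refine ext_of_crossing (c := c) h0 hst k (fun x hx => ?_) (Eq.trans hk (Eq.symm hkT))
      (Eq.trans hk' (Eq.symm hkT'))
    have hx' := hx
    rw [hst] at hx'
    exact (((incident_iff h0).1 h).2.1 x hx).trans (((incident_iff h0).1 h').2.1 x hx').symm

/-- If all the states of a face split a circle at `c`, then splitting a positive circle into two
positive ones is a bijection. -/
theorem matching_of_split (h0 : D.circles = 0) (halt : D.Alternating) (hc : c ∉ U)
    (hsplit : ∀ S ∈ D.face U (mark s c (-1)),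
      D.circleAt S.state (c, k) ≠ D.circleAt S.state (c, k + 2)) :
    Matching D.d (D.face U (mark s c 1) ∩ D.labelled (c, k) 1)
      (D.face U (mark s c (-1)) ∩ D.labelled (c, k) 1 ∩ D.labelled (c, k + 2) 1) := by
  have hjoin : ∀ {S S' : D.EnhancedState}, S' ∈ D.face U (mark s c (-1)) →
      IsDrop (D := D) S.state S'.state c →
      D.circleAt S.state (c, k) = D.circleAt S.state (c, k + 2) := fun hS' hd =>
    (circleAt_opposite_flip halt (fun v hv => (hd.agree v hv).symm)
      (by rw [hd.pos, hd.neg]; decide) k).2 (hsplit _ hS')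
  refine matching_of_incident (c := c) (fun S hS S' hS' => state_ne_of_faces hS.1 hS'.1.1 hc)
    ?_ ?_ ?_ ?_
  · rintro S ⟨hS, hk⟩
    have hSc := state_eq_of_mem_face hS hc
    have hd : IsDrop (D := D) S.state (mark S.state c (-1)) c := isDrop_mark hSc
    have hs' : ∀ v, v ≠ c → mark S.state c (-1) v = S.state v := fun v hv => mark_of_ne _ hv _
    set T := plusAt h0 S (mark S.state c (-1)) c with hT
    have hTf : T ∈ D.face U (mark s c (-1)) := mem_face_mark hS hs' (mark_self _ _ _)
    refine ⟨T, ⟨⟨hTf, lab_plusAt_self h0 hs' k⟩, lab_plusAt_self h0 hs' _⟩, ?_⟩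
    have hoff : ∀ x, ¬ D.Meets S.state c x → S.lab x = T.lab x := fun x hx =>
      (lab_plusAt_of_not_meets h0 hs' (by rwa [meets_flip hs'])).symm
    rw [incident_iff h0]
    refine ⟨hd, hoff, ?_⟩
    rw [τ_iff_of_split h0 hd.agree k hoff (hjoin hTf hd) (hsplit T hTf), hT,
      lab_plusAt_self h0 hs', lab_plusAt_self h0 hs', show S.lab (c, k) = 1 from hk]
    decide
  · rintro S' ⟨⟨hS', hk⟩, hk'⟩
    have hS'c := state_eq_of_mem_face hS' hc
    have hs : ∀ v, v ≠ c → mark S'.state c 1 v = S'.state v := fun v hv => mark_of_ne _ hv _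
    set T := plusAt h0 S' (mark S'.state c 1) c with hT
    have hTf : T ∈ D.face U (mark s c 1) := mem_face_mark hS' hs (mark_self _ _ _)
    have hd : IsDrop (D := D) T.state S'.state c := ⟨mark_self _ _ _, hS'c, hs⟩
    refine ⟨T, ⟨hTf, lab_plusAt_self h0 hs k⟩, ?_⟩
    have hoff : ∀ x, ¬ D.Meets T.state c x → T.lab x = S'.lab x := fun x hx =>
      lab_plusAt_of_not_meets h0 hs hx
    rw [incident_iff h0]
    refine ⟨hd, hoff, ?_⟩
    rw [τ_iff_of_split h0 hd.agree k hoff (hjoin hS' hd) (hsplit S' hS'), hT,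
      lab_plusAt_self h0 hs, show S'.lab (c, k) = 1 from hk, show S'.lab (c, k + 2) = 1 from hk']
    decide
  · rintro S - S' ⟨⟨hS', hk⟩, hk'⟩ T' ⟨⟨hT', hkT⟩, hkT'⟩ h h'
    have hd := ((incident_iff h0).1 h).1
    have hd' := ((incident_iff h0).1 h').1
    refine ext_of_crossing (c := c) h0 (hd.eq_mark.trans hd'.eq_mark.symm) k (fun x hx => ?_)
      (Eq.trans hk (Eq.symm hkT)) (Eq.trans hk' (Eq.symm hkT'))
    rw [← meets_flip hd.agree] at hx
    exact (((incident_iff h0).1 h).2.1 x hx).symm.trans (((incident_iff h0).1 h').2.1 x hx)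
  · rintro S' ⟨⟨hS', -⟩, -⟩ S ⟨hS, hk⟩ T ⟨hT, hkT⟩ h h'
    have hd := ((incident_iff h0).1 h).1
    have hd' := ((incident_iff h0).1 h').1
    have hst : S.state = T.state := by
      funext v
      by_cases hv : v = c
      · subst hv
        rw [hd.pos, hd'.pos]
      · rw [hd.agree v hv, hd'.agree v hv]
    refine ext_of_crossing (c := c) h0 hst k (fun x hx => ?_) (Eq.trans hk (Eq.symm hkT)) ?_
    · have hx' := hx
      rw [hst] at hx'
      exact (((incident_iff h0).1 h).2.1 x hx).trans (((incident_iff h0).1 h').2.1 x hx').symm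
    · rw [← lab_congr (hjoin hS' hd), ← lab_congr (hjoin hS' hd')]
      exact Eq.trans hk (Eq.symm hkT)

end Matchings

end LinkDiagram

/-! ### Components of partially smoothed diagrams -/

namespace LinkDiagram

open CrossingEnd EnhancedState

variable {V : Type u} [Fintype V] {D : LinkDiagram V}

section Components

/-- The components of the diagram obtained from `D` by smoothing the crossings outside `U`
according to `s`. -/
def Comp (D : LinkDiagram V) (U : Finset V) (s : D.State) : Type u :=
  Quot fun x y : CrossingEnd V =>
    y = D.edge x ∨ y = (x.1, smoothing (s x.1) x.2) ∨ (x.1 ∈ U ∧ y.1 = x.1)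

/-- The component through `x` of the partially smoothed diagram. -/
def compAt (D : LinkDiagram V) (U : Finset V) (s : D.State) (x : CrossingEnd V) : D.Comp U s :=
  Quot.mk _ x

instance (D : LinkDiagram V) (U : Finset V) (s : D.State) : Finite (D.Comp U s) :=
  inferInstanceAs (Finite (Quot _))

variable {U : Finset V} {s : D.State} {c : V}

theorem compAt_surjective : Function.Surjective (D.compAt U s) := Quot.mk_surjective

theorem compAt_edge (x : CrossingEnd V) : D.compAt U s (D.edge x) = D.compAt U s x :=
  (Quot.sound (r := fun x y : CrossingEnd V =>
    y = D.edge x ∨ y = (x.1, smoothing (s x.1) x.2) ∨ (x.1 ∈ U ∧ y.1 = x.1)) (Or.inl rfl)).symm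

theorem compAt_smoothing (v : V) (k : Fin 4) :
    D.compAt U s (v, smoothing (s v) k) = D.compAt U s (v, k) :=
  (Quot.sound (r := fun x y : CrossingEnd V =>
    y = D.edge x ∨ y = (x.1, smoothing (s x.1) x.2) ∨ (x.1 ∈ U ∧ y.1 = x.1)) (a := (v, k))
    (Or.inr (Or.inl rfl))).symm

theorem compAt_crossing {v : V} (hv : v ∈ U) (k l : Fin 4) :
    D.compAt U s (v, k) = D.compAt U s (v, l) :=
  Quot.sound (Or.inr (Or.inr ⟨hv, rfl⟩))

/-- Lying on one component is the smallest equivalence relation that is compatible with the edges,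
the smoothings, and the crossings which are left. -/
theorem rel_of_compAt_eq {r : CrossingEnd V → CrossingEnd V → Prop} (hr : Equivalence r)
    (hedge : ∀ x, r x (D.edge x)) (hsm : ∀ v k, r (v, k) (v, smoothing (s v) k))
    (hU : ∀ v ∈ U, ∀ k l, r (v, k) (v, l))
    {x y : CrossingEnd V} (h : D.compAt U s x = D.compAt U s y) : r x y := by
  let S : Setoid (CrossingEnd V) := ⟨r, hr⟩
  have := congrArg (Quot.lift (Quotient.mk S) (by
    rintro ⟨x, k⟩ ⟨y, l⟩ (h | h | ⟨h, h'⟩)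
    · rw [h]
      exact Quotient.sound (hedge _)
    · rw [h]
      exact Quotient.sound (hsm _ _)
    · obtain rfl : y = x := h'
      exact Quotient.sound (hU _ h _ _))) h
  exact Quotient.exact this

theorem compAt_eq_of_circleAt_eq {t : D.State} (ht : ∀ v, v ∉ U → t v = s v)
    {x y : CrossingEnd V} (h : D.circleAt t x = D.circleAt t y) :
    D.compAt U s x = D.compAt U s y := by
  refine rel_of_circleAt_eq (r := fun x y => D.compAt U s x = D.compAt U s y)
    ⟨fun _ => rfl, Eq.symm, Eq.trans⟩ (fun x => (compAt_edge x).symm) (fun v k => ?_) h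
  by_cases hv : v ∈ U
  · exact compAt_crossing hv _ _
  · rw [ht v hv]
    exact (compAt_smoothing v k).symm

variable [DecidableEq V]

/-- The state in which the crossings in `U` have positive, the other ones the given markers. -/
def hi (D : LinkDiagram V) (U : Finset V) (s : D.State) : D.State :=
  fun v => if v ∈ U then 1 else s v

/-- The state in which the crossings in `U` have negative, the other ones the given markers. -/
def lo (D : LinkDiagram V) (U : Finset V) (s : D.State) : D.State :=
  fun v => if v ∈ U then -1 else s v

/-- Smoothing a crossing can only disconnect. -/
theorem compAt_insert_of_mark {ε : ℤˣ} {x y : CrossingEnd V}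
    (h : D.compAt U (mark s c ε) x = D.compAt U (mark s c ε) y) :
    D.compAt (insert c U) s x = D.compAt (insert c U) s y := by
  refine rel_of_compAt_eq (r := fun x y => D.compAt (insert c U) s x = D.compAt (insert c U) s y)
    ⟨fun _ => rfl, Eq.symm, Eq.trans⟩ (fun x => (compAt_edge x).symm) (fun v k => ?_)
    (fun v hv k l => compAt_crossing (Finset.mem_insert_of_mem hv) k l) h
  by_cases hv : v = c
  · subst hv
    exact compAt_crossing (Finset.mem_insert_self _ _) _ _
  · rw [mark_of_ne _ hv]
    exact (compAt_smoothing v k).symm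

/-- Smoothing `c` affects only the component of `c`, which it cuts in at most two. -/
theorem compAt_mark_of_insert {ε : ℤˣ} {x y : CrossingEnd V}
    (h : D.compAt (insert c U) s x = D.compAt (insert c U) s y) :
    D.compAt U (mark s c ε) x = D.compAt U (mark s c ε) y ∨
      ((D.compAt U (mark s c ε) x = D.compAt U (mark s c ε) (c, 0) ∨
        D.compAt U (mark s c ε) x = D.compAt U (mark s c ε) (c, 0 + 2)) ∧
      (D.compAt U (mark s c ε) y = D.compAt U (mark s c ε) (c, 0) ∨
        D.compAt U (mark s c ε) y = D.compAt U (mark s c ε) (c, 0 + 2))) := by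
  have hends : ∀ k, D.compAt U (mark s c ε) (c, k) = D.compAt U (mark s c ε) (c, 0) ∨
        D.compAt U (mark s c ε) (c, k) = D.compAt U (mark s c ε) (c, 0 + 2) := fun k =>
    (circleAt_crossing (mark s c ε) c 0 k).imp (compAt_eq_of_circleAt_eq fun _ _ => rfl)
      (compAt_eq_of_circleAt_eq fun _ _ => rfl)
  revert h
  generalize ha : D.compAt U (mark s c ε) (c, 0) = a at hends ⊢
  generalize hb : D.compAt U (mark s c ε) (c, 0 + 2) = b at hends ⊢
  intro h
  refine rel_of_compAt_eq (r := fun x y => D.compAt U (mark s c ε) x = D.compAt U (mark s c ε) y ∨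
      ((D.compAt U (mark s c ε) x = a ∨ D.compAt U (mark s c ε) x = b) ∧
      (D.compAt U (mark s c ε) y = a ∨ D.compAt U (mark s c ε) y = b)))
    ⟨fun _ => Or.inl rfl, ?_, ?_⟩ ?_ ?_ ?_ h
  · rintro x y (h | h)
    exacts [Or.inl h.symm, Or.inr h.symm]
  · rintro x y z (h1 | h1) (h2 | h2)
    · exact Or.inl (h1.trans h2)
    · exact Or.inr ⟨by rw [h1]; exact h2.1, h2.2⟩
    · exact Or.inr ⟨h1.1, by rw [← h2]; exact h1.2⟩
    · exact Or.inr ⟨h1.1, h2.2⟩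
  · exact fun x => Or.inl (compAt_edge x).symm
  · intro v k
    by_cases hv : v = c
    · subst hv
      exact Or.inr ⟨hends _, hends _⟩
    · rw [← mark_of_ne s hv ε]
      exact Or.inl (compAt_smoothing v k).symm
  · intro v hv k l
    by_cases hvc : v = c
    · subst hvc
      exact Or.inr ⟨hends _, hends _⟩
    · exact Or.inl (compAt_crossing (Finset.mem_of_mem_insert_of_ne hv hvc) k l)

/-- The map from the components after smoothing `c` to those before. -/
noncomputable def unsmooth (D : LinkDiagram V) (U : Finset V) (s : D.State) (c : V) (ε : ℤˣ) :
    D.Comp U (mark s c ε) → D.Comp (insert c U) s :=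
  fun C => D.compAt (insert c U) s (Function.surjInv compAt_surjective C)

theorem unsmooth_compAt (ε : ℤˣ) (x : CrossingEnd V) :
    D.unsmooth U s c ε (D.compAt U (mark s c ε) x) = D.compAt (insert c U) s x :=
  compAt_insert_of_mark (Function.surjInv_eq compAt_surjective _)

theorem unsmooth_injective {ε : ℤˣ}
    (h : D.compAt U (mark s c ε) (c, 0) = D.compAt U (mark s c ε) (c, 0 + 2)) :
    Function.Injective (D.unsmooth U s c ε) := by
  intro C C'
  obtain ⟨x, rfl⟩ := compAt_surjective C
  obtain ⟨y, rfl⟩ := compAt_surjective C'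
  rw [unsmooth_compAt, unsmooth_compAt]
  intro hxy
  rcases compAt_mark_of_insert (ε := ε) hxy with h' | ⟨h1, h2⟩
  · exact h'
  · rw [← h, or_self] at h1 h2
    rw [h1, h2]

theorem card_comp_of_ne {ε : ℤˣ}
    (h : D.compAt U (mark s c ε) (c, 0) ≠ D.compAt U (mark s c ε) (c, 0 + 2)) :
    Nat.card (D.Comp U (mark s c ε)) = Nat.card (D.Comp (insert c U) s) + 1 := by
  refine card_eq_of_identify (D.unsmooth U s c ε) (fun C => ?_) h ?_ fun C C' => ?_
  · obtain ⟨x, rfl⟩ := compAt_surjective C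
    exact ⟨_, unsmooth_compAt ε x⟩
  · rw [unsmooth_compAt, unsmooth_compAt]
    exact compAt_crossing (Finset.mem_insert_self _ _) _ _
  · obtain ⟨x, rfl⟩ := compAt_surjective C
    obtain ⟨y, rfl⟩ := compAt_surjective C'
    rw [unsmooth_compAt, unsmooth_compAt]
    exact compAt_mark_of_insert

theorem hi_insert (hc : c ∉ U) : D.hi (insert c U) s = D.hi U (mark s c 1) := by
  funext v
  unfold hi
  by_cases hv : v = c
  · subst hv
    simp [hc]
  · simp [hv, mark_of_ne s hv]

theorem lo_insert (hc : c ∉ U) : D.lo (insert c U) s = D.lo U (mark s c (-1)) := by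
  funext v
  unfold lo
  by_cases hv : v = c
  · subst hv
    simp [hc]
  · simp [hv, mark_of_ne s hv]

theorem hi_mark (hc : c ∉ U) (ε : ℤˣ) : D.hi U (mark s c ε) = mark (D.hi U s) c ε := by
  funext v
  unfold hi
  by_cases hv : v = c
  · subst hv
    simp [hc]
  · simp [mark_of_ne _ hv]

theorem lo_mark (hc : c ∉ U) (ε : ℤˣ) : D.lo U (mark s c ε) = mark (D.lo U s) c ε := by
  funext v
  unfold lo
  by_cases hv : v = c
  · subst hv
    simp [hc]
  · simp [mark_of_ne _ hv]

theorem hi_agree {v : V} (hv : v ∉ U) : D.hi U s v = s v := by simp [hi, hv]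

theorem lo_agree {v : V} (hv : v ∉ U) : D.lo U s v = s v := by simp [lo, hv]

/-- The Turaev surface of the partially smoothed diagram has the circles of the two extreme states
as its faces. Its Euler characteristic, `|hi| + |lo| - |U|`, is at most twice the number of its
components. -/
theorem numCircles_add_le (h0 : D.circles = 0) (halt : D.Alternating) (U : Finset V) :
    ∀ s : D.State, D.numCircles (D.hi U s) + D.numCircles (D.lo U s)
      ≤ U.card + 2 * Nat.card (D.Comp U s) := by
  induction U using Finset.induction_on with
  | empty =>
    intro s
    have h1 : D.hi ∅ s = s := by funext v; simp [hi]
    have h2 : D.lo ∅ s = s := by funext v; simp [lo]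
    rw [h1, h2]
    have : D.numCircles s ≤ Nat.card (D.Comp ∅ s) := by
      refine Nat.card_le_card_of_surjective
        (fun C => D.circleAt s (Function.surjInv compAt_surjective C)) fun C => ?_
      obtain ⟨x, rfl⟩ := circleAt_surjective h0 s C
      refine ⟨D.compAt ∅ s x, ?_⟩
      exact rel_of_compAt_eq (r := fun x y => D.circleAt s x = D.circleAt s y)
        ⟨fun _ => rfl, Eq.symm, Eq.trans⟩ (fun x => (circleAt_edge x).symm)
        (fun v k => (circleAt_smoothing v k).symm) (by simp)
        (Function.surjInv_eq compAt_surjective _)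
    simp
    omega
  | insert c U hc ih =>
    intro s
    have hIH := ih (mark s c 1)
    rw [hi_insert hc, Finset.card_insert_of_notMem hc]
    -- the positive smoothing of `c` keeps the state `hi` and changes one marker of `lo`
    set l := D.lo U (mark s c 1) with hl
    have hlc : l c = 1 := by rw [hl, lo_agree hc, mark_self]
    have hlo : D.lo (insert c U) s = mark l c (-1) := by
      rw [lo_insert hc, hl, lo_mark hc, lo_mark hc, mark_mark]
    rw [hlo]
    by_cases h : D.compAt U (mark s c 1) (c, 0) = D.compAt U (mark s c 1) (c, 0 + 2)
    · have h1 := Nat.card_le_card_of_injective _ (unsmooth_injective h)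
      have h2 := numCircles_mark_le h0 halt hlc
      omega
    · have h1 := card_comp_of_ne h
      have h2 := numCircles_mark_of_merge h0 halt hlc 0 fun h' =>
        h (compAt_eq_of_circleAt_eq (fun v hv => lo_agree hv) h')
      omega

/-- The partially smoothed diagram is connected, and its Turaev surface is a sphere. -/
structure ConnectedPlanar (D : LinkDiagram V) (U : Finset V) (s : D.State) : Prop where
  connected : Subsingleton (D.Comp U s)
  planar : D.numCircles (D.hi U s) + D.numCircles (D.lo U s) = U.card + 2

/-- The two smoothings of a crossing of a connected planar diagram: either both are connected, or
just one of them; in the latter case the strands at the crossing are never joined after the other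
smoothing. -/
theorem ConnectedPlanar.smooth (h0 : D.circles = 0) (halt : D.Alternating) (hc : c ∉ U)
    (h : D.ConnectedPlanar (insert c U) s) :
    (D.ConnectedPlanar U (mark s c 1) ∧ D.ConnectedPlanar U (mark s c (-1)) ∧
      D.numCircles (D.hi (insert c U) s) = D.numCircles (D.hi U (mark s c (-1))) + 1) ∨
    (D.ConnectedPlanar U (mark s c 1) ∧ ∀ t : D.State, (∀ v, v ∉ U → t v = mark s c (-1) v) →
      D.circleAt t (c, 0) ≠ D.circleAt t (c, 0 + 2)) ∨
    (D.ConnectedPlanar U (mark s c (-1)) ∧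
      D.numCircles (D.hi (insert c U) s) = D.numCircles (D.hi U (mark s c (-1))) + 1 ∧
      ∀ t : D.State, (∀ v, v ∉ U → t v = mark s c 1 v) →
        D.circleAt t (c, 0) ≠ D.circleAt t (c, 0 + 2)) := by
  obtain ⟨hconn, hpl⟩ := h
  rw [Finset.card_insert_of_notMem hc] at hpl
  set l := D.lo U (mark s c 1) with hl
  have hlc : l c = 1 := by rw [hl, lo_agree hc, mark_self]
  have hlo : D.lo (insert c U) s = mark l c (-1) := by
    rw [lo_insert hc, hl, lo_mark hc, lo_mark hc, mark_mark]
  have hlo' : D.lo U (mark s c (-1)) = mark l c (-1) := by rw [← lo_insert hc, hlo]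
  set u := D.hi (insert c U) s with hu
  have hu1 : D.hi U (mark s c 1) = u := (hi_insert hc).symm
  have huc : u c = 1 := by simp [hu, hi]
  have hu2 : D.hi U (mark s c (-1)) = mark u c (-1) := by
    rw [← hu1, hi_mark hc, hi_mark hc, mark_mark]
  have hconn' : ∀ ε, D.compAt U (mark s c ε) (c, 0) = D.compAt U (mark s c ε) (c, 0 + 2) →
      Subsingleton (D.Comp U (mark s c ε)) := fun ε h => (unsmooth_injective h).subsingleton
  have hcard : ∀ ε, D.compAt U (mark s c ε) (c, 0) = D.compAt U (mark s c ε) (c, 0 + 2) →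
      Nat.card (D.Comp U (mark s c ε)) ≤ 1 := fun ε h => by
    have := hconn' ε h
    exact Finite.card_le_one_iff_subsingleton.2 this
  have hcirc : ∀ ε, ∀ t : D.State, (∀ v, v ∉ U → t v = mark s c ε v) →
      D.circleAt t (c, 0) = D.circleAt t (c, 0 + 2) →
      D.compAt U (mark s c ε) (c, 0) = D.compAt U (mark s c ε) (c, 0 + 2) := fun ε t ht h =>
    compAt_eq_of_circleAt_eq ht h
  have hle1 := numCircles_add_le h0 halt U (mark s c 1)
  have hle2 := numCircles_add_le h0 halt U (mark s c (-1))
  rw [hu1, ← hl] at hle1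
  rw [hu2, hlo'] at hle2
  rw [hlo] at hpl
  have hag1 : ∀ v, v ∉ U → u v = mark s c 1 v := fun v hv => by rw [← hu1, hi_agree hv]
  have hag2 : ∀ v, v ∉ U → mark l c (-1) v = mark s c (-1) v := fun v hv => by
    rw [← hlo', lo_agree hv]
  by_cases hP : D.circleAt u (c, 0) = D.circleAt u (c, 0 + 2) <;>
    by_cases hl2 : D.circleAt l (c, 0) = D.circleAt l (c, 0 + 2)
  · have n1 := numCircles_mark_of_split h0 halt huc 0 hP
    have n2 := numCircles_mark_of_split h0 halt hlc 0 hl2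
    refine Or.inr (Or.inl ⟨⟨hconn' 1 (hcirc 1 u hag1 hP), by rw [hu1, ← hl]; omega⟩,
      fun t ht h => ?_⟩)
    have := hcard (-1) (hcirc _ t ht h)
    omega
  · -- both smoothings would disconnect the diagram, against planarity
    have n2 := numCircles_mark_of_merge h0 halt hlc 0 hl2
    have := hcard 1 (hcirc 1 u hag1 hP)
    omega
  · have n1 := numCircles_mark_of_merge h0 halt huc 0 hP
    have n2 := numCircles_mark_of_split h0 halt hlc 0 hl2
    have d1 : IsDrop (D := D) u (mark u c (-1)) c := isDrop_mark huc
    have hQ : D.circleAt (mark u c (-1)) (c, 0) = D.circleAt (mark u c (-1)) (c, 0 + 2) :=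
      (circleAt_opposite_flip halt d1.agree (by rw [d1.pos, d1.neg]; decide) 0).2 hP
    refine Or.inl ⟨⟨hconn' 1 (hcirc 1 l (fun v hv => lo_agree hv) hl2),
      by rw [hu1, ← hl]; omega⟩, ⟨hconn' (-1) (hcirc _ _ (fun v hv => ?_) hQ),
      by rw [hu2, hlo']; omega⟩, by rw [hu2]; exact n1⟩
    rw [← hu2, hi_agree hv]
  · have n1 := numCircles_mark_of_merge h0 halt huc 0 hP
    have n2 := numCircles_mark_of_merge h0 halt hlc 0 hl2
    have d1 : IsDrop (D := D) u (mark u c (-1)) c := isDrop_mark huc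
    have hQ : D.circleAt (mark u c (-1)) (c, 0) = D.circleAt (mark u c (-1)) (c, 0 + 2) :=
      (circleAt_opposite_flip halt d1.agree (by rw [d1.pos, d1.neg]; decide) 0).2 hP
    refine Or.inr (Or.inr ⟨⟨hconn' (-1) (hcirc _ _ (fun v hv => ?_) hQ),
      by rw [hu2, hlo']; omega⟩, by rw [hu2]; exact n1, fun t ht h => ?_⟩)
    · rw [← hu2, hi_agree hv]
    · have := hcard 1 (hcirc _ t ht h)
      omega

/-- In a connected partially smoothed diagram, following the strand through `p` leads to a crossing
that is not smoothed. -/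
theorem exists_crossing_on_circle (halt : D.Alternating) (hconn : Subsingleton (D.Comp U s))
    (hU : U.Nonempty) (p : CrossingEnd V) :
    ∃ c ∈ U, ∃ k, ∀ t : D.State, (∀ v, v ∉ U → t v = s v) →
      D.circleAt t (c, k) = D.circleAt t p := by
  by_contra! hcon
  -- `W`: the ends which lie on the circle of `p` however the remaining crossings are smoothed
  set W : Set (CrossingEnd V) := {x | ∀ t : D.State, (∀ v, v ∉ U → t v = s v) →
    D.circleAt t x = D.circleAt t p} with hW
  have hWU : ∀ x ∈ W, x.1 ∉ U := by
    intro x hx hxU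
    obtain ⟨t, ht, hne⟩ := hcon x.1 hxU x.2
    exact hne (hx t ht)
  have hover : ∀ x, (D.overEnd halt x).1 ∈ W ↔ x ∈ W := by
    intro x
    unfold overEnd
    split_ifs
    · rfl
    · simp only [hW, Set.mem_ofPred_eq, circleAt_edge]
  set f := D.nextOver halt (D.hi U s) with hf
  -- an upper end at a smoothed crossing has the same predecessor in all these states
  have hclosed : ∀ o : {x : CrossingEnd V // IsOver x}, o.1 ∈ W → (f⁻¹ o).1 ∈ W := by
    intro o ho t ht
    have h1 : (f⁻¹ o).1 = D.edge (o.1.1, smoothing (D.hi U s o.1.1) o.1.2) := rfl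
    rw [h1, circleAt_edge, hi_agree (hWU _ ho), ← ht _ (hWU _ ho), circleAt_smoothing]
    exact ho t ht
  have hpow : ∀ n : ℕ, ∀ o : {x : CrossingEnd V // IsOver x}, o.1 ∈ W → ((f⁻¹ ^ n) o).1 ∈ W := by
    intro n
    induction n with
    | zero => exact fun o ho => ho
    | succ n ih =>
      intro o ho
      rw [pow_succ', Equiv.Perm.mul_apply]
      exact hclosed _ (ih o ho)
  have hcircle : ∀ x, D.circleAt (D.hi U s) p = D.circleAt (D.hi U s) x → x ∈ W := by
    intro x hx
    rw [circleAt_eq_iff_sameCycle halt, ← Equiv.Perm.sameCycle_inv] at hx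
    obtain ⟨n, hn⟩ := hx.exists_nat_pow_eq
    rw [← hover, ← hn]
    exact hpow n _ ((hover p).2 fun t _ => rfl)
  have hback : ∀ x ∈ W, D.circleAt (D.hi U s) p = D.circleAt (D.hi U s) x := fun x hx =>
    (hx _ fun v hv => hi_agree hv).symm
  have hsm : ∀ v k, (v, k) ∈ W → (v, smoothing (s v) k) ∈ W := by
    intro v k hx t ht
    rw [← ht v (hWU _ hx), circleAt_smoothing]
    exact hx t ht
  obtain ⟨c, hc⟩ := hU
  have : (c, (0 : Fin 4)) ∈ W := by
    refine (rel_of_compAt_eq (r := fun x y => x ∈ W ↔ y ∈ W) ⟨fun _ => Iff.rfl, Iff.symm, Iff.trans⟩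
      (fun x => ?_) (fun v k => ?_) (fun v hv k l => ?_)
      (Subsingleton.elim (D.compAt U s p) (D.compAt U s (c, 0)))).1 fun t _ => rfl
    · simp only [hW, Set.mem_ofPred_eq, circleAt_edge]
    · refine ⟨hsm v k, fun h => ?_⟩
      have := hsm v _ h
      rwa [smoothing_smoothing] at this
    · exact iff_of_false (fun h => hWU _ h hv) fun h => hWU _ h hv
  exact hWU _ this hc

end Components

end LinkDiagram

/-! ### Reduced homology lies on one diagonal -/

namespace LinkDiagram

open CrossingEnd EnhancedState BasedComplex

variable {V : Type u} [Fintype V] [LinearOrder V] {D : LinkDiagram V}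

section Reduced

variable {U : Finset V} {s : D.State} {c : V}

theorem face_insert : D.face (insert c U) s = D.face U (mark s c 1) ∪ D.face U (mark s c (-1)) := by
  have key : ∀ ε, ∀ S : D.EnhancedState, S.state c = ε →
      S ∈ D.face (insert c U) s → S ∈ D.face U (mark s c ε) := by
    intro ε S hS h v hv
    by_cases hvc : v = c
    · subst hvc
      rw [hS, mark_self]
    · rw [h v (by simp [hvc, hv]), mark_of_ne _ hvc]
  have key' : ∀ ε, D.face U (mark s c ε) ⊆ D.face (insert c U) s := by
    intro ε S h v hv
    rw [Finset.mem_insert, not_or] at hv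
    rw [h v hv.2, mark_of_ne _ hv.1]
  ext S
  constructor
  · intro h
    rcases Int.units_eq_one_or (S.state c) with hS | hS
    exacts [Or.inl (key 1 S hS h), Or.inr (key (-1) S hS h)]
  · rintro (h | h)
    exacts [key' _ h, key' _ h]

omit [LinearOrder V] in
theorem disjoint_faces (hc : c ∉ U) :
    Disjoint (D.face U (mark s c 1)) (D.face U (mark s c (-1))) :=
  Set.disjoint_left.2 fun _ h h' => state_ne_of_faces h h' hc rfl

/-- The differential never raises a marker. -/
theorem not_arrow_faces (h0 : D.circles = 0) (hc : c ∉ U) {S S' : D.EnhancedState}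
    (hS : S ∈ D.face U (mark s c (-1))) (hS' : S' ∈ D.face U (mark s c 1)) : ¬ Arrow D.d S S' := by
  intro h
  have h1 := state_eq_of_mem_face hS hc
  have h2 := state_eq_of_mem_face hS' hc
  rcases arrow_state h0 h c with h3 | ⟨h3, -⟩
  · rw [h1, h2] at h3
    exact absurd h3 (by decide)
  · rw [h1] at h3
    exact absurd h3 (by decide)

/-- The differential never lowers the sign at a distinguished end. -/
theorem not_arrow_labelled (h0 : D.circles = 0) (halt : D.Alternating) {x : CrossingEnd V}
    {S S' : D.EnhancedState} (hS : S ∈ D.labelled x 1) (hS' : S' ∈ D.labelled x (-1)) :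
    ¬ Arrow D.d S S' := by
  intro h
  have h1 := arrow_lab h0 halt h hS
  rw [show S'.lab x = -1 from hS'] at h1
  exact absurd h1 (by decide)

omit [LinearOrder V] in
theorem disjoint_labelled (x : CrossingEnd V) : Disjoint (D.labelled x 1) (D.labelled x (-1)) :=
  Set.disjoint_left.2 fun S (h : S.lab x = 1) (h' : S.lab x = -1) => by
    rw [h] at h'
    exact absurd h' (by decide)

omit [LinearOrder V] in
theorem labelled_union (X : Set D.EnhancedState) (x : CrossingEnd V) :
    X = X ∩ D.labelled x 1 ∪ X ∩ D.labelled x (-1) := by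
  rw [← Set.inter_union_distrib_left, eq_comm, Set.inter_eq_left]
  exact fun S _ => Int.units_eq_one_or _

omit [LinearOrder V] in
/-- If the strands at `c` are never joined in a face, the circles at the two opposite ends can be
given their signs independently. -/
theorem relabel_mem_iff {k : Fin 4} (hne : ∀ S ∈ D.face U s,
      D.circleAt S.state (c, k) ≠ D.circleAt S.state (c, k + 2)) (S : D.EnhancedState) (ε : ℤˣ) :
    S.relabel (c, k + 2) ε ∈ D.face U s ∩ D.labelled (c, k) 1 ↔
      S ∈ D.face U s ∩ D.labelled (c, k) 1 := by
  refine and_congr_right fun hS => ?_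
  change (S.relabel (c, k + 2) ε).lab (c, k) = 1 ↔ S.lab (c, k) = 1
  rw [lab_relabel_of_ne (hne S hS)]

/-- If the strands at `c` are never joined after the positive smoothing, the differential merges
their circles. The enhanced states with two positive circles at `c` form a subcomplex, which is
isomorphic to the reduced complex of the negative smoothing; the quotient by it is the cone of an
isomorphism. -/
theorem exactOn_of_merge (h0 : D.circles = 0) (halt : D.Alternating) (hc : c ∉ U) {k : Fin 4}
    (hmerge : ∀ S ∈ D.face U (mark s c 1),
      D.circleAt S.state (c, k) ≠ D.circleAt S.state (c, k + 2)) {i j : ℤ}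
    (h : ExactOn D.d D.gr (D.face U (mark s c (-1)) ∩ D.labelled (c, k) 1) (i - 2) (j - 4)) :
    ExactOn D.d D.gr (D.face (insert c U) s ∩ D.labelled (c, k) 1) i j := by
  set P := D.face U (mark s c 1) ∩ D.labelled (c, k) 1 with hP
  set C := D.face U (mark s c (-1)) ∩ D.labelled (c, k) 1 with hC
  set A := P ∩ D.labelled (c, k + 2) 1 with hA
  set B := P ∩ D.labelled (c, k + 2) (-1) with hB
  have hX : D.face (insert c U) s ∩ D.labelled (c, k) 1 = A ∪ (B ∪ C) := by
    rw [face_insert, Set.union_inter_distrib_right, ← Set.union_assoc, hA, hB, ← labelled_union]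
  have hconv : Convex D.d (A ∪ (B ∪ C)) := by
    rw [← hX]
    exact (convex_face h0 _ _).inter (convex_labelled h0 halt _ _)
  have hAB : Disjoint A B :=
    (disjoint_labelled _).mono Set.inter_subset_right Set.inter_subset_right
  have hPC : Disjoint P C :=
    (disjoint_faces hc).mono Set.inter_subset_left Set.inter_subset_left
  have hdisj : Disjoint A (B ∪ C) :=
    Set.disjoint_union_right.2 ⟨hAB, hPC.mono_left Set.inter_subset_left⟩
  have hBC : Disjoint B C := hPC.mono_left Set.inter_subset_left
  -- merging two positive circles gives zero
  have harr : ∀ S ∈ A, ∀ S' ∈ B ∪ C, ¬ Arrow D.d S S' := by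
    rintro S hS S' (hS' | hS')
    · exact not_arrow_labelled h0 halt hS.2 hS'.2
    · intro h
      have hne := state_ne_of_faces hS.1.1 hS'.1 hc
      have := ((arrow_iff_incident hne).1 h).lab_of_merge h0 halt k (hmerge S hS.1.1)
      rw [show S.lab (c, k) = 1 from hS.1.2, show S.lab (c, k + 2) = 1 from hS.2,
        show S'.lab (c, k) = 1 from hS'.2] at this
      exact absurd this (by decide)
  have hCB : ∀ S ∈ C, ∀ S' ∈ B, ¬ Arrow D.d S S' := fun S hS S' hS' =>
    not_arrow_faces h0 hc hS.1 hS'.1.1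
  have hm : Matching D.d B C := matching_of_merge h0 halt hc hmerge
  have hd := d_d h0 halt
  have hconv' := hconv.quotient_of_union harr
  have hBex := hm.exactOn_left hd isGrading_gr hconv' hBC hCB h
  rw [sub_add_cancel] at hBex
  have hAex := (exactOn_relabel_iff h0 halt (c, k + 2) (relabel_mem_iff hmerge)).1 hBex
  rw [sub_add_cancel] at hAex
  rw [hX]
  exact ExactOn.union hd isGrading_gr hconv hdisj harr hAex
    (hm.exactOn_union hd isGrading_gr hconv' hBC hCB i j)

/-- If the strands at `c` are never joined after the negative smoothing, the differential splits
circles. The cone of the bijection `+ ↦ +, +` is a subcomplex; the quotient by it, where the second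
circle at `c` is negative, is isomorphic to the reduced complex of the positive smoothing. -/
theorem exactOn_of_split (h0 : D.circles = 0) (halt : D.Alternating) (hc : c ∉ U) {k : Fin 4}
    (hsplit : ∀ S ∈ D.face U (mark s c (-1)),
      D.circleAt S.state (c, k) ≠ D.circleAt S.state (c, k + 2)) {i j : ℤ}
    (h : ExactOn D.d D.gr (D.face U (mark s c 1) ∩ D.labelled (c, k) 1) (i + 2) (j + 4)) :
    ExactOn D.d D.gr (D.face (insert c U) s ∩ D.labelled (c, k) 1) i j := by
  set M := D.face U (mark s c (-1)) ∩ D.labelled (c, k) 1 with hM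
  set B := D.face U (mark s c 1) ∩ D.labelled (c, k) 1 with hB
  set C := M ∩ D.labelled (c, k + 2) 1 with hC
  set A := M ∩ D.labelled (c, k + 2) (-1) with hA
  have hX : D.face (insert c U) s ∩ D.labelled (c, k) 1 = (B ∪ C) ∪ A := by
    rw [face_insert, Set.union_inter_distrib_right, Set.union_assoc, hA, hC, ← labelled_union]
  have hconv : Convex D.d ((B ∪ C) ∪ A) := by
    rw [← hX]
    exact (convex_face h0 _ _).inter (convex_labelled h0 halt _ _)
  have hCA : Disjoint C A :=
    (disjoint_labelled _).mono Set.inter_subset_right Set.inter_subset_right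
  have hBM : Disjoint B M :=
    (disjoint_faces hc).mono Set.inter_subset_left Set.inter_subset_left
  have hdisj : Disjoint (B ∪ C) A :=
    Set.disjoint_union_left.2 ⟨hBM.mono_right Set.inter_subset_left, hCA⟩
  have hBC : Disjoint B C := hBM.mono_right Set.inter_subset_left
  -- splitting a positive circle gives two positive ones
  have harr : ∀ S ∈ B ∪ C, ∀ S' ∈ A, ¬ Arrow D.d S S' := by
    rintro S (hS | hS) S' hS'
    · intro h
      have hne := state_ne_of_faces hS.1 hS'.1.1 hc
      have hinc := (arrow_iff_incident hne).1 h
      have hjoin : D.circleAt S.state (c, k) = D.circleAt S.state (c, k + 2) :=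
        (circleAt_opposite_flip halt (fun v hv => (hinc.agree v hv).symm) hne.symm k).2
          (hsplit S' hS'.1.1)
      have := hinc.lab_of_split h0 halt k hjoin
      rw [show S.lab (c, k) = 1 from hS.2, show S'.lab (c, k + 2) = -1 from hS'.2,
        show S'.lab (c, k) = 1 from hS'.1.2] at this
      exact absurd this (by decide)
    · exact not_arrow_labelled h0 halt hS.2 hS'.2
  have hCB : ∀ S ∈ C, ∀ S' ∈ B, ¬ Arrow D.d S S' := fun S hS S' hS' =>
    not_arrow_faces h0 hc hS.1.1 hS'.1
  have hm : Matching D.d B C := matching_of_split h0 halt hc hsplit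
  have hd := d_d h0 halt
  have hconv' := hconv.sub_of_union harr
  have hCex := hm.exactOn_right hd isGrading_gr hconv' hBC hCB h
  have hAex := (exactOn_relabel_iff h0 halt (c, k + 2) (relabel_mem_iff hsplit)).2 hCex
  rw [hX]
  exact ExactOn.union hd isGrading_gr hconv hdisj harr
    (hm.exactOn_union hd isGrading_gr hconv' hBC hCB i j) hAex

/-- The long exact sequence of the two smoothings of a crossing. -/
theorem exactOn_of_smoothings (h0 : D.circles = 0) (halt : D.Alternating) (hc : c ∉ U)
    (x : CrossingEnd V) {i j : ℤ}
    (h1 : ExactOn D.d D.gr (D.face U (mark s c 1) ∩ D.labelled x 1) i j)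
    (h2 : ExactOn D.d D.gr (D.face U (mark s c (-1)) ∩ D.labelled x 1) i j) :
    ExactOn D.d D.gr (D.face (insert c U) s ∩ D.labelled x 1) i j := by
  have hX : D.face (insert c U) s ∩ D.labelled x 1 =
      D.face U (mark s c (-1)) ∩ D.labelled x 1 ∪ D.face U (mark s c 1) ∩ D.labelled x 1 := by
    rw [face_insert, Set.union_inter_distrib_right, Set.union_comm]
  have hconv := (convex_face h0 (insert c U) s).inter (convex_labelled h0 halt x 1)
  rw [hX] at hconv ⊢
  exact ExactOn.union (d_d h0 halt) isGrading_gr hconv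
    ((disjoint_faces hc).symm.mono Set.inter_subset_left Set.inter_subset_left)
    (fun S hS S' hS' => not_arrow_faces h0 hc hS.1 hS'.1) h2 h1

theorem sum_hi_mark (hc : c ∉ U) :
    ∑ v, (D.hi U (mark s c (-1)) v : ℤ) = ∑ v, (D.hi (insert c U) s v : ℤ) - 2 := by
  have h1 : D.hi (insert c U) s c = 1 := by simp [hi]
  have h2 : D.hi U (mark s c (-1)) = mark (D.hi (insert c U) s) c (-1) := by
    rw [hi_insert hc, hi_mark hc, hi_mark hc, mark_mark]
  rw [h2, sum_of_agree (s := D.hi (insert c U) s) (c := c) fun v hv => (mark_of_ne _ hv _).symm,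
    h1, mark_self]
  push_cast
  ring

/-- The reduced homology of a connected planar alternating diagram lies on one diagonal. Here the
subcomplex is considered in which the circle through a base point `p` is positive. -/
theorem exactOn_reduced (h0 : D.circles = 0) (halt : D.Alternating) (n : ℕ) :
    ∀ (U : Finset V) (s : D.State), U.card = n → D.ConnectedPlanar U s →
    ∀ (p : CrossingEnd V) (i j : ℤ),
      j - 2 * i ≠ 2 * D.numCircles (D.hi U s) - ∑ v, (D.hi U s v : ℤ) →
      ExactOn D.d D.gr (D.face U s ∩ D.labelled p 1) i j := by
  induction n with
  | zero =>
    intro U s hU hcp p i j hij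
    obtain rfl : U = ∅ := Finset.card_eq_zero.1 hU
    have h1 : D.hi ∅ s = s := by funext v; simp [hi]
    have h2 : D.lo ∅ s = s := by funext v; simp [lo]
    have hpl := hcp.planar
    rw [h1, h2, Finset.card_empty] at hpl
    have hone : D.numCircles s = 1 := by omega
    rw [h1, hone] at hij
    -- all crossings are smoothed: there is a single circle, and it is positive
    refine exactOn_of_isEmpty fun S hS hgr => hij ?_
    have hst : S.state = s := funext fun v => hS.1 v (by simp)
    have hσ : S.σ = ∑ v, (s v : ℤ) := by rw [← hst]; rfl
    have hτ : S.τ = 1 := by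
      rw [← hst] at hone
      have hsub := (Nat.card_eq_one_iff_unique.1 hone).1
      have : S.τ = ∑ᶠ c, (S.sign c : ℤ) := rfl
      have : Unique (D.Circle S.state) := ⟨⟨D.circleAt S.state p⟩, fun _ => Subsingleton.elim _ _⟩
      have hsign : ∀ C, (S.sign C : ℤ) = 1 := fun C => by
        rw [Subsingleton.elim C (D.circleAt S.state p), show S.sign _ = 1 from hS.2]
        rfl
      rw [‹S.τ = _›, finsum_unique, hsign]
    obtain ⟨hi', hj'⟩ := hgr
    rw [← hj', ← hi', hτ, hσ]
    push_cast
    ring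
  | succ n ih =>
    intro U s hU hcp p i j hij
    obtain ⟨c, hcU, k, hk⟩ := exists_crossing_on_circle halt hcp.connected
      (Finset.card_pos.1 (by omega)) p
    -- move the base point to the crossing `c`
    have hbase : D.face U s ∩ D.labelled p 1 = D.face U s ∩ D.labelled (c, k) 1 := by
      ext S
      refine and_congr_right fun hS => ?_
      change S.lab p = 1 ↔ S.lab (c, k) = 1
      rw [lab_congr (hk S.state hS)]
    rw [hbase]
    obtain ⟨U', hc, rfl⟩ : ∃ U', c ∉ U' ∧ insert c U' = U :=
      ⟨U.erase c, Finset.notMem_erase _ _, Finset.insert_erase hcU⟩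
    rw [Finset.card_insert_of_notMem hc] at hU
    have hσ := sum_hi_mark (D := D) (s := s) hc
    rcases hcp.smooth h0 halt hc with ⟨hp, hm, hn⟩ | ⟨hp, hne⟩ | ⟨hm, hn, hne⟩
    · refine exactOn_of_smoothings h0 halt hc _ (ih U' _ (by omega) hp _ i j ?_)
        (ih U' _ (by omega) hm _ i j ?_)
      · rwa [← hi_insert hc]
      · rw [hσ]
        omega
    · refine exactOn_of_split h0 halt hc (fun S hS h => hne S.state hS
        ((circleAt_opposite_iff _ _ _ _).1 h)) (ih U' _ (by omega) hp _ _ _ ?_)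
      rw [← hi_insert hc]
      omega
    · refine exactOn_of_merge h0 halt hc (fun S hS h => hne S.state hS
        ((circleAt_opposite_iff _ _ _ _).1 h)) (ih U' _ (by omega) hm _ _ _ ?_)
      rw [hσ]
      omega

end Reduced

end LinkDiagram

/-! ### Regions of the diagram and the two diagonals -/

namespace LinkDiagram

open CrossingEnd EnhancedState BasedComplex

variable {V : Type u} [Fintype V] {D : LinkDiagram V}

section Regions

omit [Fintype V] in
theorem isOver_next (x : CrossingEnd V) : IsOver (next x) ↔ ¬ IsOver x := by
  obtain ⟨v, k⟩ := x
  unfold IsOver next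
  fin_cases k <;> simp

omit [Fintype V] in
/-- The positive smoothing joins a lower end to the next end, as in the boundary of a region. -/
theorem next_of_not_isOver {x : CrossingEnd V} (h : ¬ IsOver x) :
    next x = (x.1, smoothing 1 x.2) := by
  obtain ⟨v, k⟩ := x
  unfold IsOver at h
  unfold next smoothing
  fin_cases k <;> simp at h ⊢

omit [Fintype V] in
/-- The negative smoothing joins an upper end to the next end, as in the boundary of a region. -/
theorem next_of_isOver {x : CrossingEnd V} (h : IsOver x) :
    next x = (x.1, smoothing (-1) x.2) := by
  obtain ⟨v, k⟩ := x
  unfold IsOver at h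
  have h1 : (-1 : ℤˣ) ≠ 1 := by decide
  unfold next smoothing
  rw [if_neg h1]
  fin_cases k <;> simp at h ⊢

theorem region_eq (x : CrossingEnd V) :
    (Quot.mk _ x : Region D.edge) = Quot.mk _ (next (D.edge x)) := Quot.sound rfl

theorem arcCircle_edge (s : D.State) (x : CrossingEnd V) :
    (Quot.mk _ x : D.ArcCircle s) = Quot.mk _ (D.edge x) := Quot.sound (Or.inl rfl)

theorem arcCircle_smoothing (s : D.State) (x : CrossingEnd V) :
    (Quot.mk _ x : D.ArcCircle s) = Quot.mk _ (x.1, smoothing (s x.1) x.2) :=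
  Quot.sound (Or.inr rfl)

open Classical in
/-- The checkerboard colouring: the boundary of a region of an alternating diagram runs through
upper ends and is a circle of `s_+`, or through lower ends and is a circle of `s_-`. -/
noncomputable def regionEquiv (halt : D.Alternating) :
    Region D.edge ≃ D.ArcCircle D.posState ⊕ D.ArcCircle D.negState where
  toFun := Quot.lift
    (fun x => if IsOver x then Sum.inl (Quot.mk _ x) else Sum.inr (Quot.mk _ x)) (by
      rintro x y rfl
      have h1 := halt x
      by_cases h : IsOver x
      · have h2 : ¬ IsOver (D.edge x) := fun h' => h1.1 h' h
        rw [if_pos h, if_pos ((isOver_next _).2 h2), next_of_not_isOver h2]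
        exact congrArg Sum.inl ((arcCircle_edge _ x).trans (arcCircle_smoothing D.posState _))
      · have h2 : IsOver (D.edge x) := h1.2 h
        rw [if_neg h, if_neg (fun h' => (isOver_next _).1 h' h2), next_of_isOver h2]
        exact congrArg Sum.inr ((arcCircle_edge _ x).trans (arcCircle_smoothing D.negState _)))
  invFun := Sum.elim
    (Quot.lift (fun x => Quot.mk _ (if IsOver x then x else D.edge x)) (by
      have key : ∀ x : CrossingEnd V, ¬ IsOver x → (Quot.mk _ (D.edge x) : Region D.edge)
          = Quot.mk _ (x.1, smoothing 1 x.2) := fun x h => by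
        rw [region_eq (D.edge x), D.edge_edge, next_of_not_isOver h]
      rintro x y (rfl | rfl)
      · have h1 := halt x
        by_cases h : IsOver x
        · rw [if_pos h, if_neg (fun h' => h1.1 h' h), D.edge_edge]
        · rw [if_neg h, if_pos (h1.2 h)]
      · change _ = Quot.mk _ (if IsOver (x.1, smoothing 1 x.2) then (x.1, smoothing 1 x.2)
          else D.edge (x.1, smoothing 1 x.2))
        by_cases h : IsOver x
        · have h' : ¬ IsOver (x.1, smoothing 1 x.2) := by
            rw [isOver_smoothing, not_not]; exact h
          rw [if_pos h, if_neg h', key _ h']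
          simp only [smoothing_smoothing]
        · rw [if_neg h, if_pos ((isOver_smoothing _ _ _).2 h), key x h]))
    (Quot.lift (fun x => Quot.mk _ (if IsOver x then D.edge x else x)) (by
      have key : ∀ x : CrossingEnd V, IsOver x → (Quot.mk _ (D.edge x) : Region D.edge)
          = Quot.mk _ (x.1, smoothing (-1) x.2) := fun x h => by
        rw [region_eq (D.edge x), D.edge_edge, next_of_isOver h]
      rintro x y (rfl | rfl)
      · have h1 := halt x
        by_cases h : IsOver x
        · rw [if_pos h, if_neg (fun h' => h1.1 h' h)]
        · rw [if_neg h, if_pos (h1.2 h), D.edge_edge]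
      · change _ = Quot.mk _ (if IsOver (x.1, smoothing (-1) x.2)
          then D.edge (x.1, smoothing (-1) x.2) else (x.1, smoothing (-1) x.2))
        by_cases h : IsOver x
        · have h' : ¬ IsOver (x.1, smoothing (-1) x.2) := by
            rw [isOver_smoothing, not_not]; exact h
          rw [if_pos h, if_neg h', key x h]
        · have h' : IsOver (x.1, smoothing (-1) x.2) := (isOver_smoothing _ _ _).2 h
          rw [if_neg h, if_pos h', key _ h']
          simp only [smoothing_smoothing]))
  left_inv := by
    rintro ⟨x⟩
    change Sum.elim _ _ (if IsOver x then (Sum.inl (Quot.mk _ x) :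
      D.ArcCircle D.posState ⊕ D.ArcCircle D.negState) else Sum.inr (Quot.mk _ x)) = _
    by_cases h : IsOver x
    · rw [if_pos h]
      change Quot.mk _ (if IsOver x then x else D.edge x) = _
      rw [if_pos h]
    · rw [if_neg h]
      change Quot.mk _ (if IsOver x then D.edge x else x) = _
      rw [if_neg h]
  right_inv := by
    rintro (⟨⟨x⟩⟩ | ⟨⟨x⟩⟩)
    · change (if IsOver (if IsOver x then x else D.edge x) then (Sum.inl (Quot.mk _ _) :
        D.ArcCircle D.posState ⊕ D.ArcCircle D.negState) else Sum.inr (Quot.mk _ _)) = _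
      by_cases h : IsOver x
      · rw [if_pos h, if_pos h]
      · rw [if_neg h, if_pos ((halt x).2 h)]
        exact congrArg Sum.inl (arcCircle_edge _ x).symm
    · change (if IsOver (if IsOver x then D.edge x else x) then (Sum.inl (Quot.mk _ _) :
        D.ArcCircle D.posState ⊕ D.ArcCircle D.negState) else Sum.inr (Quot.mk _ _)) = _
      by_cases h : IsOver x
      · rw [if_pos h, if_neg (fun h' => (halt x).1 h' h)]
        exact congrArg Sum.inr (arcCircle_edge _ x).symm
      · rw [if_neg h, if_neg h]

instance (s : D.State) : Finite (D.ArcCircle s) := inferInstanceAs (Finite (Quot _))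

theorem numCircles_eq (s : D.State) :
    D.numCircles s = Nat.card (D.ArcCircle s) + D.circles := by
  unfold numCircles Circle
  rw [Nat.card_sum, Nat.card_fin]

theorem card_region (halt : D.Alternating) : Nat.card (Region D.edge)
    = Nat.card (D.ArcCircle D.posState) + Nat.card (D.ArcCircle D.negState) := by
  rw [Nat.card_congr (regionEquiv halt), Nat.card_sum]

theorem graphComponent_of_nonSplit [Nonempty V] (h : D.NonSplit) :
    D.circles = 0 ∧ Nat.card (GraphComponent D.edge) = 1 := by
  have : Finite (GraphComponent D.edge) := inferInstanceAs (Finite (Quot _))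
  have : Nonempty (GraphComponent D.edge) := ⟨Quot.mk _ (Classical.arbitrary V, 0)⟩
  have h1 : Nat.card (GraphComponent D.edge) ≠ 0 := Nat.card_pos.ne'
  unfold NonSplit Piece at h
  rw [Nat.card_sum, Nat.card_fin] at h
  omega

/-- Euler's formula, in terms of the two extreme states. -/
theorem numCircles_add_eq (halt : D.Alternating) (h : D.circles = 0)
    (hG : Nat.card (GraphComponent D.edge) = 1) :
    D.numCircles D.posState + D.numCircles D.negState = Fintype.card V + 2 := by
  have hpl := D.planar
  rw [card_region halt, hG] at hpl
  rw [numCircles_eq, numCircles_eq, h]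
  push_cast at hpl
  omega

theorem connectedPlanar_univ [DecidableEq V] (halt : D.Alternating) (h : D.circles = 0)
    (hG : Nat.card (GraphComponent D.edge) = 1) :
    D.ConnectedPlanar Finset.univ D.posState where
  connected := by
    have := (Nat.card_eq_one_iff_unique.1 hG).1
    refine ⟨fun C C' => ?_⟩
    obtain ⟨x, rfl⟩ := compAt_surjective C
    obtain ⟨y, rfl⟩ := compAt_surjective C'
    have hxy := this.elim (Quot.mk _ x : GraphComponent D.edge) (Quot.mk _ y)
    refine congrArg (Quot.lift (D.compAt Finset.univ D.posState) ?_) hxy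
    rintro ⟨x, k⟩ ⟨y, l⟩ (h | h)
    · obtain rfl : y = x := h
      exact compAt_crossing (Finset.mem_univ _) _ _
    · rw [h, compAt_edge]
  planar := by
    have h1 : D.hi Finset.univ D.posState = D.posState := by funext v; simp [hi, posState]
    have h2 : D.lo Finset.univ D.posState = D.negState := by funext v; simp [lo, negState]
    rw [h1, h2, numCircles_add_eq halt h hG, Finset.card_univ]

end Regions

section Homology

variable [LinearOrder V]

theorem not_nontrivial_of_exactOn {A : Set D.EnhancedState} (hA : ∀ S, S ∈ A) {i j : ℤ}
    (h : ExactOn D.d D.gr A i j) : ¬ Nontrivial (D.H i j) := by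
  rw [not_nontrivial_iff_subsingleton, Submodule.Quotient.subsingleton_iff,
    Submodule.submoduleOf_eq_top]
  obtain rfl : A = Set.univ := Set.eq_univ_of_forall hA
  have hdiff : ∀ z, diff D.d Set.univ z = D.d z := fun z => cut_of_mem (by simp)
  rintro z ⟨hz, hz0⟩
  obtain ⟨w, hw, hwz⟩ := h z (by rw [Set.univ_inter]; exact hz) (by rw [hdiff]; exact hz0)
  rw [Set.univ_inter] at hw
  exact ⟨w, hw, by rw [← hdiff, hwz]⟩

/-- The whole complex is an extension of two copies of the reduced one, whose bidegrees differ by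
`(0, 4)`. -/
theorem diagonals_of_nonempty [Nonempty V] (hsplit : D.NonSplit) (halt : D.Alternating) :
    2 * (D.numCircles D.posState : ℤ) - Fintype.card V
        = Fintype.card V - 2 * D.numCircles D.negState + 4 ∧
      ∀ i j : ℤ, Nontrivial (D.H i j) →
        j - 2 * i = Fintype.card V - 2 * D.numCircles D.negState ∨
          j - 2 * i = 2 * D.numCircles D.posState - Fintype.card V := by
  obtain ⟨h0, hG⟩ := graphComponent_of_nonSplit hsplit
  have hcount := numCircles_add_eq halt h0 hG
  refine ⟨by omega, fun i j => ?_⟩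
  contrapose!
  rintro ⟨hlow, hhigh⟩
  rw [← not_nontrivial_iff_subsingleton]
  set X : Set D.EnhancedState := D.face Finset.univ D.posState with hX
  have hXall : ∀ S, S ∈ X := fun S v hv => absurd (Finset.mem_univ v) hv
  set p : CrossingEnd V := (Classical.arbitrary V, 0)
  have hhi : D.hi Finset.univ D.posState = D.posState := by funext v; simp [hi, posState]
  have hred : ∀ i j : ℤ, j - 2 * i ≠ 2 * D.numCircles D.posState - Fintype.card V →
      ExactOn D.d D.gr (X ∩ D.labelled p 1) i j := by
    intro i j hij
    refine exactOn_reduced h0 halt _ Finset.univ D.posState rfl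
      (connectedPlanar_univ halt h0 hG) p i j ?_
    rw [hhi]
    simpa [posState] using hij
  have hquot : ExactOn D.d D.gr (X ∩ D.labelled p (-1)) i j :=
    (exactOn_relabel_iff h0 halt p fun S ε => iff_of_true (hXall _) (hXall _)).2
      (hred i (j + 4) (by omega))
  have hconv : Convex D.d (X ∩ D.labelled p 1 ∪ X ∩ D.labelled p (-1)) := by
    rw [← labelled_union]
    exact convex_face h0 _ _
  have := ExactOn.union (d_d h0 halt) isGrading_gr hconv
    ((disjoint_labelled p).mono Set.inter_subset_right Set.inter_subset_right)
    (fun S hS S' hS' => not_arrow_labelled h0 halt hS.2 hS'.2) (hred i j hhigh) hquot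
  rw [← labelled_union] at this
  exact not_nontrivial_of_exactOn hXall this

/-- The crossingless diagram of the unknot. -/
theorem diagonals_of_isEmpty [IsEmpty V] (hsplit : D.NonSplit) :
    2 * (D.numCircles D.posState : ℤ) - Fintype.card V
        = Fintype.card V - 2 * D.numCircles D.negState + 4 ∧
      ∀ i j : ℤ, Nontrivial (D.H i j) →
        j - 2 * i = Fintype.card V - 2 * D.numCircles D.negState ∨
          j - 2 * i = 2 * D.numCircles D.posState - Fintype.card V := by
  have hG : IsEmpty (GraphComponent D.edge) := ⟨by rintro ⟨x⟩; exact isEmptyElim x.1⟩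
  have hc : D.circles = 1 := by
    unfold NonSplit Piece at hsplit
    rwa [Nat.card_sum, Nat.card_fin, Nat.card_of_isEmpty, zero_add] at hsplit
  have hnum : ∀ s, D.numCircles s = 1 := by
    intro s
    have : IsEmpty (D.ArcCircle s) := ⟨by rintro ⟨x⟩; exact isEmptyElim x.1⟩
    rw [numCircles_eq, hc, Nat.card_of_isEmpty]
  rw [hnum, hnum, Fintype.card_eq_zero]
  refine ⟨by norm_num, fun i j hH => ?_⟩
  by_contra hcon
  refine not_nontrivial_of_exactOn (A := Set.univ) (fun _ => trivial)
    (exactOn_of_isEmpty fun S _ hS => hcon ?_) hH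
  obtain ⟨hi', hj'⟩ := hS
  have hσ : S.σ = 0 := by simp [σ]
  have hu := Nat.card_eq_one_iff_unique.1 (hnum S.state)
  have hsub := hu.1
  obtain ⟨C⟩ := hu.2
  have hun : Unique (D.Circle S.state) := ⟨⟨C⟩, fun _ => Subsingleton.elim _ _⟩
  have hτ : S.τ = S.sign default := finsum_unique _
  rw [← hj', ← hi', hσ, hτ]
  rcases Int.units_eq_one_or (S.sign default) with h | h <;> rw [h] <;> simp

end Homology

end LinkDiagram

theorem corollary5p5 {V : Type*} [Fintype V] [LinearOrder V] (D : LinkDiagram V)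
    (hsplit : D.NonSplit) (halt : D.Alternating) (hnug : ∀ v, ¬ D.Nugatory v) :
    D.HThickPair 0 0 ∧ D.HThick 1 ∧
      (2 * (D.numCircles D.posState : ℤ) - Fintype.card V
          = Fintype.card V - 2 * D.numCircles D.negState + 4 ∧
        ∀ i j : ℤ, Nontrivial (D.H i j) →
          j - 2 * i = Fintype.card V - 2 * D.numCircles D.negState ∨
            j - 2 * i = 2 * D.numCircles D.posState - Fintype.card V) := by
  have key : 2 * (D.numCircles D.posState : ℤ) - Fintype.card V
          = Fintype.card V - 2 * D.numCircles D.negState + 4 ∧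
        ∀ i j : ℤ, Nontrivial (D.H i j) →
          j - 2 * i = Fintype.card V - 2 * D.numCircles D.negState ∨
            j - 2 * i = 2 * D.numCircles D.posState - Fintype.card V := by
    rcases isEmpty_or_nonempty V with h | h
    exacts [D.diagonals_of_isEmpty hsplit, D.diagonals_of_nonempty hsplit halt]
  have hthick : D.HThickPair 0 0 := by
    intro i j hH
    have h1 := key.1
    rcases key.2 i j hH with h | h <;> constructor <;> omega
  refine ⟨hthick, ⟨0, 0, hthick, ?_⟩, key⟩
  have h1 : (D.numCircles D.posState : ℚ) + D.numCircles D.negState = Fintype.card V + 2 := by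
    have : D.numCircles D.posState + D.numCircles D.negState = Fintype.card V + 2 := by
      have := key.1
      omega
    exact_mod_cast this
  rw [h1]
  norm_num
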